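/- Let $0<R\le\log 2$ (natural logarithms) and $T\in\mathbb R$. For $\theta\in[0,1]$ let $W_\theta$ be the binary symmetric channel with crossover probability $\theta$, used $n$ times ($n$ even). A code $\mathcal C$ consists of $M=\lceil e^{nR}\rceil$ codewords $x_1,\dots,x_M$ drawn independently and uniformly from the binary words with exactly $n/2$ ones (type $(1/2,1/2)$). A decoder is a family $\mathcal R=(\mathcal R_1,\dots,\mathcal R_M)$ of subsets of $\{0,1\}^n$, pairwise disjoint if $T\ge0$ (erasure mode) and arbitrary if $T<0$ (list mode). Put $$\Pr\{\mathcal E_1\}=\tfrac1M\sum_m\sum_{y\notin\mathcal R_m}W_\theta(y|x_m),\qquad \Pr\{\mathcal E_2\}=\tfrac1M\sum_m\sum_{y\in\mathcal R_m}\sum_{m'\ne m}W_\theta(y|x_{m'}),\qquad \Gamma_\theta(\mathcal C,\mathcal R)=\Pr\{\mathcal E_2\}+e^{-nT}\Pr\{\mathcal E_1\}.$$ Let $E_1(R,T,\theta)\in[0,\infty]$ be $-\liminf_n\frac1n\log$ of the ensemble average of $\Pr\{\mathcal E_1\}$ for Forney's decoder $\mathcal R_m=\{y: W_\theta(y|x_m)>e^{nT}\sum_{m'\ne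 m}W_\theta(y|x_{m'})\}$ (ties are erased). For $\xi\in[0,1]$ let $$\bar K_n=\mathbb E\Big[\min_{\mathcal R}\max_{0\le\theta\le1}\frac{\Gamma_\theta(\mathcal C,\mathcal R)}{e^{-n(\xi E_1(R,T,\theta)+T)}}\Big],$$ and let $\xi^*(R,T)$ be the largest $\xi\in[0,1]$ with $\limsup_n\frac1n\log\bar K_n\le0$. Let $h$ be the binary entropy, $D(q\|\theta)$ the binary divergence, $\beta(\theta)=\log\frac{1-\theta}{\theta}$, $|x|^+=\max\{0,x\}$, and let $\delta=\delta_{GV}(R)$ be the smaller solution of $h(\delta)=\log2-R$. Expressions $\log(1-\theta)-q\beta(\theta)$ mean $q\log\theta+(1-q)\log(1-\theta)$, with $0\log0=0$; maxima and minima are suprema and infima in $[-\infty,\infty]$, with $\min\emptyset=+\infty$, $0\cdot\infty=0$, $\infty-\infty=-\infty$ and $h(\pm\infty)=0$ (the last two matter only for $T<0$). Variables $q,\tilde q$ range over $[0,1]$. For $0<\theta<\frac12$ let $E_{1,\rm BSC}(R,T,\theta)=\min\{E_a,E_b\}$ with $$E_a=\min_{\tilde q\in[\theta,\,\delta-T/\beta(\theta)],\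 \tilde q+T/\beta(\theta)\ge0}\Big[D(\tilde q\|\theta)-h\big(\tilde q+\tfrac T{\beta(\theta)}\big)+\log2-R\Big],\qquad E_b=\min_{\tilde q\in\hat{\mathcal L}}D(\tilde q\|\theta),$$ $$\hat{\mathcal L}=\Big\{\tilde q:\ -\tilde q\beta(\theta)\le R+T+\max_{q:\,R\ge\log2-h(q)}[-q\beta(\theta)+h(q)-\log2]\Big\}.$$ Let $E_{1,\rm BSC}(R,T,\theta)=E_{1,\rm BSC}(R,T,1-\theta)$ for $\frac12<\theta<1$. For $\theta\in\{0,1\}$ it is $\log2-R$ if $T\ge0$ and $+\infty$ if $T<0$; for $\theta=\frac12$ it is $0$ if $R+T>0$ and $+\infty$ otherwise. For given $\xi$ and $\tilde q$ let, for $0<\theta<1$, $\theta\ne\frac12$, $$\phi(\theta)=\frac{\xi E_{1,\rm BSC}(R,T,\theta)+\log(1-\theta)+T-\max_{0\le\theta'\le1}\{\xi E_{1,\rm BSC}(R,T,\theta')+\log(1-\theta')-\beta(\theta')\tilde q\}}{\beta(\theta)},$$ $q_1^*=\max_{0<\theta<1/2}\phi(\theta)$, $q_2^*=\min_{1/2<\theta<1}\phi(\theta)$,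 and let $g(q_1^*,q_2^*)=\log2$ if $q_1^*>\frac12$ or $q_2^*<\frac12$, and $g(q_1^*,q_2^*)=\max\{h(q_1^*),h(q_2^*)\}$ otherwise. Let $q_\theta=\min\{\max\{\theta,\delta\},1-\delta\}$ and $$\mathcal L_{\rm BSC}=\Big\{\tilde q:\ \max_{0\le\theta\le1}[\xi E_{1,\rm BSC}(R,T,\theta)-\tilde q\beta(\theta)+\log(1-\theta)]\le R+T+\max_{0\le\theta\le1}[\xi E_{1,\rm BSC}(R,T,\theta)-q_\theta\beta(\theta)+\log(1-\theta)+h(q_\theta)-\log2]\Big\}.$$ Then $\xi^*(R,T)$ exists and equals the largest $\xi\in[0,1]$ that satisfies simultaneously $$\max_{0\le\theta\le1}\Big\{\xi E_{1,\rm BSC}(R,T,\theta)-\min_{\tilde q}\big[D(\tilde q\|\theta)+|-g(q_1^*,q_2^*)+\log2-R|^+\big]\Big\}\le0$$ and $$\max_{0\le\theta\le1}\Big\{\xi E_{1,\rm BSC}(R,T,\theta)-\min_{\tilde q\in\mathcal L_{\rm BSC}}D(\tilde q\|\theta)\Big\}\le0.$$ -/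

import Mathlib

open Filter Set
open scoped ENNReal

noncomputable section

namespace ErasureBSC

/-! ### Codes, channels and decoders -/

/-- Binary words of length `n`. -/
abbrev Word (n : ℕ) : Type := Fin n → Bool

/-- The type class of the composition `(1/2, 1/2)`: words with as many ones as zeros. -/
abbrev BalancedWord (n : ℕ) : Type :=
  {x : Word n // 2 * (Finset.univ.filter fun i => x i = true).card = n}

/-- The number of codewords `M = ⌈e^{nR}⌉`. -/
def codeSize (R : ℝ) (n : ℕ) : ℕ := ⌈Real.exp (n * R)⌉₊

/-- A codebook of `M` codewords (repetitions allowed) of composition `(1/2, 1/2)`. -/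
abbrev Codebook (M n : ℕ) : Type := Fin M → BalancedWord n

/-- `W_θ(y | x)` for `n` uses of the binary symmetric channel with crossover probability `θ`. -/
def chan (θ : ℝ) {n : ℕ} (x y : Word n) : ℝ :=
  ∏ i, if y i = x i then 1 - θ else θ

/-- Decoding regions `R_1, …, R_M`; the erasure region `R_0` is the complement of their union. -/
abbrev Regions (M n : ℕ) : Type := Fin M → Finset (Word n)

/-- In the erasure mode `T ≥ 0` the regions have to be disjoint; in the list mode `T < 0` they are
arbitrary. -/
def IsDecoder (T : ℝ) {M n : ℕ} (D : Regions M n) : Prop :=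
  0 ≤ T → Pairwise fun m m' => Disjoint (D m) (D m')

/-- `Pr{E₁}`: the transmitted message is not decided on. -/
def prE1 (θ : ℝ) {M n : ℕ} (C : Codebook M n) (D : Regions M n) : ℝ :=
  1 / (M : ℝ) * ∑ m, ∑ y ∈ (D m)ᶜ, chan θ (C m).1 y

/-- `Pr{E₂}`: undetected error (for list decoding: average number of incorrect messages listed). -/
def prE2 (θ : ℝ) {M n : ℕ} (C : Codebook M n) (D : Regions M n) : ℝ :=
  1 / (M : ℝ) * ∑ m, ∑ y ∈ D m, ∑ m' ∈ Finset.univ.erase m, chan θ (C m').1 y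

/-- The Lagrangian `Γ_θ(C, D) = Pr{E₂} + e^{-nT} Pr{E₁}`. -/
def Gam (T θ : ℝ) {M n : ℕ} (C : Codebook M n) (D : Regions M n) : ℝ :=
  prE2 θ C D + Real.exp (-(n * T)) * prE1 θ C D

open Classical in
/-- Forney's optimal decoder for the known channel `W_θ` with threshold `T`. Ties are erased, so
that the regions are disjoint for every `T ≥ 0`. -/
def forney (T θ : ℝ) {M n : ℕ} (C : Codebook M n) : Regions M n := fun m =>
  Finset.univ.filter fun y =>
    Real.exp (n * T) * ∑ m' ∈ Finset.univ.erase m, chan θ (C m').1 y < chan θ (C m).1 y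

/-- The ensemble average of `Pr{E₁}` for Forney's decoder: the codewords are independent and
uniform on the type class. -/
def avgE1 (R T θ : ℝ) (n : ℕ) : ℝ :=
  (∑ C : Codebook (codeSize R n) n, prE1 θ C (forney T θ C)) /
    (Fintype.card (Codebook (codeSize R n) n) : ℝ)

/-- The exponent `E₁(R, T, θ) = - liminf n⁻¹ log avgE1`, along the even blocklengths `n = 2k`, the
only ones with balanced words; it is `⊤` if the average vanishes superexponentially. -/
def expE1 (R T θ : ℝ) : EReal :=
  -liminf (fun k : ℕ =>
    ENNReal.log (ENNReal.ofReal (avgE1 R T θ (2 * k))) / ((2 * k : ℕ) : EReal)) atTop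

/-! ### The competitive minimax criterion over `Θ = [0, 1]` -/

/-- `K_n(D, C) = max_θ Γ_θ(C, D) / e^{-n (ξ E₁(R, T, θ) + T)}`. -/
def KnD (R T ξ : ℝ) {M n : ℕ} (C : Codebook M n) (D : Regions M n) : ℝ≥0∞ :=
  ⨆ θ ∈ Icc (0 : ℝ) 1, ENNReal.ofReal (Gam T θ C D) /
    EReal.exp (-((n : EReal) * ((ξ : EReal) * expE1 R T θ + (T : EReal))))

/-- `K_n(C)`, the minimum of `K_n(D, C)` over all decoders `D`. -/
def Kn (R T ξ : ℝ) {M n : ℕ} (C : Codebook M n) : ℝ≥0∞ :=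
  ⨅ (D : Regions M n) (_ : IsDecoder T D), KnD R T ξ C D

/-- The ensemble average of `K_n(C)`. -/
def avgKn (R T ξ : ℝ) (n : ℕ) : ℝ≥0∞ :=
  (∑ C : Codebook (codeSize R n) n, Kn R T ξ C) /
    (Fintype.card (Codebook (codeSize R n) n) : ℝ≥0∞)

/-- The fraction `ξ` is achievable: the average of `K_n(C)` does not grow exponentially. -/
def Achievable (R T ξ : ℝ) : Prop :=
  limsup (fun k : ℕ => ENNReal.log (avgKn R T ξ (2 * k)) / ((2 * k : ℕ) : EReal)) atTop ≤ 0

/-- `ξ*(R, T)`, the largest achievable fraction in `[0, 1]`. -/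
def xiStar (R T : ℝ) : ℝ := sSup {ξ : ℝ | ξ ∈ Icc (0 : ℝ) 1 ∧ Achievable R T ξ}

/-! ### Single-letter quantities -/

/-- Logarithm of a nonnegative real with `log 0 = -∞`. -/
def elog (x : ℝ) : EReal := ENNReal.log (ENNReal.ofReal x)

/-- `β(θ) = log ((1 - θ) / θ)`, used for `0 < θ < 1` only. -/
def beta (θ : ℝ) : ℝ := Real.log ((1 - θ) / θ)

/-- `log (1 - θ) - q β(θ) = q log θ + (1 - q) log (1 - θ)`, in the second form, which also makes
sense for `θ = 0` and `θ = 1` (with `0 · log 0 = 0`). -/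
def logLik (q θ : ℝ) : EReal := (q : EReal) * elog θ + ((1 - q : ℝ) : EReal) * elog (1 - θ)

/-- The binary divergence `D(q ‖ θ)`, possibly `⊤`. -/
def divB (q θ : ℝ) : EReal := ((-Real.binEntropy q : ℝ) : EReal) - logLik q θ

/-- The Gilbert–Varshamov distance: the smallest `δ ∈ [0, 1]` with `h(δ) = log 2 - R`. -/
def deltaGV (R : ℝ) : ℝ :=
  sInf {δ : ℝ | δ ∈ Icc (0 : ℝ) 1 ∧ Real.binEntropy δ = Real.log 2 - R}

/-- `E_{a,BSC}`, for `0 < θ < 1/2`: the minimum over `q ∈ [θ, δ_GV(R) - T/β(θ)]` for which `q` and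
`q + T/β(θ)` are probabilities (`⊤` if there is none). -/
def EaBSC (R T θ : ℝ) : EReal :=
  ⨅ q ∈ {q : ℝ | q ∈ Icc θ (deltaGV R - T / beta θ) ∧ q ≤ 1 ∧ 0 ≤ q + T / beta θ},
    divB q θ + ((-Real.binEntropy (q + T / beta θ) + Real.log 2 - R : ℝ) : EReal)

/-- The region `𝓛̂_BSC`, for `0 < θ < 1/2`. -/
def LhatBSC (R T θ : ℝ) : Set ℝ :=
  {q | q ∈ Icc (0 : ℝ) 1 ∧ ((-q * beta θ : ℝ) : EReal) ≤ ((R + T : ℝ) : EReal) +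
    ⨆ p ∈ {p : ℝ | p ∈ Icc (0 : ℝ) 1 ∧ Real.log 2 - Real.binEntropy p ≤ R},
      ((-p * beta θ + Real.binEntropy p - Real.log 2 : ℝ) : EReal)}

/-- `E_{b,BSC}`, for `0 < θ < 1/2`. -/
def EbBSC (R T θ : ℝ) : EReal := ⨅ q ∈ LhatBSC R T θ, divB q θ

/-- `E_{1,BSC}(R, T, θ)`. A crossover probability above `1/2` is replaced by `1 - θ`; the three
values of `θ` for which `β(θ)` is `0` or infinite are given separately: the noiseless channel
(`θ = 0, 1`) and the useless one (`θ = 1/2`). -/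
def E1BSC (R T θ : ℝ) : EReal :=
  if θ = 0 ∨ θ = 1 then (if 0 ≤ T then ((Real.log 2 - R : ℝ) : EReal) else ⊤)
  else if θ = 1 / 2 then (if 0 < R + T then 0 else ⊤)
  else min (EaBSC R T (min θ (1 - θ))) (EbBSC R T (min θ (1 - θ)))

/-- `max_θ {ξ E₁(θ) + log (1 - θ) - β(θ) q}`. -/
def maxMetric (R T ξ q : ℝ) : EReal :=
  ⨆ θ ∈ Icc (0 : ℝ) 1, ((ξ : EReal) * E1BSC R T θ + logLik q θ)

/-- `φ(θ)`, for a given `q` and `0 < θ < 1`, `θ ≠ 1/2`. -/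
def phi (R T ξ q θ : ℝ) : EReal :=
  ((ξ : EReal) * E1BSC R T θ + ((Real.log (1 - θ) + T : ℝ) : EReal) - maxMetric R T ξ q) /
    (beta θ : EReal)

/-- `q₁*`. -/
def q1 (R T ξ q : ℝ) : EReal := ⨆ θ ∈ Ioo (0 : ℝ) (1 / 2), phi R T ξ q θ

/-- `q₂*`. -/
def q2 (R T ξ q : ℝ) : EReal := ⨅ θ ∈ Ioo (1 / 2 : ℝ) 1, phi R T ξ q θ

open Classical in
/-- The function `g` of a pair of extended reals. -/
def gFun (a b : EReal) : ℝ :=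
  if ((1 / 2 : ℝ) : EReal) < a ∨ b < ((1 / 2 : ℝ) : EReal) then Real.log 2
  else max (Real.binEntropy a.toReal) (Real.binEntropy b.toReal)

/-- The maximizer over `{q : h(q) ≥ log 2 - R} = [δ_GV(R), 1 - δ_GV(R)]` of
`log (1 - θ) - q β(θ) + h(q)`, namely the point of this interval nearest to `θ`. -/
def clampGV (R θ : ℝ) : ℝ := min (max θ (deltaGV R)) (1 - deltaGV R)

/-- The region `𝓛_BSC`. -/
def LBSC (R T ξ : ℝ) : Set ℝ :=
  {q | q ∈ Icc (0 : ℝ) 1 ∧ maxMetric R T ξ q ≤ ((R + T : ℝ) : EReal) +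
    ⨆ θ ∈ Icc (0 : ℝ) 1, ((ξ : EReal) * E1BSC R T θ + logLik (clampGV R θ) θ +
      ((Real.binEntropy (clampGV R θ) - Real.log 2 : ℝ) : EReal))}

/-- The first condition on `ξ`. -/
def Cond1 (R T ξ : ℝ) : Prop :=
  (⨆ θ ∈ Icc (0 : ℝ) 1, ((ξ : EReal) * E1BSC R T θ -
    ⨅ q ∈ Icc (0 : ℝ) 1, (divB q θ +
      ((max 0 (-gFun (q1 R T ξ q) (q2 R T ξ q) + Real.log 2 - R) : ℝ) : EReal)))) ≤ 0

/-- The second condition on `ξ`. -/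
def Cond2 (R T ξ : ℝ) : Prop :=
  (⨆ θ ∈ Icc (0 : ℝ) 1, ((ξ : EReal) * E1BSC R T θ - ⨅ q ∈ LBSC R T ξ, divB q θ)) ≤ 0

end ErasureBSC

end

/-!
The ensemble average of `K_n` is governed by pairs of normalized Hamming distances: `q` from the
output word to the sent codeword and `q'` to a competing one. A sum over the codebook of terms
`min (e^{nT} ∑ u(competitors)) (u(sent codeword))`, with a weight `u` of the distance, has the
exponent `max_{q, q'} pairExp`. The upper bound needs only the mean number of competitors at each
distance and the probability that there are any (`expect_codeSum_min_le_exp`); the lower bound is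
the second moment method for the number of competitors at one distance, with balanced output words
(`second_moment_lower`, `exp_le_expect_codeSum`). Polynomial factors are lost, exponents are not.

In the erasure mode `T ≥ 0` the sums over the codebook enter twice.

* The average of `Pr{E₁}` for Forney's decoder is such a sum, except that a term counts only if the
  competitors exceed the threshold. Replacing this by the minimum does not change the exponent:
  below `1/2` the divergence has slope at most `β(θ)` in `q`, so `q` may be increased until the
  competitors do reach the threshold, at no loss (`E1BSC_le_pair`). Hence the exponent is given by
  the single-letter formula (`expE1_eq`).
* Normalized by `e^{-n(ξ E₁(θ) + T)}`, the Lagrangian of a decoder charges each output word either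
  the likelihood of the competitors or that of the sent codeword. All likelihoods depend on the
  `n + 1` Hamming distances only, so the maximum over `θ` may be taken inside the sums, where it
  turns the likelihood into the weight `e^{n U(q)}` with `U(q) = sup_θ (ξ E₁(θ) + log (1 - θ) -
  q β(θ))`. The best decoder compares these weights and attains the minimum (`Kn_le`, `le_Kn`).
  Therefore `ξ` is achievable if and only if `pairExp ≤ 0` for all pairs, with `U` as the metric
  (`achievable_iff_pairExp`).

The metric `U` is convex and symmetric about `1/2`, and strictly decreasing below `1/2`. So for
each `q'` the worst `q` balances the two terms of the minimum, and `pairExp ≤ 0` splits according to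
whether competitors at distance `q'` are rare or plentiful. In the first case the smallest entropic
penalty among the `q'` that reach the metric at `q` is `log 2 - R - g`, the extreme ones being
`q₁*` and `q₂*`, which is the first condition; in the second case the set of `q` that are reached is
`𝓛`, which is the second condition (`cond_iff_pairExp`). The set of these `ξ` is closed because `U`
is Lipschitz in `ξ`, so it has a largest element.

In the list mode `T < 0` the noiseless channel `θ = 0` has `E₁ = ∞`: the average erasure probability
vanishes doubly exponentially (`avgE1_zero_le`). A codebook that repeats a single word has
`Γ_0 > 0` for every decoder, so the normalized average is infinite for every `ξ > 0`, while the
first condition fails at `θ = 0`; both sets are `{0}`.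
-/

noncomputable section

namespace ErasureBSC

open scoped BigOperators Topology

/-! ### Binomial coefficients and the binary entropy -/

open scoped BigOperators

lemma pow_mul_pow_eq_exp {θ : ℝ} (h0 : 0 < θ) (h1 : θ < 1) {n d : ℕ} (hd : d ≤ n) :
    θ ^ d * (1 - θ) ^ (n - d) =
      Real.exp (d * Real.log θ + ((n : ℝ) - d) * Real.log (1 - θ)) := by
  have h1' : 0 < 1 - θ := by linarith
  rw [Real.exp_add, ← Nat.cast_sub hd, Real.exp_nat_mul, Real.exp_nat_mul, Real.exp_log h0,
    Real.exp_log h1']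

lemma freq_pow_mul_pow {n d : ℕ} (hn : 0 < n) (hd : d ≤ n) :
    ((d : ℝ) / n) ^ d * (1 - (d : ℝ) / n) ^ (n - d) =
      Real.exp (-(n * Real.binEntropy ((d : ℝ) / n))) := by
  have hn' : (0 : ℝ) < n := by exact_mod_cast hn
  rcases Nat.eq_zero_or_pos d with rfl | hd0
  · simp
  rcases hd.eq_or_lt with rfl | hdn
  · simp [div_self hn'.ne']
  have hd0' : (0 : ℝ) < d := by exact_mod_cast hd0
  have hdn' : (d : ℝ) < n := by exact_mod_cast hdn
  have h0 : 0 < (d : ℝ) / n := by positivity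
  have h1 : (d : ℝ) / n < 1 := by rw [div_lt_one hn']; exact hdn'
  rw [pow_mul_pow_eq_exp h0 h1 hd, Real.binEntropy, Real.log_inv, Real.log_inv]
  congr 1
  field_simp
  ring

lemma choose_le_exp {n d : ℕ} (hd : d ≤ n) :
    (n.choose d : ℝ) ≤ Real.exp (n * Real.binEntropy ((d : ℝ) / n)) := by
  rcases Nat.eq_zero_or_pos n with rfl | hn
  · obtain rfl : d = 0 := by omega
    simp
  have hn' : (0 : ℝ) < n := by exact_mod_cast hn
  have h0 : 0 ≤ (d : ℝ) / n := by positivity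
  have h1 : 0 ≤ 1 - (d : ℝ) / n := by
    have : (d : ℝ) / n ≤ 1 := by rw [div_le_one hn']; exact_mod_cast hd
    linarith
  have hs := add_pow ((d : ℝ) / n) (1 - (d : ℝ) / n) n
  have hle : ((d : ℝ) / n) ^ d * (1 - (d : ℝ) / n) ^ (n - d) * (n.choose d : ℝ) ≤
      ∑ m ∈ Finset.range (n + 1),
        ((d : ℝ) / n) ^ m * (1 - (d : ℝ) / n) ^ (n - m) * (n.choose m : ℝ) :=
    Finset.single_le_sum
      (f := fun m => ((d : ℝ) / n) ^ m * (1 - (d : ℝ) / n) ^ (n - m) * (n.choose m : ℝ))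
      (fun i _ => by positivity) (Finset.mem_range.2 (by omega))
  rw [← hs, freq_pow_mul_pow hn hd, Real.exp_neg] at hle
  have : ((d : ℝ) / n + (1 - (d : ℝ) / n)) ^ n = 1 := by
    rw [add_sub_cancel, one_pow]
  rw [this, inv_mul_le_iff₀ (Real.exp_pos _), mul_one] at hle
  exact hle

/-- The binomial distribution with mean `d` has its mode at `d`. -/
lemma choose_mul_pow_le_mode (d m j : ℕ) (hj : j ≤ d + m) :
    (d + m).choose j * (d ^ j * m ^ (d + m - j)) ≤ (d + m).choose d * (d ^ d * m ^ m) := by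
  have key : ∀ i, i < d + m →
      (d + m).choose (i + 1) * (d ^ (i + 1) * m ^ (d + m - (i + 1))) * (i + 1) =
        ((d + m).choose i * (d ^ i * m ^ (d + m - (i + 1)))) * ((d + m - i) * d) ∧
      (d + m).choose i * (d ^ i * m ^ (d + m - i)) * (i + 1) =
        ((d + m).choose i * (d ^ i * m ^ (d + m - (i + 1)))) * (m * (i + 1)) := by
    intro i hi
    constructor
    · have := Nat.choose_succ_right_eq (d + m) i
      calc _ = ((d + m).choose (i + 1) * (i + 1)) * (d ^ (i + 1) * m ^ (d + m - (i + 1))) := by ring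
        _ = _ := by rw [this]; ring
    · have : d + m - i = (d + m - (i + 1)) + 1 := by omega
      rw [this, pow_succ]
      ring
  have up : ∀ i, i < d → (d + m).choose i * (d ^ i * m ^ (d + m - i)) ≤
      (d + m).choose (i + 1) * (d ^ (i + 1) * m ^ (d + m - (i + 1))) := by
    intro i hi
    obtain ⟨h1, h2⟩ := key i (by omega)
    refine Nat.le_of_mul_le_mul_right (c := i + 1) ?_ (by omega)
    rw [h1, h2]
    refine Nat.mul_le_mul_left _ ?_
    obtain ⟨r, hr⟩ : ∃ r, d + m - i = m + 1 + r := ⟨d - i - 1, by omega⟩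
    rw [hr]
    calc m * (i + 1) ≤ m * d := Nat.mul_le_mul_left _ (by omega)
      _ ≤ (m + 1 + r) * d := Nat.mul_le_mul_right _ (by omega)
  have down : ∀ i, d ≤ i → i < d + m →
      (d + m).choose (i + 1) * (d ^ (i + 1) * m ^ (d + m - (i + 1))) ≤
      (d + m).choose i * (d ^ i * m ^ (d + m - i)) := by
    intro i hi hi'
    obtain ⟨h1, h2⟩ := key i hi'
    refine Nat.le_of_mul_le_mul_right (c := i + 1) ?_ (by omega)
    rw [h1, h2]
    refine Nat.mul_le_mul_left _ ?_
    calc (d + m - i) * d ≤ m * d := Nat.mul_le_mul_right _ (by omega)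
      _ ≤ m * (i + 1) := Nat.mul_le_mul_left _ (by omega)
  rcases le_total j d with h | h
  · have : ∀ r, r ≤ d → (d + m).choose (d - r) * (d ^ (d - r) * m ^ (d + m - (d - r))) ≤
        (d + m).choose d * (d ^ d * m ^ m) := by
      intro r
      induction r with
      | zero => intro _; simp
      | succ r ih =>
        intro hr
        have h1 := up (d - (r + 1)) (by omega)
        have h2 : d - (r + 1) + 1 = d - r := by omega
        rw [h2] at h1
        exact h1.trans (ih (by omega))
    have h3 := this (d - j) (by omega)
    rwa [Nat.sub_sub_self h] at h3
  · have : ∀ r, r ≤ m → (d + m).choose (d + r) * (d ^ (d + r) * m ^ (d + m - (d + r))) ≤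
        (d + m).choose d * (d ^ d * m ^ m) := by
      intro r
      induction r with
      | zero => intro _; simp
      | succ r ih =>
        intro hr
        exact (down (d + r) (by omega) (by omega)).trans (ih (by omega))
    have h3 := this (j - d) (by omega)
    rwa [Nat.add_sub_cancel' h] at h3

lemma exp_le_choose {n d : ℕ} (hd : d ≤ n) :
    Real.exp (n * Real.binEntropy ((d : ℝ) / n)) ≤ (n + 1) * (n.choose d : ℝ) := by
  rcases Nat.eq_zero_or_pos n with rfl | hn
  · obtain rfl : d = 0 := by omega
    simp
  have hn' : (0 : ℝ) < n := by exact_mod_cast hn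
  have hs := add_pow ((d : ℝ) / n) (1 - (d : ℝ) / n) n
  have hone : ((d : ℝ) / n + (1 - (d : ℝ) / n)) ^ n = 1 := by rw [add_sub_cancel, one_pow]
  obtain ⟨m, rfl⟩ := Nat.exists_eq_add_of_le hd
  have hm : 1 - (d : ℝ) / ((d + m : ℕ) : ℝ) = (m : ℝ) / ((d + m : ℕ) : ℝ) := by
    rw [eq_div_iff hn'.ne', sub_mul, div_mul_cancel₀ _ hn'.ne']
    push_cast; ring
  have hterm : ∀ j ∈ Finset.range (d + m + 1),
      ((d : ℝ) / ((d + m : ℕ) : ℝ)) ^ j * (1 - (d : ℝ) / ((d + m : ℕ) : ℝ)) ^ (d + m - j) *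
        ((d + m).choose j : ℝ) ≤
      Real.exp (-(((d + m : ℕ) : ℝ) * Real.binEntropy ((d : ℝ) / ((d + m : ℕ) : ℝ)))) *
        ((d + m).choose d : ℝ) := by
    intro j hj
    have hj' : j ≤ d + m := by have := Finset.mem_range.1 hj; omega
    rw [← freq_pow_mul_pow hn hd, hm, div_pow, div_pow, div_pow, div_pow]
    have e1 : ((d + m : ℕ) : ℝ) ^ j * ((d + m : ℕ) : ℝ) ^ (d + m - j) =
        ((d + m : ℕ) : ℝ) ^ (d + m) := by rw [← pow_add]; congr 1; omega
    have e2 : ((d + m : ℕ) : ℝ) ^ d * ((d + m : ℕ) : ℝ) ^ (d + m - d) =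
        ((d + m : ℕ) : ℝ) ^ (d + m) := by rw [← pow_add]; congr 1; omega
    rw [div_mul_div_comm, div_mul_div_comm, e1, e2, div_mul_eq_mul_div, div_mul_eq_mul_div]
    refine div_le_div_of_nonneg_right ?_ (by positivity)
    have := choose_mul_pow_le_mode d m j hj'
    rw [Nat.add_sub_cancel_left]
    have h' : (((d + m).choose j * (d ^ j * m ^ (d + m - j)) : ℕ) : ℝ) ≤
        (((d + m).choose d * (d ^ d * m ^ m) : ℕ) : ℝ) := by exact_mod_cast this
    push_cast at h'
    linarith
  have := Finset.sum_le_sum hterm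
  rw [← hs, hone, Finset.sum_const, Finset.card_range, nsmul_eq_mul, Real.exp_neg,
    ← mul_assoc, mul_comm _ (Real.exp _)⁻¹, mul_assoc, le_inv_mul_iff₀ (Real.exp_pos _),
    mul_one] at this
  refine this.trans (le_of_eq ?_)
  push_cast; ring

/-! ### Counting words at a given Hamming distance -/

lemma chan_eq {θ : ℝ} {n : ℕ} (x y : Word n) :
    chan θ x y = θ ^ hammingDist x y * (1 - θ) ^ (n - hammingDist x y) := by
  classical
  unfold chan
  rw [Finset.prod_ite, Finset.prod_const, Finset.prod_const, mul_comm]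
  have h1 : (Finset.univ.filter fun i => ¬ y i = x i).card = hammingDist x y := by
    unfold hammingDist
    congr 1
    ext i
    simp [eq_comm]
  have h2 := Finset.card_filter_add_card_filter_not (s := (Finset.univ : Finset (Fin n)))
    (fun i => y i = x i)
  rw [h1, Finset.card_univ, Fintype.card_fin] at h2
  rw [h1]
  congr 2
  omega

lemma hammingDist_le {n : ℕ} (x y : Word n) : hammingDist x y ≤ n := by
  simpa using hammingDist_le_card_fintype (x := x) (y := y)

/-- The word `x` with the bits in `S` flipped. -/
def flipOn {n : ℕ} (x : Word n) (S : Finset (Fin n)) : Word n :=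
  fun i => if i ∈ S then !x i else x i

lemma filter_ne_flipOn {n : ℕ} (x : Word n) (S : Finset (Fin n)) :
    (Finset.univ.filter fun i => x i ≠ flipOn x S i) = S := by
  ext i
  by_cases h : i ∈ S <;> simp [flipOn, h]

lemma flipOn_filter_ne {n : ℕ} (x y : Word n) :
    flipOn x (Finset.univ.filter fun i => x i ≠ y i) = y := by
  funext i
  by_cases h : x i = y i
  · simp [flipOn, h]
  · cases hx : x i <;> cases hy : y i <;> simp_all [flipOn]

lemma hammingDist_flipOn {n : ℕ} (x : Word n) (S : Finset (Fin n)) :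
    hammingDist x (flipOn x S) = S.card := by
  unfold hammingDist
  rw [filter_ne_flipOn]

lemma card_hammingDist_eq {n : ℕ} (x : Word n) (d : ℕ) :
    (Finset.univ.filter fun y : Word n => hammingDist x y = d).card = n.choose d := by
  have : n.choose d = (Finset.powersetCard d (Finset.univ : Finset (Fin n))).card := by
    rw [Finset.card_powersetCard, Finset.card_univ, Fintype.card_fin]
  rw [this]
  refine Finset.card_nbij' (fun y => Finset.univ.filter fun i => x i ≠ y i) (fun S => flipOn x S)
    ?_ ?_ ?_ ?_
  · intro y hy
    simp only [Finset.coe_filter, Finset.mem_univ, true_and, mem_ofPred_eq] at hy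
    simp only [SetLike.mem_coe, Finset.mem_powersetCard, Finset.subset_univ, true_and]
    exact hy
  · intro S hS
    simp only [SetLike.mem_coe, Finset.mem_powersetCard, Finset.subset_univ, true_and] at hS
    simp [hammingDist_flipOn, hS]
  · intro y _
    exact flipOn_filter_ne x y
  · intro S _
    exact filter_ne_flipOn x S

lemma card_balancedWord (k : ℕ) : Fintype.card (BalancedWord (2 * k)) = (2 * k).choose k := by
  rw [Fintype.card_subtype, ← card_hammingDist_eq (fun _ : Fin (2 * k) => false) k]
  congr 1
  ext x
  simp only [Finset.mem_filter, Finset.mem_univ, true_and]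
  have : hammingDist (fun _ : Fin (2 * k) => false) x =
      (Finset.univ.filter fun i => x i = true).card := by
    unfold hammingDist
    congr 1
    ext i
    cases h : x i <;> simp [h]
  rw [this]
  omega

instance instNonemptyBalanced (k : ℕ) : Nonempty (BalancedWord (2 * k)) := by
  rw [← Fintype.card_pos_iff, card_balancedWord]
  exact Nat.choose_pos (by omega)

lemma card_balanced_hammingDist_le {n : ℕ} (y : Word n) (d : ℕ) :
    (Finset.univ.filter fun x : BalancedWord n => hammingDist x.1 y = d).card ≤ n.choose d := by
  rw [← card_hammingDist_eq y d]
  refine Finset.card_le_card_of_injOn (fun x => x.1) ?_ ?_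
  · intro x hx
    simp only [Finset.coe_filter, Finset.mem_univ, true_and, mem_ofPred_eq] at hx ⊢
    rw [hammingDist_comm]; exact hx
  · intro x _ x' _ h
    exact Subtype.ext h

lemma choose_sq_le_card_balanced {k : ℕ} (x : BalancedWord (2 * k)) (j : ℕ) :
    k.choose j ^ 2 ≤
      (Finset.univ.filter fun y : BalancedWord (2 * k) => hammingDist x.1 y.1 = 2 * j).card := by
  classical
  set S₁ := Finset.univ.filter fun i => x.1 i = true with hS₁
  set S₀ := Finset.univ.filter fun i => x.1 i = false with hS₀
  have c1 : S₁.card = k := by have := x.2; rw [← hS₁] at this; omega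
  have hdisj : Disjoint S₁ S₀ := by
    rw [Finset.disjoint_left]; intro i hi; simp_all
  have hun : S₁ ∪ S₀ = Finset.univ := by
    ext i; cases h : x.1 i <;> simp [hS₁, hS₀, h]
  have c0 : S₀.card = k := by
    have := Finset.card_union_of_disjoint hdisj
    rw [hun, Finset.card_univ, Fintype.card_fin] at this
    omega
  have hcard : (Finset.powersetCard j S₁ ×ˢ Finset.powersetCard j S₀).card = k.choose j ^ 2 := by
    rw [Finset.card_product, Finset.card_powersetCard, Finset.card_powersetCard, c1, c0, sq]
  have hbal : ∀ A B : Finset (Fin (2 * k)), A ⊆ S₁ → B ⊆ S₀ → A.card = B.card →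
      2 * (Finset.univ.filter fun i => flipOn x.1 (A ∪ B) i = true).card = 2 * k := by
    intro A B hA hB hAB
    have : (Finset.univ.filter fun i => flipOn x.1 (A ∪ B) i = true) = (S₁ \ A) ∪ B := by
      ext i
      have hA' := @hA i
      have hB' := @hB i
      by_cases hiA : i ∈ A <;> by_cases hiB : i ∈ B <;> cases hxi : x.1 i <;>
        simp_all [flipOn]
    rw [this, Finset.card_union_of_disjoint, Finset.card_sdiff_of_subset hA, c1]
    · have := Finset.card_le_card hA
      omega
    · exact Disjoint.mono Finset.sdiff_subset hB hdisj
  rw [← hcard]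
  refine Finset.card_le_card_of_injOn
    (fun p => if h : p.1 ⊆ S₁ ∧ p.2 ⊆ S₀ ∧ p.1.card = p.2.card then
      ⟨flipOn x.1 (p.1 ∪ p.2), hbal _ _ h.1 h.2.1 h.2.2⟩ else x) ?_ ?_
  · rintro ⟨A, B⟩ hAB
    simp only [SetLike.mem_coe, Finset.mem_product, Finset.mem_powersetCard] at hAB
    have h : A ⊆ S₁ ∧ B ⊆ S₀ ∧ A.card = B.card := ⟨hAB.1.1, hAB.2.1, by omega⟩
    simp only [Finset.coe_filter, Finset.mem_univ, true_and, mem_ofPred_eq, dif_pos h]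
    rw [hammingDist_flipOn, Finset.card_union_of_disjoint (hdisj.mono h.1 h.2.1)]
    omega
  · rintro ⟨A, B⟩ hAB ⟨A', B'⟩ hAB' heq
    simp only [SetLike.mem_coe, Finset.mem_product, Finset.mem_powersetCard] at hAB hAB'
    have h : A ⊆ S₁ ∧ B ⊆ S₀ ∧ A.card = B.card := ⟨hAB.1.1, hAB.2.1, by omega⟩
    have h' : A' ⊆ S₁ ∧ B' ⊆ S₀ ∧ A'.card = B'.card := ⟨hAB'.1.1, hAB'.2.1, by omega⟩
    simp only [dif_pos h, dif_pos h', Subtype.mk.injEq] at heq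
    have hU : A ∪ B = A' ∪ B' := by
      rw [← filter_ne_flipOn x.1 (A ∪ B), heq, filter_ne_flipOn]
    have recover : ∀ A B : Finset (Fin (2 * k)), A ⊆ S₁ → B ⊆ S₀ →
        (A ∪ B) ∩ S₁ = A ∧ (A ∪ B) ∩ S₀ = B := by
      intro A B hA hB
      rw [Finset.disjoint_left] at hdisj
      constructor <;> ext i <;> have hA' := @hA i <;> have hB' := @hB i <;>
        have hd := @hdisj i <;> simp only [Finset.mem_inter, Finset.mem_union] <;> tauto
    have r1 := recover A B h.1 h.2.1
    have r2 := recover A' B' h'.1 h'.2.1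
    rw [hU] at r1
    rw [Prod.mk.injEq]
    exact ⟨r1.1.symm.trans r2.1, r1.2.symm.trans r2.2⟩

lemma sum_chan (θ : ℝ) {n : ℕ} (x : Word n) : ∑ y, chan θ x y = 1 := by
  unfold chan
  have := (Finset.prod_univ_sum (fun _ : Fin n => (Finset.univ : Finset Bool))
    (fun i b => if b = x i then 1 - θ else θ)).symm
  rw [Fintype.piFinset_univ] at this
  rw [this]
  refine Finset.prod_eq_one fun i _ => ?_
  cases x i <;> simp

/-! ### Averages over independent uniform letters -/

section Averages

variable {ι B : Type} [Fintype ι] [DecidableEq ι] [Fintype B]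

lemma expect_pi_split [Nonempty B] (i : ι) (F : B → ({j // j ≠ i} → B) → ℝ) :
    𝔼 C : ι → B, F (C i) (fun j => C j) = 𝔼 x : B, 𝔼 C' : {j // j ≠ i} → B, F x C' := by
  rw [← Finset.expect_product' Finset.univ Finset.univ F]
  exact Fintype.expect_equiv (Equiv.funSplitAt i B) _ _ fun C => rfl

lemma expect_pi_apply [Nonempty B] (i : ι) (f : B → ℝ) :
    𝔼 C : ι → B, f (C i) = 𝔼 x, f x := by
  rw [expect_pi_split i fun x _ => f x]
  simp

lemma expect_pi_apply_mul [Nonempty B] {i j : ι} (hij : j ≠ i) (f g : B → ℝ) :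
    𝔼 C : ι → B, f (C i) * g (C j) = (𝔼 x, f x) * 𝔼 x, g x := by
  rw [expect_pi_split i fun x C' => f x * g (C' ⟨j, hij⟩), Finset.expect_mul]
  refine Finset.expect_congr rfl fun x _ => ?_
  rw [← Finset.mul_expect, expect_pi_apply]

/-- Paley–Zygmund for a binomial variable with mean `l`: with probability at least
`l / (4 (1 + l))` it is at least half its mean. -/
lemma second_moment_lower [Nonempty B] (S : B → Prop) [DecidablePred S] {l : ℝ}
    (hl : l = Fintype.card ι * 𝔼 x : B, (if S x then (1 : ℝ) else 0)) :
    l / (4 * (1 + l)) ≤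
      𝔼 C : ι → B, (if l / 2 ≤ ∑ i, (if S (C i) then (1 : ℝ) else 0) then (1 : ℝ) else 0) := by
  set p := 𝔼 x : B, (if S x then (1 : ℝ) else 0) with hp
  have hp0 : 0 ≤ p := Finset.expect_nonneg fun x _ => by split_ifs <;> norm_num
  have hl0 : 0 ≤ l := by rw [hl]; positivity
  set N : (ι → B) → ℝ := fun C => ∑ i, (if S (C i) then (1 : ℝ) else 0) with hN
  have m1 : 𝔼 C, N C = l := by
    rw [hN, Finset.expect_sum_comm]
    simp_rw [expect_pi_apply _ (fun x => if S x then (1 : ℝ) else 0)]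
    rw [Finset.sum_const, Finset.card_univ, nsmul_eq_mul, hl]
  have m2 : 𝔼 C, N C ^ 2 ≤ l + l ^ 2 := by
    have e : ∀ C, N C ^ 2 = ∑ i, ∑ j,
        (if S (C i) then (1 : ℝ) else 0) * (if S (C j) then (1 : ℝ) else 0) := by
      intro C
      rw [sq, hN, Finset.sum_mul_sum]
    simp_rw [e]
    rw [Finset.expect_sum_comm]
    simp_rw [Finset.expect_sum_comm]
    have b : ∀ i j : ι, 𝔼 C : ι → B,
        (if S (C i) then (1 : ℝ) else 0) * (if S (C j) then (1 : ℝ) else 0) ≤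
        (if j = i then p else 0) + p * p := by
      intro i j
      by_cases hij : j = i
      · subst hij
        have : ∀ C : ι → B, (if S (C j) then (1 : ℝ) else 0) * (if S (C j) then (1 : ℝ) else 0) =
            (if S (C j) then (1 : ℝ) else 0) := fun C => by split_ifs <;> norm_num
        simp_rw [this]
        rw [expect_pi_apply j fun x => if S x then (1 : ℝ) else 0, if_pos trivial]
        nlinarith
      · rw [expect_pi_apply_mul hij (fun x => if S x then (1 : ℝ) else 0)
          (fun x => if S x then (1 : ℝ) else 0), if_neg hij, zero_add]
    refine (Finset.sum_le_sum fun i _ => Finset.sum_le_sum fun j _ => b i j).trans (le_of_eq ?_)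
    simp only [Finset.sum_add_distrib, Finset.sum_ite_eq', Finset.mem_univ, if_true,
      Finset.sum_const, Finset.card_univ, nsmul_eq_mul]
    rw [hl]; ring
  -- a parabola in `N` below the indicator, with slope and curvature that make its mean large
  set a : ℝ := 1 / (1 + l) with ha
  have ha0 : 0 < a := by positivity
  have pt : ∀ C, a * N C - a ^ 2 / 4 * N C ^ 2 - a * l / 2 ≤
      (if l / 2 ≤ N C then (1 : ℝ) else 0) := by
    intro C
    split_ifs with h
    · nlinarith [sq_nonneg (a * N C / 2 - 1), mul_nonneg ha0.le hl0]
    · push Not at h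
      nlinarith [mul_nonneg ha0.le (sub_nonneg.2 h.le), sq_nonneg (a * N C)]
  have := Finset.expect_le_expect (s := Finset.univ) fun C _ => pt C
  rw [Finset.expect_sub_distrib, Finset.expect_sub_distrib, ← Finset.mul_expect,
    ← Finset.mul_expect, m1, Fintype.expect_const] at this
  refine le_trans ?_ this
  have h2 : a ^ 2 / 4 * 𝔼 C, N C ^ 2 ≤ a ^ 2 / 4 * (l + l ^ 2) :=
    mul_le_mul_of_nonneg_left m2 (by positivity)
  have h3 : l / (4 * (1 + l)) = a * l - a ^ 2 / 4 * (l + l ^ 2) - a * l / 2 := by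
    rw [ha]; field_simp; ring
  linarith

/-- Truncation at a nonnegative constant is subadditive. -/
lemma min_sum_le_sum_min {κ : Type} (s : Finset κ) (f : κ → ℝ) (hf : ∀ i ∈ s, 0 ≤ f i) {c : ℝ}
    (hc : 0 ≤ c) : min (∑ i ∈ s, f i) c ≤ ∑ i ∈ s, min (f i) c := by
  classical
  induction s using Finset.induction_on with
  | empty => simp [hc]
  | insert a s ha ih =>
    rw [Finset.sum_insert ha, Finset.sum_insert ha]
    have h1 := ih fun i hi => hf i (Finset.mem_insert_of_mem hi)
    have h2 := hf a (Finset.mem_insert_self _ _)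
    have h3 : 0 ≤ ∑ i ∈ s, f i := Finset.sum_nonneg fun i hi => hf i (Finset.mem_insert_of_mem hi)
    have : min (f a + ∑ i ∈ s, f i) c ≤ min (f a) c + min (∑ i ∈ s, f i) c := by
      rcases min_cases (f a) c with h | h <;> rcases min_cases (∑ i ∈ s, f i) c with h' | h' <;>
        rcases min_cases (f a + ∑ i ∈ s, f i) c with h'' | h'' <;> linarith
    linarith

/-- The truncated mean of a sum of i.i.d. weights `w (D X)` is bounded class by class: the class
`D X = d` has `|ι| p d` members on average and is nonempty with probability at most that. -/
lemma expect_min_sum_le [Nonempty B] {n : ℕ} (D : B → ℕ) (hD : ∀ x, D x ≤ n) (w : ℕ → ℝ)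
    (hw : ∀ d, 0 ≤ w d) {c : ℝ} (hc : 0 ≤ c) {K : ℝ} (hK : Fintype.card ι ≤ K) (p : ℕ → ℝ)
    (hp : ∀ d, 𝔼 x : B, (if D x = d then (1 : ℝ) else 0) ≤ p d) :
    𝔼 C : ι → B, min (∑ i, w (D (C i))) c ≤
      ∑ d ∈ Finset.range (n + 1), min (K * p d * w d) (c * min 1 (K * p d)) := by
  set N : ℕ → (ι → B) → ℝ := fun d C => ∑ i, (if D (C i) = d then (1 : ℝ) else 0) with hN
  have hN0 : ∀ d C, 0 ≤ N d C := fun d C =>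
    Finset.sum_nonneg fun i _ => by split_ifs <;> norm_num
  have hNd : ∀ C : ι → B, ∑ i, w (D (C i)) = ∑ d ∈ Finset.range (n + 1), N d C * w d := by
    intro C
    simp_rw [hN, Finset.sum_mul]
    rw [Finset.sum_comm]
    refine Finset.sum_congr rfl fun i _ => ?_
    simp only [ite_mul, one_mul, zero_mul]
    rw [Finset.sum_ite_eq, if_pos (Finset.mem_range.2 (Nat.lt_succ_of_le (hD _)))]
  have hEN : ∀ d, 𝔼 C, N d C ≤ K * p d := by
    intro d
    rw [hN]
    simp only
    rw [Finset.expect_sum_comm]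
    simp_rw [expect_pi_apply _ (fun x => if D x = d then (1 : ℝ) else 0)]
    rw [Finset.sum_const, Finset.card_univ, nsmul_eq_mul]
    have h0 : 0 ≤ 𝔼 x : B, (if D x = d then (1 : ℝ) else 0) :=
      Finset.expect_nonneg fun x _ => by split_ifs <;> norm_num
    exact mul_le_mul hK (hp d) h0 ((Nat.cast_nonneg _).trans hK)
  -- a class count is a nonnegative integer, so a truncated class weight vanishes unless `1 ≤ N`
  have hint : ∀ d C, N d C = 0 ∨ 1 ≤ N d C := by
    intro d C
    have : N d C = ((Finset.univ.filter fun i => D (C i) = d).card : ℝ) := by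
      simp [hN]
    rw [this]
    rcases Nat.eq_zero_or_pos (Finset.univ.filter fun i => D (C i) = d).card with h | h
    · left; rw [h]; simp
    · right; exact_mod_cast h
  calc 𝔼 C : ι → B, min (∑ i, w (D (C i))) c
      ≤ 𝔼 C : ι → B, ∑ d ∈ Finset.range (n + 1), min (N d C * w d) c := by
        refine Finset.expect_le_expect fun C _ => ?_
        rw [hNd]
        exact min_sum_le_sum_min _ _ (fun d _ => mul_nonneg (hN0 d C) (hw d)) hc
    _ = ∑ d ∈ Finset.range (n + 1), 𝔼 C : ι → B, min (N d C * w d) c :=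
        Finset.expect_sum_comm _ _ _
    _ ≤ _ := by
        refine Finset.sum_le_sum fun d _ => le_min ?_ ?_
        · calc _ ≤ 𝔼 C, N d C * w d := Finset.expect_le_expect fun C _ => min_le_left _ _
            _ = (𝔼 C, N d C) * w d := (Finset.expect_mul _ _ _).symm
            _ ≤ _ := mul_le_mul_of_nonneg_right (hEN d) (hw d)
        · rw [mul_min_of_nonneg _ _ hc, mul_one]
          refine le_min ?_ ?_
          · calc _ ≤ 𝔼 C : ι → B, c := Finset.expect_le_expect fun C _ => min_le_right _ _
              _ = c := Fintype.expect_const c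
          · calc _ ≤ 𝔼 C, c * N d C := by
                  refine Finset.expect_le_expect fun C _ => ?_
                  rcases hint d C with h | h
                  · rw [h]; simp [hc]
                  · exact (min_le_right _ _).trans (le_mul_of_one_le_right hc h)
              _ = c * 𝔼 C, N d C := (Finset.mul_expect _ _ _).symm
              _ ≤ _ := mul_le_mul_of_nonneg_left (hEN d) hc

end Averages

/-! ### Sums over the codebook -/

/-- `M⁻¹ ∑_m ∑_y ψ (e^{nT} ∑_{m' ≠ m} u (d(x_{m'}, y)), u (d(x_m, y)))` for a weight `u` of the
Hamming distance. Both `Pr{E₁}` of Forney's decoder and the optimal value of the minimax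
criterion are of this form up to polynomial factors. -/
def codeSum (ψ : ℝ → ℝ → ℝ) (T : ℝ) (u : ℕ → ℝ) {M n : ℕ} (C : Codebook M n) : ℝ :=
  1 / (M : ℝ) * ∑ m, ∑ y : Word n,
    ψ (Real.exp (n * T) * ∑ m' ∈ Finset.univ.erase m, u (hammingDist (C m').1 y))
      (u (hammingDist (C m).1 y))

lemma sum_erase_eq_sum_subtype {M : ℕ} (m : Fin M) (f : Fin M → ℝ) :
    ∑ m' ∈ Finset.univ.erase m, f m' = ∑ j : {j // j ≠ m}, f j := by
  rw [← Finset.sum_subtype (Finset.univ.erase m) (p := fun j => j ≠ m) (by simp)]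

lemma expect_codeSum (ψ : ℝ → ℝ → ℝ) (T : ℝ) (u : ℕ → ℝ) (M k : ℕ) :
    𝔼 C : Codebook M (2 * k), codeSum ψ T u C =
      1 / (M : ℝ) * ∑ m : Fin M, 𝔼 x : BalancedWord (2 * k), ∑ y : Word (2 * k),
        𝔼 C' : {j // j ≠ m} → BalancedWord (2 * k),
          ψ (∑ j, Real.exp ((2 * k : ℕ) * T) * u (hammingDist (C' j).1 y))
            (u (hammingDist x.1 y)) := by
  unfold codeSum
  rw [← Finset.mul_expect, Finset.expect_sum_comm]
  congr 1
  refine Finset.sum_congr rfl fun m _ => ?_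
  set F : BalancedWord (2 * k) → ({j // j ≠ m} → BalancedWord (2 * k)) → ℝ := fun x C' =>
    ∑ y : Word (2 * k), ψ (∑ j, Real.exp ((2 * k : ℕ) * T) * u (hammingDist (C' j).1 y))
      (u (hammingDist x.1 y)) with hF
  have h1 : 𝔼 C : Fin M → BalancedWord (2 * k), F (C m) (fun j => C j) = 𝔼 x, 𝔼 C', F x C' :=
    expect_pi_split m F
  refine Eq.trans (Eq.trans ?_ h1) ?_
  · refine Finset.expect_congr rfl fun C _ => Finset.sum_congr rfl fun y _ => ?_
    rw [sum_erase_eq_sum_subtype, Finset.mul_sum]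
  · refine Finset.expect_congr rfl fun x _ => ?_
    rw [hF, Finset.expect_sum_comm]

lemma card_ne_fin {M : ℕ} (m : Fin M) : Fintype.card {j // j ≠ m} = M - 1 := by
  simp [Fintype.card_subtype_compl]

/-- Upper bound on the ensemble average of the truncated sum, by joint types. -/
lemma expect_codeSum_min_le (T : ℝ) {u : ℕ → ℝ} (hu : ∀ d, 0 ≤ u d) {M : ℕ} (hM : 0 < M) (k : ℕ) :
    𝔼 C : Codebook M (2 * k), codeSum min T u C ≤
      ∑ d ∈ Finset.range (2 * k + 1), ∑ d' ∈ Finset.range (2 * k + 1), ((2 * k).choose d : ℝ) *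
        min (M * ((2 * k).choose d' / (2 * k).choose k : ℝ) *
          (Real.exp ((2 * k : ℕ) * T) * u d'))
          (u d * min 1 (M * ((2 * k).choose d' / (2 * k).choose k : ℝ))) := by
  rw [expect_codeSum]
  set A : ℕ → ℝ := fun d => ∑ d' ∈ Finset.range (2 * k + 1),
    min (M * ((2 * k).choose d' / (2 * k).choose k : ℝ) * (Real.exp ((2 * k : ℕ) * T) * u d'))
      (u d * min 1 (M * ((2 * k).choose d' / (2 * k).choose k : ℝ))) with hA
  have inner : ∀ (m : Fin M) (x : BalancedWord (2 * k)) (y : Word (2 * k)),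
      𝔼 C' : {j // j ≠ m} → BalancedWord (2 * k),
        min (∑ j, Real.exp ((2 * k : ℕ) * T) * u (hammingDist (C' j).1 y))
          (u (hammingDist x.1 y)) ≤ A (hammingDist x.1 y) := by
    intro m x y
    refine expect_min_sum_le (n := 2 * k) (fun z : BalancedWord (2 * k) => hammingDist z.1 y)
      (fun z => hammingDist_le _ _) (fun d => Real.exp ((2 * k : ℕ) * T) * u d)
      (fun d => mul_nonneg (Real.exp_pos _).le (hu d)) (hu _) (K := M) ?_ _ ?_
    · rw [card_ne_fin]; exact_mod_cast Nat.sub_le _ _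
    · intro d
      rw [Fintype.expect_eq_sum_div_card, card_balancedWord]
      refine div_le_div_of_nonneg_right ?_ (by positivity)
      rw [Finset.sum_boole]
      exact_mod_cast card_balanced_hammingDist_le y d
  have outer : ∀ x : BalancedWord (2 * k), ∑ y : Word (2 * k), A (hammingDist x.1 y) =
      ∑ d ∈ Finset.range (2 * k + 1), ((2 * k).choose d : ℝ) * A d := by
    intro x
    rw [← Finset.sum_fiberwise_of_maps_to (s := Finset.univ) (t := Finset.range (2 * k + 1))
      (g := fun y => hammingDist x.1 y)
      (fun y _ => Finset.mem_range.2 (Nat.lt_succ_of_le (hammingDist_le _ _)))]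
    refine Finset.sum_congr rfl fun d _ => ?_
    rw [Finset.sum_congr rfl (g := fun _ => A d) (fun y hy => by
      rw [(Finset.mem_filter.1 hy).2]), Finset.sum_const, card_hammingDist_eq, nsmul_eq_mul]
  calc _ ≤ 1 / (M : ℝ) * ∑ m : Fin M, 𝔼 x : BalancedWord (2 * k),
        ∑ d ∈ Finset.range (2 * k + 1), ((2 * k).choose d : ℝ) * A d := by
        refine mul_le_mul_of_nonneg_left (Finset.sum_le_sum fun m _ =>
          Finset.expect_le_expect fun x _ => ?_) (by positivity)
        rw [← outer x]
        exact Finset.sum_le_sum fun y _ => inner m x y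
    _ = ∑ d ∈ Finset.range (2 * k + 1), ((2 * k).choose d : ℝ) * A d := by
        have hM' : (M : ℝ) ≠ 0 := by positivity
        rw [Fintype.expect_const, Finset.sum_const, Finset.card_univ, Fintype.card_fin,
          nsmul_eq_mul]
        field_simp
    _ = _ := by simp_rw [hA, Finset.mul_sum]

/-- Lower bound on the ensemble average by one joint type, with balanced output words only;
`l` bounds the mean number of competing codewords at distance `2 j'` from below. -/
lemma le_expect_codeSum {ψ : ℝ → ℝ → ℝ} (hψ0 : ∀ s c, 0 ≤ s → 0 ≤ c → 0 ≤ ψ s c)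
    (hψ : ∀ s s' c, 0 ≤ c → s ≤ s' → ψ s c ≤ ψ s' c) (T : ℝ) {u : ℕ → ℝ} (hu : ∀ d, 0 ≤ u d)
    {M : ℕ} (hM : 0 < M) (k j j' : ℕ) {l : ℝ} (hl0 : 0 < l)
    (hl : l ≤ ((M - 1 : ℕ) : ℝ) * ((k.choose j' : ℝ) ^ 2 / (2 * k).choose k)) :
    (k.choose j : ℝ) ^ 2 * (l / (4 * (1 + l)) *
      ψ (max 1 (l / 2) * (Real.exp ((2 * k : ℕ) * T) * u (2 * j'))) (u (2 * j))) ≤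
      𝔼 C : Codebook M (2 * k), codeSum ψ T u C := by
  rw [expect_codeSum]
  set v := ψ (max 1 (l / 2) * (Real.exp ((2 * k : ℕ) * T) * u (2 * j'))) (u (2 * j)) with hv
  have hv0 : 0 ≤ v := hψ0 _ _ (by have := hu (2 * j'); positivity) (hu _)
  have inner : ∀ (m : Fin M) (x y : BalancedWord (2 * k)), hammingDist x.1 y.1 = 2 * j →
      l / (4 * (1 + l)) * v ≤ 𝔼 C' : {j // j ≠ m} → BalancedWord (2 * k),
        ψ (∑ j, Real.exp ((2 * k : ℕ) * T) * u (hammingDist (C' j).1 y.1))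
          (u (hammingDist x.1 y.1)) := by
    intro m x y hxy
    set L : ℝ := Fintype.card {j // j ≠ m} * 𝔼 z : BalancedWord (2 * k),
      (if hammingDist z.1 y.1 = 2 * j' then (1 : ℝ) else 0) with hL
    have hlL : l ≤ L := by
      refine hl.trans ?_
      rw [hL, card_ne_fin, Fintype.expect_eq_sum_div_card, card_balancedWord, Finset.sum_boole]
      refine mul_le_mul_of_nonneg_left (div_le_div_of_nonneg_right ?_ (by positivity))
        (by positivity)
      have := choose_sq_le_card_balanced y j'
      simp_rw [hammingDist_comm y.1] at this
      exact_mod_cast this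
    have h2 := second_moment_lower (ι := {j // j ≠ m})
      (fun z : BalancedWord (2 * k) => hammingDist z.1 y.1 = 2 * j') hL
    have h1 : l / (4 * (1 + l)) ≤ L / (4 * (1 + L)) := by
      rw [div_le_div_iff₀ (by positivity) (by positivity)]
      nlinarith
    calc l / (4 * (1 + l)) * v ≤ _ := mul_le_mul_of_nonneg_right (h1.trans h2) hv0
      _ = _ := Finset.expect_mul _ _ _
      _ ≤ _ := by
        refine Finset.expect_le_expect fun C' _ => ?_
        have hterm : ∀ i, 0 ≤ Real.exp ((2 * k : ℕ) * T) * u (hammingDist (C' i).1 y.1) :=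
          fun i => mul_nonneg (Real.exp_pos _).le (hu _)
        split_ifs with h
        · rw [one_mul, hv, hxy]
          refine hψ _ _ _ (hu _) ?_
          set N : ℝ := ∑ i, (if hammingDist (C' i).1 y.1 = 2 * j' then (1 : ℝ) else 0) with hN
          have hN' : N = ((Finset.univ.filter
              fun i => hammingDist (C' i).1 y.1 = 2 * j').card : ℝ) := by simp [hN]
          have hN1 : 1 ≤ N := by
            have : 0 < N := lt_of_lt_of_le (by linarith) h
            rw [hN'] at this ⊢
            exact_mod_cast this
          calc _ ≤ N * (Real.exp ((2 * k : ℕ) * T) * u (2 * j')) :=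
                mul_le_mul_of_nonneg_right (max_le hN1 (by linarith))
                  (mul_nonneg (Real.exp_pos _).le (hu _))
            _ ≤ _ := by
                rw [hN, Finset.sum_mul]
                refine Finset.sum_le_sum fun i _ => ?_
                split_ifs with hi
                · rw [one_mul, hi]
                · rw [zero_mul]; exact hterm i
        · rw [zero_mul]
          exact hψ0 _ _ (Finset.sum_nonneg fun i _ => hterm i) (hu _)
  have hin0 : ∀ (m : Fin M) (x : BalancedWord (2 * k)) (y : Word (2 * k)),
      0 ≤ 𝔼 C' : {j // j ≠ m} → BalancedWord (2 * k),
        ψ (∑ j, Real.exp ((2 * k : ℕ) * T) * u (hammingDist (C' j).1 y))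
          (u (hammingDist x.1 y)) := fun m x y =>
    Finset.expect_nonneg fun C' _ => hψ0 _ _
      (Finset.sum_nonneg fun i _ => mul_nonneg (Real.exp_pos _).le (hu _)) (hu _)
  have outer : ∀ (m : Fin M) (x : BalancedWord (2 * k)),
      (k.choose j : ℝ) ^ 2 * (l / (4 * (1 + l)) * v) ≤ ∑ y : Word (2 * k),
        𝔼 C' : {j // j ≠ m} → BalancedWord (2 * k),
        ψ (∑ j, Real.exp ((2 * k : ℕ) * T) * u (hammingDist (C' j).1 y))
          (u (hammingDist x.1 y)) := by
    intro m x
    set s := Finset.univ.filter fun y : BalancedWord (2 * k) => hammingDist x.1 y.1 = 2 * j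
    set F : Word (2 * k) → ℝ := fun y => 𝔼 C' : {j // j ≠ m} → BalancedWord (2 * k),
        ψ (∑ j, Real.exp ((2 * k : ℕ) * T) * u (hammingDist (C' j).1 y))
          (u (hammingDist x.1 y)) with hF
    calc _ ≤ (s.card : ℝ) * (l / (4 * (1 + l)) * v) := by
          refine mul_le_mul_of_nonneg_right ?_ (by positivity)
          exact_mod_cast choose_sq_le_card_balanced x j
      _ = ∑ y ∈ s, l / (4 * (1 + l)) * v := by rw [Finset.sum_const, nsmul_eq_mul]
      _ ≤ ∑ y ∈ s, F y.1 :=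
          Finset.sum_le_sum fun y hy => inner m x y (Finset.mem_filter.1 hy).2
      _ = ∑ y ∈ s.map ⟨Subtype.val, Subtype.val_injective⟩, F y := by
          rw [Finset.sum_map]; rfl
      _ ≤ _ := Finset.sum_le_sum_of_subset_of_nonneg (Finset.subset_univ _)
          fun y _ _ => hin0 m x y
  calc _ = 1 / (M : ℝ) * ∑ m : Fin M, 𝔼 x : BalancedWord (2 * k),
        (k.choose j : ℝ) ^ 2 * (l / (4 * (1 + l)) * v) := by
        have hM' : (M : ℝ) ≠ 0 := by positivity
        rw [Fintype.expect_const, Finset.sum_const, Finset.card_univ, Fintype.card_fin,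
          nsmul_eq_mul]
        field_simp
    _ ≤ _ := mul_le_mul_of_nonneg_left (Finset.sum_le_sum fun m _ =>
          Finset.expect_le_expect fun x _ => outer m x) (by positivity)

/-! ### Exponential rates -/

lemma tendsto_log_poly_div (A : ℝ) (hA : 0 < A) (j : ℕ) :
    Tendsto (fun k : ℕ => Real.log (A * ((k : ℝ) + 1) ^ j) / ((2 * k : ℕ) : ℝ)) atTop (𝓝 0) := by
  have h1 : Tendsto (fun x : ℝ => Real.log x / x) atTop (𝓝 0) := by
    simpa using Real.tendsto_pow_log_div_mul_add_atTop 1 0 1 one_ne_zero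
  have h2 : Tendsto (fun k : ℕ => (k : ℝ) + 1) atTop atTop :=
    tendsto_atTop_add_const_right _ _ tendsto_natCast_atTop_atTop
  have h3 := h1.comp h2
  have h4 : Tendsto (fun k : ℕ => ((k : ℝ) + 1) / k) atTop (𝓝 1) := by
    have : Tendsto (fun k : ℕ => 1 + 1 / (k : ℝ)) atTop (𝓝 (1 + 0)) :=
      tendsto_const_nhds.add tendsto_one_div_atTop_nhds_zero_nat
    rw [add_zero] at this
    refine this.congr' ?_
    filter_upwards [eventually_gt_atTop 0] with k hk
    have : (k : ℝ) ≠ 0 := by positivity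
    field_simp
  have h5 : Tendsto (fun k : ℕ => Real.log A / 2 * (1 / (k : ℝ)) +
      (j : ℝ) / 2 * ((Real.log ((k : ℝ) + 1) / ((k : ℝ) + 1)) * (((k : ℝ) + 1) / k))) atTop
      (𝓝 (Real.log A / 2 * 0 + (j : ℝ) / 2 * (0 * 1))) :=
    (tendsto_one_div_atTop_nhds_zero_nat.const_mul _).add ((h3.mul h4).const_mul _)
  simp only [mul_zero, zero_mul, add_zero] at h5
  refine h5.congr' ?_
  filter_upwards [eventually_gt_atTop 0] with k hk
  have hk' : (k : ℝ) ≠ 0 := by positivity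
  have hk1 : (k : ℝ) + 1 ≠ 0 := by positivity
  rw [Real.log_mul hA.ne' (by positivity), Real.log_pow]
  push_cast
  field_simp

lemma ereal_log_div_ofReal {x : ℝ} (hx : 0 < x) (n : ℕ) :
    ENNReal.log (ENNReal.ofReal x) / ((n : ℕ) : EReal) = ((Real.log x / n : ℝ) : EReal) := by
  rw [ENNReal.log_ofReal_of_pos hx, EReal.coe_div]
  rfl

lemma limsup_log_le {X : ℕ → ℝ≥0∞} {A : ℝ} (hA : 0 < A) (j : ℕ) {c : ℝ}
    (h : ∀ᶠ k : ℕ in atTop,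
      X k ≤ ENNReal.ofReal (A * ((k : ℝ) + 1) ^ j * Real.exp ((2 * k : ℕ) * c))) :
    limsup (fun k : ℕ => ENNReal.log (X k) / ((2 * k : ℕ) : EReal)) atTop ≤ (c : EReal) := by
  have ht : Tendsto (fun k : ℕ => ((Real.log (A * ((k : ℝ) + 1) ^ j) / ((2 * k : ℕ) : ℝ) + c : ℝ) :
      EReal)) atTop (𝓝 (c : EReal)) := by
    refine (continuous_coe_real_ereal.tendsto c).comp ?_
    simpa using (tendsto_log_poly_div A hA j).add_const c
  rw [← ht.limsup_eq]
  refine limsup_le_limsup ?_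
  filter_upwards [h, eventually_gt_atTop 0] with k hk hk0
  have hk0' : (k : ℝ) ≠ 0 := by positivity
  have h1 := EReal.div_le_div_right_of_nonneg (c := ((2 * k : ℕ) : EReal))
    (by positivity) (ENNReal.log_monotone hk)
  rw [ereal_log_div_ofReal (by positivity)] at h1
  refine h1.trans (le_of_eq ?_)
  rw [Real.log_mul (by positivity) (Real.exp_pos _).ne', Real.log_exp]
  congr 1
  push_cast
  field_simp

lemma le_liminf_log {X : ℕ → ℝ≥0∞} {A : ℝ} (hA : 0 < A) (j : ℕ) {c : ℝ} {v : ℕ → ℝ}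
    (hv : Tendsto v atTop (𝓝 c))
    (h : ∀ᶠ k : ℕ in atTop,
      ENNReal.ofReal (Real.exp ((2 * k : ℕ) * v k) / (A * ((k : ℝ) + 1) ^ j)) ≤ X k) :
    (c : EReal) ≤ liminf (fun k : ℕ => ENNReal.log (X k) / ((2 * k : ℕ) : EReal)) atTop := by
  have ht : Tendsto (fun k : ℕ =>
      ((v k - Real.log (A * ((k : ℝ) + 1) ^ j) / ((2 * k : ℕ) : ℝ) : ℝ) :
      EReal)) atTop (𝓝 (c : EReal)) := by
    refine (continuous_coe_real_ereal.tendsto c).comp ?_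
    simpa using hv.sub (tendsto_log_poly_div A hA j)
  rw [← ht.liminf_eq]
  refine liminf_le_liminf ?_
  filter_upwards [h, eventually_gt_atTop 0] with k hk hk0
  have hk0' : (k : ℝ) ≠ 0 := by positivity
  have h1 := EReal.div_le_div_right_of_nonneg (c := ((2 * k : ℕ) : EReal))
    (by positivity) (ENNReal.log_monotone hk)
  rw [ereal_log_div_ofReal (by positivity)] at h1
  refine le_trans (le_of_eq ?_) h1
  rw [Real.log_div (Real.exp_pos _).ne' (by positivity), Real.log_exp]
  congr 1
  push_cast
  field_simp

/-! ### Ensemble averages at the exponential scale -/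

/-- Minus the exponent of the mean number of codewords at normalized distance `q` from a balanced
output word; it is positive exactly when such a codeword is exponentially rare. -/
def gap (R q : ℝ) : ℝ := Real.log 2 - R - Real.binEntropy q

/-- Exponent of the contribution of the pair of normalized distances `(q, q')`, to the sent and to
a competing codeword, to the ensemble average of the truncated sum, for weights with exponents
`v` at `q` and `v'` at `q'`. -/
def pairExp (R T v v' q q' : ℝ) : ℝ :=
  Real.binEntropy q + min (T + v' - gap R q') (v - max 0 (gap R q'))

lemma codeSize_pos (R : ℝ) (n : ℕ) : 0 < codeSize R n := Nat.ceil_pos.2 (Real.exp_pos _)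

lemma codeSize_le {R : ℝ} (hR : 0 ≤ R) (n : ℕ) :
    (codeSize R n : ℝ) ≤ 2 * Real.exp (n * R) := by
  have h1 := (Nat.ceil_lt_add_one (Real.exp_pos (n * R)).le).le
  have h2 : 1 ≤ Real.exp (n * R) := Real.one_le_exp (by positivity)
  unfold codeSize
  linarith

lemma exp_le_centralBinom (k : ℕ) :
    Real.exp ((2 * k : ℕ) * Real.log 2) ≤ ((2 * k : ℕ) + 1) * ((2 * k).choose k : ℝ) := by
  rcases Nat.eq_zero_or_pos k with rfl | hk
  · simp
  have h := exp_le_choose (n := 2 * k) (d := k) (by omega)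
  have : (k : ℝ) / ((2 * k : ℕ) : ℝ) = 2⁻¹ := by
    have : (k : ℝ) ≠ 0 := by positivity
    push_cast; field_simp
  rwa [this, Real.binEntropy_two_inv] at h

lemma expect_codeSum_min_le_exp {R T c : ℝ} (hR : 0 ≤ R) {k : ℕ} {u : ℕ → ℝ}
    (hu0 : ∀ d, 0 ≤ u d) {V : ℝ → ℝ}
    (hu : ∀ d ≤ 2 * k, u d ≤ Real.exp ((2 * k : ℕ) * V ((d : ℝ) / (2 * k : ℕ))))
    (hV : ∀ q ∈ Icc (0 : ℝ) 1, ∀ q' ∈ Icc (0 : ℝ) 1, pairExp R T (V q) (V q') q q' ≤ c) :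
    𝔼 C : Codebook (codeSize R (2 * k)) (2 * k), codeSum min T u C ≤
      16 * ((k : ℝ) + 1) ^ 3 * Real.exp ((2 * k : ℕ) * c) := by
  refine (expect_codeSum_min_le T hu0 (codeSize_pos R _) k).trans ?_
  set n := 2 * k with hn
  set B : ℝ := 2 * ((n : ℝ) + 1) with hB
  have hB1 : 1 ≤ B := by have : (0 : ℝ) ≤ n := Nat.cast_nonneg n; linarith
  have hmem : ∀ d ∈ Finset.range (n + 1), (d : ℝ) / n ∈ Icc (0 : ℝ) 1 := by
    intro d hd
    have : (d : ℝ) ≤ n := by exact_mod_cast Nat.lt_succ_iff.1 (Finset.mem_range.1 hd)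
    exact ⟨by positivity, div_le_one_of_le₀ this (Nat.cast_nonneg _)⟩
  have hterm : ∀ d ∈ Finset.range (n + 1), ∀ d' ∈ Finset.range (n + 1), ((n).choose d : ℝ) *
      min ((codeSize R n) * ((n).choose d' / (n).choose k : ℝ) * (Real.exp (n * T) * u d'))
        (u d * min 1 ((codeSize R n) * ((n).choose d' / (n).choose k : ℝ))) ≤
      B * Real.exp (n * c) := by
    intro d hd d' hd'
    have hdn := Nat.lt_succ_iff.1 (Finset.mem_range.1 hd)
    have hdn' := Nat.lt_succ_iff.1 (Finset.mem_range.1 hd')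
    set q := (d : ℝ) / n
    set q' := (d' : ℝ) / n
    have hp : (codeSize R n : ℝ) * ((n).choose d' / (n).choose k : ℝ) ≤
        B * Real.exp (-(n * gap R q')) := by
      have hc : (0 : ℝ) < (n).choose k := by exact_mod_cast Nat.choose_pos (by omega)
      have h1 := choose_le_exp hdn'
      have h2 : ((n : ℕ) + 1 : ℝ) * ((n).choose k : ℝ) * Real.exp (-(n * Real.log 2)) ≥ 1 := by
        have := exp_le_centralBinom k
        rw [Real.exp_neg, ge_iff_le, ← div_eq_mul_inv, le_div_iff₀ (Real.exp_pos _), one_mul]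
        exact this
      have h3 : ((n).choose d' / (n).choose k : ℝ) ≤ ((n : ℝ) + 1) *
          (Real.exp (n * Real.binEntropy q') * Real.exp (-(n * Real.log 2))) := by
        rw [div_le_iff₀ hc]
        calc ((n).choose d' : ℝ) ≤ Real.exp (n * Real.binEntropy q') * 1 := by
              rw [mul_one]; exact h1
          _ ≤ Real.exp (n * Real.binEntropy q') *
              (((n : ℕ) + 1 : ℝ) * ((n).choose k : ℝ) * Real.exp (-(n * Real.log 2))) :=
            mul_le_mul_of_nonneg_left h2 (Real.exp_pos _).le
          _ = _ := by ring
      calc _ ≤ (2 * Real.exp (n * R)) * (((n : ℝ) + 1) *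
          (Real.exp (n * Real.binEntropy q') * Real.exp (-(n * Real.log 2)))) :=
            mul_le_mul (codeSize_le hR n) h3 (by positivity) (by positivity)
        _ = B * (Real.exp (n * R) * (Real.exp (n * Real.binEntropy q') *
            Real.exp (-(n * Real.log 2)))) := by rw [hB]; ring
        _ = _ := by
            rw [← Real.exp_add, ← Real.exp_add, gap]
            congr 2; ring
    have hp0 : 0 ≤ (codeSize R n : ℝ) * ((n).choose d' / (n).choose k : ℝ) := by positivity
    have hexp0 : ∀ x : ℝ, 0 ≤ Real.exp x := fun x => (Real.exp_pos x).le
    have hmin : min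
        ((codeSize R n) * ((n).choose d' / (n).choose k : ℝ) * (Real.exp (n * T) * u d'))
        (u d * min 1 ((codeSize R n) * ((n).choose d' / (n).choose k : ℝ))) ≤
        B * Real.exp (n * min (T + V q' - gap R q') (V q - max 0 (gap R q'))) := by
      rcases min_cases (T + V q' - gap R q') (V q - max 0 (gap R q')) with h | h
      · rw [h.1]
        refine (min_le_left _ _).trans ?_
        calc _ ≤ B * Real.exp (-(n * gap R q')) * (Real.exp (n * T) * Real.exp (n * V q')) :=
              mul_le_mul hp (mul_le_mul_of_nonneg_left (hu d' hdn') (hexp0 _))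
                (mul_nonneg (hexp0 _) (hu0 _)) (by positivity)
          _ = _ := by
              rw [mul_assoc, ← Real.exp_add, ← Real.exp_add]
              congr 2; ring
      · rw [h.1]
        refine (min_le_right _ _).trans ?_
        have h4 : min 1 ((codeSize R n) * ((n).choose d' / (n).choose k : ℝ)) ≤
            B * Real.exp (-(n * max 0 (gap R q'))) := by
          rcases max_cases 0 (gap R q') with h' | h'
          · rw [h'.1]
            exact (min_le_left _ _).trans (by simpa using hB1)
          · rw [h'.1]
            exact (min_le_right _ _).trans hp
        calc _ ≤ Real.exp (n * V q) * (B * Real.exp (-(n * max 0 (gap R q')))) :=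
              mul_le_mul (hu d hdn) h4 (le_min zero_le_one hp0) (hexp0 _)
          _ = B * (Real.exp (n * V q) * Real.exp (-(n * max 0 (gap R q')))) := by ring
          _ = _ := by
              rw [← Real.exp_add]
              congr 2; ring
    calc _ ≤ Real.exp (n * Real.binEntropy q) *
          (B * Real.exp (n * min (T + V q' - gap R q') (V q - max 0 (gap R q')))) :=
          mul_le_mul (choose_le_exp hdn) hmin (le_min (by have := hu0 d'; positivity)
            (mul_nonneg (hu0 _) (le_min zero_le_one hp0))) (hexp0 _)
      _ = B * Real.exp (n * pairExp R T (V q) (V q') q q') := by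
          rw [mul_left_comm, ← Real.exp_add, ← mul_add, pairExp]
      _ ≤ _ := by
          have := hV q (hmem d hd) q' (hmem d' hd')
          gcongr
  calc _ ≤ ∑ d ∈ Finset.range (n + 1), ∑ d' ∈ Finset.range (n + 1), B * Real.exp (n * c) :=
        Finset.sum_le_sum fun d hd => Finset.sum_le_sum fun d' hd' => hterm d hd d' hd'
    _ = 2 * ((n : ℝ) + 1) ^ 3 * Real.exp (n * c) := by
        simp only [Finset.sum_const, Finset.card_range, nsmul_eq_mul, hB]
        push_cast
        ring
    _ ≤ 2 * (2 * ((k : ℝ) + 1)) ^ 3 * Real.exp (n * c) := by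
        have : (n : ℝ) + 1 ≤ 2 * ((k : ℝ) + 1) := by rw [hn]; push_cast; linarith
        gcongr
    _ = _ := by ring

/-- The lower bound for one joint type, at the exponential scale. -/
lemma exp_le_expect_codeSum {ψ : ℝ → ℝ → ℝ} (hψ0 : ∀ s c, 0 ≤ s → 0 ≤ c → 0 ≤ ψ s c)
    (hψ : ∀ s s' c, 0 ≤ c → s ≤ s' → ψ s c ≤ ψ s' c) (T : ℝ) {u : ℕ → ℝ} (hu : ∀ d, 0 ≤ u d)
    {R : ℝ} {k j j' : ℕ} (hj : j ≤ k) (hj' : j' ≤ k)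
    (hk : 2 ≤ Real.exp ((2 * k : ℕ) * R)) :
    Real.exp ((2 * k : ℕ) * (Real.binEntropy ((j : ℝ) / k) - max 0 (gap R ((j' : ℝ) / k)))) /
        (16 * ((k : ℝ) + 1) ^ 4) *
      ψ (max 1 (Real.exp (-((2 * k : ℕ) * gap R ((j' : ℝ) / k))) / (4 * ((k : ℝ) + 1) ^ 2)) *
        (Real.exp ((2 * k : ℕ) * T) * u (2 * j'))) (u (2 * j)) ≤
      𝔼 C : Codebook (codeSize R (2 * k)) (2 * k), codeSum ψ T u C := by
  have hsq : ∀ i ≤ k, Real.exp ((2 * k : ℕ) * Real.binEntropy ((i : ℝ) / k)) / ((k : ℝ) + 1) ^ 2 ≤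
      (k.choose i : ℝ) ^ 2 := by
    intro i hi
    have h := exp_le_choose hi
    rw [div_le_iff₀ (by positivity)]
    calc _ = Real.exp (k * Real.binEntropy ((i : ℝ) / k)) ^ 2 := by
          rw [← Real.exp_nat_mul]; push_cast; congr 1; ring
      _ ≤ (((k : ℝ) + 1) * (k.choose i : ℝ)) ^ 2 := by gcongr
      _ = _ := by ring
  set g := gap R ((j' : ℝ) / k) with hg
  set l : ℝ := Real.exp (-((2 * k : ℕ) * g)) / (2 * ((k : ℝ) + 1) ^ 2) with hldef
  have hl0 : 0 < l := by positivity
  have hM : Real.exp ((2 * k : ℕ) * R) / 2 ≤ ((codeSize R (2 * k) - 1 : ℕ) : ℝ) := by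
    rw [Nat.cast_sub (codeSize_pos R _)]
    have : Real.exp ((2 * k : ℕ) * R) ≤ codeSize R (2 * k) := Nat.le_ceil _
    push_cast at this ⊢
    push_cast at hk
    linarith
  have hcb : ((2 * k).choose k : ℝ) ≤ Real.exp ((2 * k : ℕ) * Real.log 2) :=
    (choose_le_exp (by omega)).trans (Real.exp_le_exp.2
      (mul_le_mul_of_nonneg_left Real.binEntropy_le_log_two (Nat.cast_nonneg _)))
  have hl : l ≤ ((codeSize R (2 * k) - 1 : ℕ) : ℝ) *
      ((k.choose j' : ℝ) ^ 2 / (2 * k).choose k) := by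
    have hc : (0 : ℝ) < (2 * k).choose k := by exact_mod_cast Nat.choose_pos (by omega)
    calc l = Real.exp ((2 * k : ℕ) * R) / 2 *
          (Real.exp ((2 * k : ℕ) * Real.binEntropy ((j' : ℝ) / k)) / ((k : ℝ) + 1) ^ 2 /
            Real.exp ((2 * k : ℕ) * Real.log 2)) := by
          have e : Real.exp (-((2 * k : ℕ) * g)) = Real.exp ((2 * k : ℕ) * R) *
              Real.exp ((2 * k : ℕ) * Real.binEntropy ((j' : ℝ) / k)) /
              Real.exp ((2 * k : ℕ) * Real.log 2) := by
            rw [← Real.exp_add, ← Real.exp_sub, hg, gap]; congr 1; ring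
          rw [hldef, e]
          field_simp
      _ ≤ _ := by
          refine mul_le_mul hM ?_ (by positivity) (Nat.cast_nonneg _)
          exact div_le_div₀ (by positivity) (hsq j' hj') hc hcb
  refine le_trans ?_ (le_expect_codeSum hψ0 hψ T hu (codeSize_pos R _) k j j' hl0 hl)
  rw [← mul_assoc ((k.choose j : ℝ) ^ 2)]
  have hmax : max 1 (l / 2) =
      max 1 (Real.exp (-((2 * k : ℕ) * g)) / (4 * ((k : ℝ) + 1) ^ 2)) := by
    rw [hldef, div_div]; congr 2; ring
  rw [hmax]
  refine mul_le_mul_of_nonneg_right ?_ (hψ0 _ _ (mul_nonneg (le_max_of_le_left zero_le_one)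
    (mul_nonneg (Real.exp_pos _).le (hu _))) (hu _))
  have hfrac : Real.exp (-((2 * k : ℕ) * max 0 g)) / (16 * ((k : ℝ) + 1) ^ 2) ≤
      l / (4 * (1 + l)) := by
    set E := Real.exp (-((2 * k : ℕ) * max 0 g)) with hE
    have hE1 : E ≤ 1 := Real.exp_le_one_iff.2 (by
      have : 0 ≤ ((2 * k : ℕ) : ℝ) * max 0 g := mul_nonneg (Nat.cast_nonneg _) (le_max_left _ _)
      linarith)
    have hEl : E / (2 * ((k : ℝ) + 1) ^ 2) ≤ l := by
      rw [hldef]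
      gcongr
      rw [hE]
      gcongr
      exact le_max_right _ _
    have hm : E / (2 * ((k : ℝ) + 1) ^ 2) ≤ 1 := by
      rw [div_le_one (by positivity)]
      have : (0 : ℝ) ≤ k := Nat.cast_nonneg k
      nlinarith
    have e8 : E / (16 * ((k : ℝ) + 1) ^ 2) = E / (2 * ((k : ℝ) + 1) ^ 2) / 8 := by
      rw [div_div]; congr 1; ring
    rw [e8]
    set m := E / (2 * ((k : ℝ) + 1) ^ 2)
    rw [le_div_iff₀ (by positivity)]
    nlinarith
  calc _ = Real.exp ((2 * k : ℕ) * Real.binEntropy ((j : ℝ) / k)) / ((k : ℝ) + 1) ^ 2 *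
        (Real.exp (-((2 * k : ℕ) * max 0 g)) / (16 * ((k : ℝ) + 1) ^ 2)) := by
        rw [mul_sub, sub_eq_add_neg, Real.exp_add]
        field_simp
    _ ≤ _ := mul_le_mul (hsq j hj) hfrac (by positivity) (by positivity)

lemma exp_pairExp_le_expect_codeSum_min (T : ℝ) {u : ℕ → ℝ} (hu : ∀ d, 0 ≤ u d)
    {R : ℝ} {k j j' : ℕ} (hj : j ≤ k) (hj' : j' ≤ k)
    (hk : 2 ≤ Real.exp ((2 * k : ℕ) * R)) {v v' : ℝ} (hv : Real.exp ((2 * k : ℕ) * v) ≤ u (2 * j))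
    (hv' : Real.exp ((2 * k : ℕ) * v') ≤ u (2 * j')) :
    Real.exp ((2 * k : ℕ) * pairExp R T v v' ((j : ℝ) / k) ((j' : ℝ) / k)) /
        (64 * ((k : ℝ) + 1) ^ 6) ≤
      𝔼 C : Codebook (codeSize R (2 * k)) (2 * k), codeSum min T u C := by
  refine le_trans ?_ (exp_le_expect_codeSum (ψ := min) (fun s c hs hc => le_min hs hc)
    (fun s s' c _ h => min_le_min_right _ h) T hu hj hj' hk)
  set g := gap R ((j' : ℝ) / k) with hg
  set D : ℝ := 4 * ((k : ℝ) + 1) ^ 2 with hD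
  have hD1 : 1 ≤ D := by
    have : (0 : ℝ) ≤ k := Nat.cast_nonneg k
    nlinarith
  have hmax : Real.exp ((2 * k : ℕ) * max 0 (-g)) / D ≤
      max 1 (Real.exp (-((2 * k : ℕ) * g)) / D) := by
    rcases max_cases 0 (-g) with h | h
    · rw [h.1, mul_zero, Real.exp_zero]
      exact le_max_of_le_left (div_le_one_of_le₀ hD1 (by linarith))
    · rw [h.1, mul_neg]
      exact le_max_right _ _
  set N : ℝ := ((2 * k : ℕ) : ℝ) with hN
  have hN0 : 0 ≤ N := Nat.cast_nonneg _
  have hmain : Real.exp (N * min (max 0 (-g) + T + v') v) / D ≤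
      min (max 1 (Real.exp (-(N * g)) / D) * (Real.exp (N * T) * u (2 * j'))) (u (2 * j)) := by
    refine le_min ?_ ?_
    · calc _ ≤ Real.exp (N * (max 0 (-g) + T + v')) / D := by
            gcongr; exact min_le_left _ _
        _ = Real.exp (N * max 0 (-g)) / D * (Real.exp (N * T) * Real.exp (N * v')) := by
            rw [mul_add, mul_add, Real.exp_add, Real.exp_add]; ring
        _ ≤ _ := by
            refine mul_le_mul hmax (mul_le_mul_of_nonneg_left hv' (Real.exp_pos _).le)
              (by positivity) (le_max_of_le_left zero_le_one)
    · calc _ ≤ Real.exp (N * min (max 0 (-g) + T + v') v) := div_le_self (Real.exp_pos _).le hD1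
        _ ≤ Real.exp (N * v) := by gcongr; exact min_le_right _ _
        _ ≤ _ := hv
  refine le_trans (le_of_eq ?_) (mul_le_mul_of_nonneg_left hmain (by positivity))
  have e : pairExp R T v v' ((j : ℝ) / k) ((j' : ℝ) / k) =
      (Real.binEntropy ((j : ℝ) / k) - max 0 g) + min (max 0 (-g) + T + v') v := by
    unfold pairExp
    rw [← hg, sub_add_eq_add_sub, add_sub_assoc (Real.binEntropy _), ← min_sub_sub_right]
    congr 2
    rcases le_total 0 g with h | h
    · rw [max_eq_right h, max_eq_left (by linarith)]; ring
    · rw [max_eq_left h, max_eq_right (by linarith)]; ring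
  rw [e, mul_add, Real.exp_add, hD]
  field_simp
  ring

lemma tendsto_floor_mul_div {q : ℝ} (hq : 0 ≤ q) :
    Tendsto (fun k : ℕ => (⌊q * k⌋₊ : ℝ) / k) atTop (𝓝 q) := by
  have := (tendsto_nat_floor_mul_div_atTop hq).comp (tendsto_natCast_atTop_atTop (R := ℝ))
  exact this

lemma floor_mul_le {q : ℝ} (hq : q ≤ 1) (k : ℕ) : ⌊q * k⌋₊ ≤ k := by
  refine Nat.floor_le_of_le ?_
  have : (0 : ℝ) ≤ k := Nat.cast_nonneg k
  nlinarith

lemma eventually_two_le_exp {R : ℝ} (hR : 0 < R) :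
    ∀ᶠ k : ℕ in atTop, 2 ≤ Real.exp ((2 * k : ℕ) * R) := by
  have h : Tendsto (fun k : ℕ => Real.exp ((2 * k : ℕ) * R)) atTop atTop := by
    refine Real.tendsto_exp_atTop.comp (Tendsto.atTop_mul_const hR ?_)
    exact tendsto_natCast_atTop_atTop.comp (tendsto_id.const_mul_atTop' (by norm_num))
  exact h.eventually_ge_atTop 2

lemma continuous_gap (R : ℝ) : Continuous (gap R) := by
  unfold gap; fun_prop

/-! ### Binary divergence and the Gilbert–Varshamov distance -/

/-- The real-valued normalized log-likelihood `q log θ + (1 - q) log (1 - θ)`, for `0 < θ < 1`. -/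
def lik (θ q : ℝ) : ℝ := q * Real.log θ + (1 - q) * Real.log (1 - θ)

/-- The real-valued binary divergence `D(q ‖ θ)`, for `0 < θ < 1`. -/
def div2 (θ q : ℝ) : ℝ := -Real.binEntropy q - lik θ q

lemma logLik_eq {θ : ℝ} (h0 : 0 < θ) (h1 : θ < 1) (q : ℝ) : logLik q θ = (lik θ q : EReal) := by
  unfold logLik elog lik
  rw [ENNReal.log_ofReal_of_pos h0, ENNReal.log_ofReal_of_pos (by linarith)]
  push_cast
  rfl

lemma divB_eq {θ : ℝ} (h0 : 0 < θ) (h1 : θ < 1) (q : ℝ) : divB q θ = (div2 θ q : EReal) := by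
  unfold divB div2
  rw [logLik_eq h0 h1, EReal.coe_sub]

lemma logLik_one_sub (q θ : ℝ) : logLik q (1 - θ) = logLik (1 - q) θ := by
  unfold logLik
  rw [sub_sub_cancel, sub_sub_cancel, add_comm]

lemma logLik_zero_right {q : ℝ} (hq : 0 < q) : logLik q 0 = ⊥ := by
  unfold logLik elog
  rw [ENNReal.ofReal_zero, ENNReal.log_zero, EReal.coe_mul_bot_of_pos hq]
  simp

lemma logLik_zero_zero : logLik 0 0 = 0 := by
  unfold logLik elog
  simp

lemma lik_one_sub (θ q : ℝ) : lik (1 - θ) q = lik θ (1 - q) := by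
  unfold lik; rw [sub_sub_cancel, sub_sub_cancel, add_comm]

lemma beta_eq {θ : ℝ} (h0 : 0 < θ) (h1 : θ < 1) :
    beta θ = Real.log (1 - θ) - Real.log θ := by
  unfold beta
  rw [Real.log_div (by linarith) h0.ne']

lemma lik_eq {θ : ℝ} (h0 : 0 < θ) (h1 : θ < 1) (q : ℝ) :
    lik θ q = Real.log (1 - θ) - q * beta θ := by
  rw [beta_eq h0 h1, lik]; ring

lemma beta_pos {θ : ℝ} (h0 : 0 < θ) (h1 : θ < 1 / 2) : 0 < beta θ := by
  unfold beta
  exact Real.log_pos (by rw [lt_div_iff₀ h0]; linarith)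

lemma beta_one_sub {θ : ℝ} (h0 : 0 < θ) (h1 : θ < 1) : beta (1 - θ) = -beta θ := by
  rw [beta_eq h0 h1, beta_eq (by linarith) (by linarith), sub_sub_cancel]; ring

lemma continuous_lik (θ : ℝ) : Continuous (lik θ) := by unfold lik; fun_prop

lemma continuous_div2 (θ : ℝ) : Continuous (div2 θ) := by
  unfold div2; exact Real.binEntropy_continuous.neg.sub (continuous_lik θ)

lemma lik_self (θ : ℝ) : lik θ θ = -Real.binEntropy θ := by
  rw [lik, Real.binEntropy, Real.log_inv, Real.log_inv]; ring

lemma div2_self (θ : ℝ) : div2 θ θ = 0 := by rw [div2, lik_self]; ring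

lemma div2_nonneg {θ q : ℝ} (h0 : 0 < θ) (h1 : θ < 1) (hq : q ∈ Icc (0 : ℝ) 1) :
    0 ≤ div2 θ q := by
  have key : ∀ a b : ℝ, 0 ≤ a → 0 < b → a * Real.log b - a * Real.log a ≤ b - a := by
    intro a b ha hb
    rcases ha.eq_or_lt with rfl | ha
    · simpa using hb.le
    · have := Real.log_le_sub_one_of_pos (div_pos hb ha)
      rw [Real.log_div hb.ne' ha.ne'] at this
      have h2 := mul_le_mul_of_nonneg_left this ha.le
      have h3 : a * (b / a - 1) = b - a := by field_simp
      linarith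
  have k1 := key q θ hq.1 h0
  have k2 := key (1 - q) (1 - θ) (by linarith [hq.2]) (by linarith)
  rw [div2, lik, Real.binEntropy, Real.log_inv, Real.log_inv]
  linarith

lemma divB_nonneg {θ q : ℝ} (hθ : θ ∈ Icc (0 : ℝ) 1) (hq : q ∈ Icc (0 : ℝ) 1) :
    0 ≤ divB q θ := by
  have zero : ∀ q ∈ Icc (0 : ℝ) 1, 0 ≤ divB q 0 := by
    intro q hq
    unfold divB
    rcases hq.1.eq_or_lt with rfl | h
    · rw [logLik_zero_zero]; simp
    · rw [logLik_zero_right h]; simp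
  rcases hθ.1.eq_or_lt with rfl | h0
  · exact zero q hq
  rcases hθ.2.eq_or_lt with rfl | h1
  · have := zero (1 - q) ⟨by linarith [hq.2], by linarith [hq.1]⟩
    unfold divB at this ⊢
    rwa [Real.binEntropy_one_sub, ← logLik_one_sub, sub_zero] at this
  · rw [divB_eq h0 h1]
    exact_mod_cast div2_nonneg h0 h1 hq

/-- The divergence decreases when `q` moves towards `θ`. -/
lemma div2_le_of_mem_uIcc {θ q c : ℝ} (h0 : 0 < θ) (h1 : θ < 1) (hq : q ∈ Icc (0 : ℝ) 1)
    (hc : c ∈ uIcc θ q) : div2 θ c ≤ div2 θ q := by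
  rw [← segment_eq_uIcc] at hc
  obtain ⟨a, b, ha, hb, hab, rfl⟩ := hc
  have hconc := Real.strictConcave_binEntropy.concaveOn.2 (x := θ) (y := q)
    ⟨h0.le, h1.le⟩ hq ha hb hab
  have hlin : lik θ (a • θ + b • q) = a * lik θ θ + b * lik θ q := by
    simp only [lik, smul_eq_mul]
    have : a = 1 - b := by linarith
    rw [this]; ring
  have hs := div2_self θ
  have hp := div2_nonneg h0 h1 hq
  simp only [smul_eq_mul] at hconc hlin ⊢
  have e : div2 θ (a * θ + b * q) ≤ a * div2 θ θ + b * div2 θ q := by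
    unfold div2; rw [hlin]; linarith
  rw [hs] at e
  nlinarith

/-- Below `1/2` the entropy increases, so the divergence grows at most with slope `β(θ)`. -/
lemma div2_le_add {θ q r : ℝ} (h0 : 0 < θ) (h1 : θ < 1) (hq : 0 ≤ q) (hqr : q ≤ r)
    (hr : r ≤ 1 / 2) : div2 θ r ≤ div2 θ q + beta θ * (r - q) := by
  have hm := Real.binEntropy_strictMonoOn.monotoneOn (a := q) (b := r)
    ⟨hq, by norm_num at hr ⊢; linarith⟩ ⟨by linarith, by norm_num at hr ⊢; linarith⟩ hqr
  rw [div2, div2, lik_eq h0 h1, lik_eq h0 h1]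
  linarith

lemma binEntropy_half : Real.binEntropy (1 / 2) = Real.log 2 := by
  rw [one_div]; exact Real.binEntropy_two_inv

lemma binEntropy_mono {p q : ℝ} (hp : 0 ≤ p) (hpq : p ≤ q) (hq : q ≤ 1 / 2) :
    Real.binEntropy p ≤ Real.binEntropy q :=
  Real.binEntropy_strictMonoOn.monotoneOn ⟨hp, by norm_num at hq ⊢; linarith⟩
    ⟨by linarith, by norm_num at hq ⊢; linarith⟩ hpq

lemma binEntropy_strictMono {p q : ℝ} (hp : 0 ≤ p) (hpq : p < q) (hq : q ≤ 1 / 2) :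
    Real.binEntropy p < Real.binEntropy q :=
  Real.binEntropy_strictMonoOn ⟨hp, by norm_num at hq ⊢; linarith⟩
    ⟨by linarith, by norm_num at hq ⊢; linarith⟩ hpq

lemma deltaGV_spec {R : ℝ} (hR : 0 < R) (hR2 : R ≤ Real.log 2) :
    0 ≤ deltaGV R ∧ deltaGV R < 1 / 2 ∧ Real.binEntropy (deltaGV R) = Real.log 2 - R := by
  set s : Set ℝ := {δ : ℝ | δ ∈ Icc (0 : ℝ) 1 ∧ Real.binEntropy δ = Real.log 2 - R} with hs
  obtain ⟨x, hx, hx'⟩ : ∃ x ∈ Icc (0 : ℝ) (1 / 2), Real.binEntropy x = Real.log 2 - R := by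
    have := intermediate_value_Icc (a := (0 : ℝ)) (b := 1 / 2) (by norm_num)
      Real.binEntropy_continuous.continuousOn
    rw [Real.binEntropy_zero, binEntropy_half] at this
    exact this ⟨by linarith, by linarith⟩
  have hxs : x ∈ s := ⟨⟨hx.1, by linarith [hx.2]⟩, hx'⟩
  have hcl : IsCompact s := by
    refine isCompact_Icc.of_isClosed_subset ?_ (fun y hy => hy.1 : s ⊆ Icc 0 1)
    exact isClosed_Icc.inter (isClosed_eq Real.binEntropy_continuous continuous_const)
  have hmem : deltaGV R ∈ s := hcl.sInf_mem ⟨x, hxs⟩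
  have hle : deltaGV R ≤ 1 / 2 := (csInf_le hcl.bddBelow hxs).trans hx.2
  refine ⟨hmem.1.1, lt_of_le_of_ne hle fun h => ?_, hmem.2⟩
  have := hmem.2
  rw [h, binEntropy_half] at this
  linarith

lemma gap_deltaGV {R : ℝ} (hR : 0 < R) (hR2 : R ≤ Real.log 2) : gap R (deltaGV R) = 0 := by
  rw [gap, (deltaGV_spec hR hR2).2.2]; ring

lemma gap_one_sub (R q : ℝ) : gap R (1 - q) = gap R q := by
  rw [gap, Real.binEntropy_one_sub, gap]

lemma gap_anti {R p q : ℝ} (hp : 0 ≤ p) (hpq : p ≤ q) (hq : q ≤ 1 / 2) : gap R q ≤ gap R p := by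
  have := binEntropy_mono hp hpq hq
  unfold gap; linarith

lemma gap_nonpos {R q : ℝ} (hR : 0 < R) (hR2 : R ≤ Real.log 2) (h1 : deltaGV R ≤ q)
    (h2 : q ≤ 1 - deltaGV R) : gap R q ≤ 0 := by
  obtain ⟨d0, d1, _⟩ := deltaGV_spec hR hR2
  rw [← gap_deltaGV hR hR2]
  rcases le_total q (1 / 2) with h | h
  · exact gap_anti d0 h1 h
  · rw [← gap_one_sub R q]
    exact gap_anti d0 (by linarith) (by linarith)

lemma le_of_gap_nonpos {R q : ℝ} (hR : 0 < R) (hR2 : R ≤ Real.log 2) (hq : q ∈ Icc (0 : ℝ) 1)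
    (h : gap R q ≤ 0) : deltaGV R ≤ q ∧ q ≤ 1 - deltaGV R := by
  obtain ⟨d0, d1, _⟩ := deltaGV_spec hR hR2
  have key : ∀ r, 0 ≤ r → gap R r ≤ 0 → deltaGV R ≤ r := by
    intro r hr hg
    by_contra! hlt
    have := binEntropy_strictMono hr hlt d1.le
    have h2 := gap_deltaGV hR hR2
    unfold gap at hg h2
    linarith
  refine ⟨key q hq.1 h, ?_⟩
  have := key (1 - q) (by linarith [hq.2]) (by rwa [gap_one_sub])
  linarith

/-! ### The single-letter exponent of the erasure probability -/

lemma E1BSC_one_sub (R T θ : ℝ) : E1BSC R T (1 - θ) = E1BSC R T θ := by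
  unfold E1BSC
  have h1 : (1 - θ = 0 ∨ 1 - θ = 1) ↔ (θ = 0 ∨ θ = 1) := by
    constructor
    · rintro (h | h)
      · right; linarith
      · left; linarith
    · rintro (h | h)
      · right; linarith
      · left; linarith
  have h2 : 1 - θ = 1 / 2 ↔ θ = 1 / 2 := by constructor <;> intro h <;> linarith
  simp only [h1, h2, sub_sub_cancel, min_comm (1 - θ) θ]

section Single

variable {R T θ : ℝ}

lemma E1BSC_eq_min (h0 : 0 < θ) (h1 : θ < 1 / 2) :
    E1BSC R T θ = min (EaBSC R T θ) (EbBSC R T θ) := by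
  unfold E1BSC
  have h : ¬ (θ = 0 ∨ θ = 1) := by rintro (h | h) <;> linarith
  rw [if_neg h, if_neg h1.ne, min_eq_left (by linarith : θ ≤ 1 - θ)]

lemma E1BSC_le_of_mem_Lhat (h0 : 0 < θ) (h1 : θ < 1 / 2) {q : ℝ} (hq : q ∈ LhatBSC R T θ) :
    E1BSC R T θ ≤ (div2 θ q : EReal) := by
  rw [E1BSC_eq_min h0 h1, ← divB_eq h0 (by linarith)]
  exact (min_le_right _ _).trans (iInf₂_le q hq)

lemma E1BSC_le_of_mem_Icc (h0 : 0 < θ) (h1 : θ < 1 / 2) {q : ℝ} (hq : θ ≤ q)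
    (hq' : q + T / beta θ ≤ deltaGV R) (hq1 : q ≤ 1) (hq0 : 0 ≤ q + T / beta θ) :
    E1BSC R T θ ≤ ((div2 θ q + gap R (q + T / beta θ) : ℝ) : EReal) := by
  rw [E1BSC_eq_min h0 h1]
  refine (min_le_left _ _).trans ((iInf₂_le q ⟨⟨hq, by linarith⟩, hq1, hq0⟩).trans (le_of_eq ?_))
  rw [divB_eq h0 (by linarith), ← EReal.coe_add, gap]
  congr 2; ring

lemma le_E1BSC (h0 : 0 < θ) (h1 : θ < 1 / 2) {x : ℝ}
    (ha : ∀ q, θ ≤ q → q + T / beta θ ≤ deltaGV R → q ≤ 1 → 0 ≤ q + T / beta θ →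
      x ≤ div2 θ q + gap R (q + T / beta θ))
    (hb : ∀ q ∈ LhatBSC R T θ, x ≤ div2 θ q) : (x : EReal) ≤ E1BSC R T θ := by
  rw [E1BSC_eq_min h0 h1]
  refine le_min (le_iInf₂ fun q hq => ?_) (le_iInf₂ fun q hq => ?_)
  · have := ha q hq.1.1 (by linarith [hq.1.2]) hq.2.1 hq.2.2
    rw [divB_eq h0 (by linarith), ← EReal.coe_add]
    rw [gap] at this
    exact_mod_cast (by linarith : x ≤ div2 θ q + (-Real.binEntropy (q + T / beta θ) +
      Real.log 2 - R))
  · rw [divB_eq h0 (by linarith)]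
    exact_mod_cast hb q hq

lemma mem_Lhat_of_le {q p : ℝ} (hq : q ∈ Icc (0 : ℝ) 1) (hp : p ∈ Icc (0 : ℝ) 1)
    (hg : gap R p ≤ 0) (h : -q * beta θ ≤ T - gap R p - p * beta θ) : q ∈ LhatBSC R T θ := by
  refine ⟨hq, ?_⟩
  have hmem : p ∈ {p : ℝ | p ∈ Icc (0 : ℝ) 1 ∧ Real.log 2 - Real.binEntropy p ≤ R} :=
    ⟨hp, by unfold gap at hg; linarith⟩
  refine le_trans ?_ (add_le_add_right (le_iSup₂ (f := fun (p : ℝ)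
    (_ : p ∈ {p : ℝ | p ∈ Icc (0 : ℝ) 1 ∧ Real.log 2 - Real.binEntropy p ≤ R}) =>
    ((-p * beta θ + Real.binEntropy p - Real.log 2 : ℝ) : EReal)) p hmem) _)
  unfold gap at h
  exact_mod_cast (by linarith : -q * beta θ ≤ (R + T) +
    (-p * beta θ + Real.binEntropy p - Real.log 2))

lemma exists_of_mem_Lhat {q ε : ℝ} (hq : q ∈ LhatBSC R T θ) (hε : 0 < ε) :
    ∃ p ∈ Icc (0 : ℝ) 1, gap R p ≤ 0 ∧ -q * beta θ - ε < T - gap R p - p * beta θ := by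
  by_contra! hcon
  have : (⨆ p ∈ {p : ℝ | p ∈ Icc (0 : ℝ) 1 ∧ Real.log 2 - Real.binEntropy p ≤ R},
      ((-p * beta θ + Real.binEntropy p - Real.log 2 : ℝ) : EReal)) ≤
      ((-q * beta θ - ε - (R + T) : ℝ) : EReal) := by
    refine iSup₂_le fun p hp => ?_
    have := hcon p hp.1 (by unfold gap; linarith [hp.2])
    unfold gap at this
    exact_mod_cast (by linarith :
      -p * beta θ + Real.binEntropy p - Real.log 2 ≤ -q * beta θ - ε - (R + T))
  have h2 := hq.2.trans (add_le_add_right this _)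
  rw [← EReal.coe_add] at h2
  have h3 : -q * beta θ ≤ (R + T) + (-q * beta θ - ε - (R + T)) := by exact_mod_cast h2
  linarith

lemma self_mem_Lhat (hR : 0 < R) (hR2 : R ≤ Real.log 2) (h0 : 0 < θ) (h1 : θ < 1 / 2)
    (h : deltaGV R ≤ θ + T / beta θ) :
    θ ∈ LhatBSC R T θ := by
  obtain ⟨d0, d1, d2⟩ := deltaGV_spec hR hR2
  have hb := beta_pos h0 h1
  refine mem_Lhat_of_le (p := deltaGV R) ⟨h0.le, by linarith⟩ ⟨d0, by linarith⟩
    (gap_deltaGV hR hR2).le ?_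
  rw [gap_deltaGV hR hR2]
  have := mul_le_mul_of_nonneg_right h hb.le
  rw [add_mul, div_mul_cancel₀ _ hb.ne'] at this
  linarith

lemma E1BSC_nonneg_of_lt_half (hR : 0 < R) (hR2 : R ≤ Real.log 2) (h0 : 0 < θ)
    (h1 : θ < 1 / 2) : 0 ≤ E1BSC R T θ := by
  obtain ⟨d0, d1, d2⟩ := deltaGV_spec hR hR2
  have hb := beta_pos h0 h1
  refine le_E1BSC h0 h1 (x := 0) (fun q hq hq' hq1 hq0 => ?_) fun q hq => ?_
  · have := gap_anti (R := R) hq0 hq' d1.le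
    rw [gap_deltaGV hR hR2] at this
    have := div2_nonneg h0 (by linarith) ⟨h0.le.trans hq, hq1⟩
    linarith
  · exact div2_nonneg h0 (by linarith) hq.1

lemma E1BSC_le_of_lt_half (hR : 0 < R) (hR2 : R ≤ Real.log 2) (hT : 0 ≤ T)
    (h0 : 0 < θ) (h1 : θ < 1 / 2) :
    E1BSC R T θ ≤ ((Real.log 2 - R : ℝ) : EReal) := by
  obtain ⟨d0, d1, d2⟩ := deltaGV_spec hR hR2
  have hb := beta_pos h0 h1
  have hTb : 0 ≤ T / beta θ := by positivity
  rcases le_total (deltaGV R) (θ + T / beta θ) with h | h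
  · refine (E1BSC_le_of_mem_Lhat h0 h1 (self_mem_Lhat hR hR2 h0 h1 h)).trans ?_
    rw [div2_self]
    exact_mod_cast (by linarith : (0 : ℝ) ≤ Real.log 2 - R)
  · refine (E1BSC_le_of_mem_Icc h0 h1 le_rfl h (by linarith) (by linarith)).trans ?_
    have := Real.binEntropy_nonneg (p := θ + T / beta θ) (by linarith) (by linarith)
    rw [div2_self, gap]
    exact_mod_cast (by linarith : 0 + (Real.log 2 - R - Real.binEntropy (θ + T / beta θ)) ≤
      Real.log 2 - R)

lemma E1BSC_zero (hT : 0 ≤ T) : E1BSC R T 0 = ((Real.log 2 - R : ℝ) : EReal) := by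
  unfold E1BSC; simp [hT]

lemma E1BSC_half (hR : 0 < R) (hT : 0 ≤ T) : E1BSC R T (1 / 2) = 0 := by
  unfold E1BSC
  rw [if_neg (by norm_num), if_pos rfl, if_pos (by linarith)]

lemma E1BSC_mem (hR : 0 < R) (hR2 : R ≤ Real.log 2) (hT : 0 ≤ T)
    (hθ : θ ∈ Icc (0 : ℝ) 1) :
    0 ≤ E1BSC R T θ ∧ E1BSC R T θ ≤ ((Real.log 2 - R : ℝ) : EReal) := by
  have hlog : (0 : EReal) ≤ ((Real.log 2 - R : ℝ) : EReal) := by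
    exact_mod_cast (by linarith : (0 : ℝ) ≤ Real.log 2 - R)
  have key : ∀ θ ∈ Icc (0 : ℝ) (1 / 2),
      0 ≤ E1BSC R T θ ∧ E1BSC R T θ ≤ ((Real.log 2 - R : ℝ) : EReal) := by
    intro θ hθ
    rcases hθ.1.eq_or_lt with rfl | h0
    · rw [E1BSC_zero hT]; exact ⟨hlog, le_rfl⟩
    rcases hθ.2.eq_or_lt with rfl | h1
    · rw [E1BSC_half hR hT]; exact ⟨le_rfl, hlog⟩
    exact ⟨E1BSC_nonneg_of_lt_half hR hR2 h0 h1, E1BSC_le_of_lt_half hR hR2 hT h0 h1⟩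
  rcases le_total θ (1 / 2) with h | h
  · exact key θ ⟨hθ.1, h⟩
  · rw [← E1BSC_one_sub]
    exact key _ ⟨by linarith [hθ.2], by linarith⟩

lemma E1BSC_eq_coe (hR : 0 < R) (hR2 : R ≤ Real.log 2) (hT : 0 ≤ T)
    (hθ : θ ∈ Icc (0 : ℝ) 1) :
    E1BSC R T θ = ((E1BSC R T θ).toReal : EReal) := by
  obtain ⟨h1, h2⟩ := E1BSC_mem hR hR2 hT hθ
  refine (EReal.coe_toReal (ne_top_of_le_ne_top (EReal.coe_ne_top _) h2) ?_).symm
  exact ne_bot_of_le_ne_bot EReal.zero_ne_bot h1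

/-- Truncating at the sent codeword's likelihood loses nothing in the exponent: below `1/2` the
divergence grows with slope at most `β(θ)`, so that the distance `q` to the sent codeword may be
increased until the competing codewords reach the threshold. -/
lemma E1BSC_le_pair (hR : 0 < R) (hR2 : R ≤ Real.log 2) (hT : 0 ≤ T)
    (h0 : 0 < θ) (h1 : θ < 1 / 2) {q q' : ℝ} (hq : q ∈ Icc (0 : ℝ) 1)
    (hq' : q' ∈ Icc (0 : ℝ) 1) :
    E1BSC R T θ ≤
      ((div2 θ q + max (gap R q' - T + beta θ * (q' - q)) (max 0 (gap R q')) : ℝ) : EReal) := by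
  obtain ⟨d0, d1, d2⟩ := deltaGV_spec hR hR2
  have hb := beta_pos h0 h1
  have hθ1 : θ < 1 := by linarith
  have hTb : 0 ≤ T / beta θ := by positivity
  have hTc : T / beta θ * beta θ = T := div_mul_cancel₀ _ hb.ne'
  have hhalf : ∀ r, 1 / 2 ≤ r → r ≤ 1 → r ∈ LhatBSC R T θ := by
    intro r hr hr1
    refine mem_Lhat_of_le (p := 1 / 2) ⟨by linarith, hr1⟩ ⟨by norm_num, by norm_num⟩
      (gap_nonpos hR hR2 d1.le (by linarith)) ?_
    rw [gap, binEntropy_half]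
    nlinarith
  -- competing distances at which codewords are plentiful
  have dense : ∀ p ∈ Icc (0 : ℝ) 1, gap R p ≤ 0 → E1BSC R T θ ≤
      ((div2 θ q + max (gap R p - T + beta θ * (p - q)) 0 : ℝ) : EReal) := by
    intro p hp hg
    rcases le_total (gap R p - T + beta θ * (p - q)) 0 with h | h
    · rw [max_eq_right h, add_zero]
      exact E1BSC_le_of_mem_Lhat h0 h1 (mem_Lhat_of_le hq hp hg (by linarith))
    · rw [max_eq_left h]
      set r := q + (gap R p - T + beta θ * (p - q)) / beta θ with hr
      have hrq : q ≤ r := by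
        have : 0 ≤ (gap R p - T + beta θ * (p - q)) / beta θ := div_nonneg h hb.le
        linarith
      have hrb : beta θ * (r - q) = gap R p - T + beta θ * (p - q) := by
        rw [hr]; field_simp; ring
      rcases le_total (1 / 2) q with h2 | h2
      · refine (E1BSC_le_of_mem_Lhat h0 h1 (hhalf q h2 hq.2)).trans ?_
        exact_mod_cast (by linarith)
      · rcases le_total r (1 / 2) with h3 | h3
        · have hm : r ∈ LhatBSC R T θ := mem_Lhat_of_le ⟨hq.1.trans hrq, by linarith⟩ hp hg
            (by linarith)
          refine (E1BSC_le_of_mem_Lhat h0 h1 hm).trans ?_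
          rw [← hrb]
          exact_mod_cast div2_le_add h0 hθ1 hq.1 hrq h3
        · refine (E1BSC_le_of_mem_Lhat h0 h1 (hhalf (1 / 2) le_rfl (by norm_num))).trans ?_
          rw [← hrb]
          have h4 := div2_le_add h0 hθ1 hq.1 h2 le_rfl
          have h5 : beta θ * (1 / 2 - q) ≤ beta θ * (r - q) :=
            mul_le_mul_of_nonneg_left (by linarith) hb.le
          exact_mod_cast h4.trans (by linarith)
  rcases le_or_gt (gap R q') 0 with hg | hg
  · rw [max_eq_left hg]
    exact dense q' hq' hg
  rw [max_eq_right hg.le]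
  rcases le_or_gt (deltaGV R) q' with hd | hd
  · -- beyond `1 - δ` competitors are as rare as, and farther than, those at `δ`
    refine (dense (deltaGV R) ⟨d0, by linarith⟩ (gap_deltaGV hR hR2).le).trans ?_
    rw [gap_deltaGV hR hR2]
    have h2 : beta θ * (deltaGV R - q) ≤ beta θ * (q' - q) :=
      mul_le_mul_of_nonneg_left (by linarith) hb.le
    have h3 : max (0 - T + beta θ * (deltaGV R - q)) 0 ≤
        max (gap R q' - T + beta θ * (q' - q)) (gap R q') :=
      max_le_max (by linarith) hg.le
    exact_mod_cast add_le_add_right h3 _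
  -- competing distances at which codewords are rare, with `q` moved up to `q' - T / β` if necessary
  · have rare : ∀ r, q ≤ r → r ≤ 1 → q' ≤ r + T / beta θ →
        E1BSC R T θ ≤ ((div2 θ r + gap R q' : ℝ) : EReal) := by
      intro r hqr hr1 hr
      have hr0 := hq.1.trans hqr
      rcases le_total (deltaGV R) (r + T / beta θ) with h2 | h2
      · have hm : r ∈ LhatBSC R T θ := by
          refine mem_Lhat_of_le ⟨hr0, hr1⟩ (p := deltaGV R) ⟨d0, by linarith⟩
            (gap_deltaGV hR hR2).le ?_
          rw [gap_deltaGV hR hR2]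
          have := mul_le_mul_of_nonneg_right h2 hb.le
          rw [add_mul, hTc] at this
          linarith
        refine (E1BSC_le_of_mem_Lhat h0 h1 hm).trans ?_
        exact_mod_cast (by linarith)
      · rcases le_total θ r with h3 | h3
        · refine (E1BSC_le_of_mem_Icc h0 h1 h3 h2 hr1 (by linarith)).trans ?_
          have := gap_anti (R := R) hq'.1 hr (h2.trans d1.le)
          exact_mod_cast (by linarith)
        · rcases le_total (θ + T / beta θ) (deltaGV R) with h4 | h4
          · refine (E1BSC_le_of_mem_Icc h0 h1 le_rfl h4 (by linarith) (by linarith)).trans ?_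
            have := gap_anti (R := R) hq'.1 (hr.trans (add_le_add_left h3 _)) (h4.trans d1.le)
            have hn := div2_nonneg h0 hθ1 ⟨hr0, hr1⟩
            rw [div2_self]
            exact_mod_cast (by linarith)
          · refine (E1BSC_le_of_mem_Lhat h0 h1 (self_mem_Lhat hR hR2 h0 h1 h4)).trans ?_
            have hn := div2_nonneg h0 hθ1 ⟨hr0, hr1⟩
            rw [div2_self]
            exact_mod_cast (by linarith)
    rcases le_total q' (q + T / beta θ) with h2 | h2
    · refine (rare q le_rfl hq.2 h2).trans ?_
      exact_mod_cast add_le_add_right (le_max_right _ _) _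
    · refine (rare (q' - T / beta θ) (by linarith) (by linarith) (by linarith)).trans ?_
      have h3 := div2_le_add h0 hθ1 hq.1 (by linarith : q ≤ q' - T / beta θ) (by linarith)
      have h4 : beta θ * (q' - T / beta θ - q) = -T + beta θ * (q' - q) := by
        have : beta θ * (T / beta θ) = T := by rw [mul_comm]; exact hTc
        linarith
      have h5 := le_max_left (gap R q' - T + beta θ * (q' - q)) (gap R q')
      exact_mod_cast (by linarith)

end Single

/-! ### The exponent of the erasure probability in the erasure mode -/

/-- The contribution of an output word to `Pr{E₁}` of Forney's decoder: the likelihood `c` of the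
sent codeword if it does not exceed the scaled likelihood `s` of the competitors. -/
def erased (s c : ℝ) : ℝ := if c ≤ s then c else 0

lemma erased_nonneg {s c : ℝ} (hc : 0 ≤ c) : 0 ≤ erased s c := by
  unfold erased; split_ifs <;> simp [hc]

lemma erased_mono {s s' c : ℝ} (hc : 0 ≤ c) (h : s ≤ s') : erased s c ≤ erased s' c := by
  unfold erased
  split_ifs with h1 h2
  · exact le_rfl
  · exact absurd (h1.trans h) h2
  · exact hc
  · exact le_rfl

lemma erased_le_min {s c : ℝ} (hs : 0 ≤ s) (hc : 0 ≤ c) : erased s c ≤ min s c := by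
  unfold erased
  split_ifs with h
  · exact le_min h le_rfl
  · exact le_min hs hc

lemma prE1_forney (T θ : ℝ) {M n : ℕ} (C : Codebook M n) :
    prE1 θ C (forney T θ C) = 1 / (M : ℝ) * ∑ m, ∑ y : Word n,
      erased (Real.exp (n * T) * ∑ m' ∈ Finset.univ.erase m, chan θ (C m').1 y)
        (chan θ (C m).1 y) := by
  classical
  unfold prE1
  congr 1
  refine Finset.sum_congr rfl fun m _ => ?_
  unfold erased
  rw [← Finset.sum_filter]
  refine Finset.sum_congr ?_ fun _ _ => rfl
  ext y
  simp [forney]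

/-- The likelihood of an output word at distance `d` from the sent codeword. -/
def chanWeight (θ : ℝ) (n d : ℕ) : ℝ := θ ^ d * (1 - θ) ^ (n - d)

lemma chanWeight_nonneg {θ : ℝ} (hθ : θ ∈ Icc (0 : ℝ) 1) (n d : ℕ) : 0 ≤ chanWeight θ n d :=
  mul_nonneg (pow_nonneg hθ.1 _) (pow_nonneg (by linarith [hθ.2]) _)

lemma chanWeight_eq_exp {θ : ℝ} (h0 : 0 < θ) (h1 : θ < 1) {n d : ℕ} (hn : 0 < n) (hd : d ≤ n) :
    chanWeight θ n d = Real.exp (n * lik θ ((d : ℝ) / n)) := by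
  have hn' : (n : ℝ) ≠ 0 := by positivity
  rw [chanWeight, pow_mul_pow_eq_exp h0 h1 hd, lik]
  congr 1
  field_simp

lemma avgE1_eq (R T θ : ℝ) (n : ℕ) :
    avgE1 R T θ n =
      𝔼 C : Codebook (codeSize R n) n, codeSum erased T (chanWeight θ n) C := by
  rw [Fintype.expect_eq_sum_div_card, avgE1]
  congr 1
  refine Finset.sum_congr rfl fun C _ => ?_
  simp_rw [prE1_forney, codeSum, chan_eq, chanWeight]

lemma codeSum_erased_le (T : ℝ) {u : ℕ → ℝ} (hu : ∀ d, 0 ≤ u d) {M n : ℕ} (C : Codebook M n) :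
    codeSum erased T u C ≤ codeSum min T u C := by
  unfold codeSum
  refine mul_le_mul_of_nonneg_left (Finset.sum_le_sum fun m _ => Finset.sum_le_sum fun y _ => ?_)
    (by positivity)
  exact erased_le_min (mul_nonneg (Real.exp_pos _).le (Finset.sum_nonneg fun _ _ => hu _)) (hu _)

/-- Complementing the output word exchanges `θ` and `1 - θ`. -/
lemma expE1_one_sub (R T θ : ℝ) : expE1 R T (1 - θ) = expE1 R T θ := by
  have hchan : ∀ {n : ℕ} (x y : Word n), chan (1 - θ) x (fun i => !y i) = chan θ x y := by
    intro n x y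
    unfold chan
    refine Finset.prod_congr rfl fun i _ => ?_
    cases x i <;> cases hy : y i <;> simp [hy]
  have : ∀ n, avgE1 R T (1 - θ) n = avgE1 R T θ n := by
    intro n
    unfold avgE1
    congr 1
    refine Finset.sum_congr rfl fun C _ => ?_
    rw [prE1_forney, prE1_forney]
    congr 1
    refine Finset.sum_congr rfl fun m _ => (Fintype.sum_equiv
      (Equiv.piCongrRight fun _ : Fin n => Equiv.boolNot) _ _ fun y => ?_).symm
    have e : (Equiv.piCongrRight fun _ : Fin n => Equiv.boolNot) y = fun i => !y i := rfl
    simp only [e, hchan]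
  unfold expE1
  simp_rw [this]

lemma neg_le_expE1_of_limsup {R T θ e : ℝ}
    (h : limsup (fun k : ℕ => ENNReal.log (ENNReal.ofReal (avgE1 R T θ (2 * k))) /
      ((2 * k : ℕ) : EReal)) atTop ≤ ((-e : ℝ) : EReal)) : (e : EReal) ≤ expE1 R T θ := by
  have := EReal.neg_le_neg_iff.2 ((liminf_le_limsup (f := atTop)).trans h)
  rwa [EReal.coe_neg, neg_neg] at this

/-- If no pair of joint types contributes more than `e^{-n e}`, the exponent is at least `e`. -/
lemma le_expE1_of_pairExp {R T θ e : ℝ} (hR : 0 ≤ R) (h0 : 0 ≤ θ) (h1 : θ ≤ 1) {V : ℝ → ℝ}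
    (hu : ∀ n d : ℕ, 0 < n → d ≤ n → chanWeight θ n d ≤ Real.exp (n * V ((d : ℝ) / n)))
    (h : ∀ q ∈ Icc (0 : ℝ) 1, ∀ q' ∈ Icc (0 : ℝ) 1, pairExp R T (V q) (V q') q q' ≤ -e) :
    (e : EReal) ≤ expE1 R T θ := by
  refine neg_le_expE1_of_limsup (limsup_log_le (A := 16) (by norm_num) 3 ?_)
  filter_upwards [eventually_gt_atTop 0] with k hk
  refine ENNReal.ofReal_le_ofReal ?_
  rw [avgE1_eq]
  have hw := chanWeight_nonneg ⟨h0, h1⟩ (2 * k)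
  refine (Finset.expect_le_expect fun C _ => codeSum_erased_le T hw C).trans ?_
  exact expect_codeSum_min_le_exp hR hw (fun d hd => hu (2 * k) d (by omega) hd) h

/-- A pair of distances `(q, p)` at which the competitors exceed the threshold bounds the exponent
from above. -/
lemma expE1_le_of_lt {R T θ q p : ℝ} (hR : 0 < R) (h0 : 0 < θ) (h1 : θ < 1)
    (hq : q ∈ Icc (0 : ℝ) 1) (hp : p ∈ Icc (0 : ℝ) 1)
    (h : lik θ q < max 0 (-gap R p) + T + lik θ p) :
    expE1 R T θ ≤ ((div2 θ q + max 0 (gap R p) : ℝ) : EReal) := by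
  set a : ℕ → ℝ := fun k => (⌊q * k⌋₊ : ℝ) / k with ha
  set b : ℕ → ℝ := fun k => (⌊p * k⌋₊ : ℝ) / k with hb
  have ta : Tendsto a atTop (𝓝 q) := tendsto_floor_mul_div hq.1
  have tb : Tendsto b atTop (𝓝 p) := tendsto_floor_mul_div hp.1
  set v : ℕ → ℝ := fun k => Real.binEntropy (a k) - max 0 (gap R (b k)) + lik θ (a k) with hv
  have tv : Tendsto v atTop (𝓝 (Real.binEntropy q - max 0 (gap R p) + lik θ q)) :=
    (((Real.binEntropy_continuous.tendsto q).comp ta).sub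
      (tendsto_const_nhds.max (((continuous_gap R).tendsto p).comp tb))).add
      (((continuous_lik θ).tendsto q).comp ta)
  have tthr : ∀ᶠ k : ℕ in atTop, lik θ (a k) <
      max 0 (-gap R (b k) - Real.log (4 * ((k : ℝ) + 1) ^ 2) / ((2 * k : ℕ) : ℝ)) + T +
        lik θ (b k) := by
    have t1 : Tendsto (fun k : ℕ =>
        max 0 (-gap R (b k) - Real.log (4 * ((k : ℝ) + 1) ^ 2) / ((2 * k : ℕ) : ℝ)) + T +
        lik θ (b k)) atTop (𝓝 (max 0 (-gap R p - 0) + T + lik θ p)) :=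
      ((tendsto_const_nhds.max ((((continuous_gap R).tendsto p).comp tb).neg.sub
        (tendsto_log_poly_div 4 (by norm_num) 2))).add_const T).add
        (((continuous_lik θ).tendsto p).comp tb)
    rw [sub_zero] at t1
    exact (((continuous_lik θ).tendsto q).comp ta).eventually_lt t1 h
  have hlim := le_liminf_log (X := fun k => ENNReal.ofReal (avgE1 R T θ (2 * k))) (A := 16)
    (by norm_num) 4 tv (by
      filter_upwards [tthr, eventually_gt_atTop 0, eventually_two_le_exp hR] with k hk hk0 hkR
      refine ENNReal.ofReal_le_ofReal ?_
      rw [avgE1_eq]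
      set N : ℝ := ((2 * k : ℕ) : ℝ) with hN
      have hN0 : 0 < N := by rw [hN]; exact_mod_cast (by omega : 0 < 2 * k)
      have hj := floor_mul_le hq.2 k
      have hj' := floor_mul_le hp.2 k
      have hw := chanWeight_nonneg (θ := θ) ⟨h0.le, h1.le⟩ (2 * k)
      have hwe : ∀ j ≤ k, chanWeight θ (2 * k) (2 * j) = Real.exp (N * lik θ ((j : ℝ) / k)) := by
        intro j hj
        rw [chanWeight_eq_exp h0 h1 (by omega) (by omega)]
        congr 3
        push_cast
        rw [mul_div_mul_left _ _ two_ne_zero]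
      have key := exp_le_expect_codeSum (ψ := erased)
        (fun s c _ hc => erased_nonneg hc)
        (fun s s' c hc h => erased_mono hc h) T hw hj hj' hkR
      refine le_trans ?_ key
      have hthr : chanWeight θ (2 * k) (2 * ⌊q * k⌋₊) ≤
          max 1 (Real.exp (-(N * gap R (b k))) / (4 * ((k : ℝ) + 1) ^ 2)) *
            (Real.exp (N * T) * chanWeight θ (2 * k) (2 * ⌊p * k⌋₊)) := by
        rw [hwe _ hj, hwe _ hj', ← Real.exp_add]
        have e1 : Real.exp (-(N * gap R (b k))) / (4 * ((k : ℝ) + 1) ^ 2) =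
            Real.exp (N * (-gap R (b k) - Real.log (4 * ((k : ℝ) + 1) ^ 2) / N)) := by
          rw [mul_sub, mul_div_cancel₀ _ hN0.ne', Real.exp_sub,
            Real.exp_log (by positivity : (0 : ℝ) < 4 * ((k : ℝ) + 1) ^ 2)]
          ring_nf
        have e2 : Real.exp (N * max 0 (-gap R (b k) - Real.log (4 * ((k : ℝ) + 1) ^ 2) / N)) ≤
            max 1 (Real.exp (-(N * gap R (b k))) / (4 * ((k : ℝ) + 1) ^ 2)) := by
          rw [e1]
          rcases max_cases 0 (-gap R (b k) - Real.log (4 * ((k : ℝ) + 1) ^ 2) / N) with h | h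
          · rw [h.1, mul_zero, Real.exp_zero]; exact le_max_left _ _
          · rw [h.1]; exact le_max_right _ _
        refine le_trans ?_ (mul_le_mul_of_nonneg_right e2 (Real.exp_pos _).le)
        rw [← Real.exp_add]
        refine Real.exp_le_exp.2 ?_
        have := mul_le_mul_of_nonneg_left hk.le hN0.le
        simp only [ha, hb] at this ⊢
        linarith
      have hval : erased (max 1 (Real.exp (-(N * gap R (b k))) / (4 * ((k : ℝ) + 1) ^ 2)) *
            (Real.exp (N * T) * chanWeight θ (2 * k) (2 * ⌊p * k⌋₊)))
            (chanWeight θ (2 * k) (2 * ⌊q * k⌋₊)) = Real.exp (N * lik θ (a k)) := by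
        rw [erased, if_pos hthr, hwe _ hj]
      refine le_trans (le_of_eq ?_) (mul_le_mul_of_nonneg_left hval.ge (by positivity))
      rw [hv, div_mul_eq_mul_div, ← Real.exp_add, ← mul_add])
  have := EReal.neg_le_neg_iff.2 hlim
  refine this.trans (le_of_eq ?_)
  rw [← EReal.coe_neg]
  congr 1
  unfold div2; ring

lemma chanWeight_zero (n d : ℕ) : chanWeight 0 n d = if d = 0 then 1 else 0 := by
  unfold chanWeight
  split_ifs with h
  · simp [h]
  · simp [h]

lemma expE1_zero {R T : ℝ} (hR : 0 < R) (hR2 : R ≤ Real.log 2) (hT : 0 ≤ T) :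
    expE1 R T 0 = ((Real.log 2 - R : ℝ) : EReal) := by
  have hg0 : gap R 0 = Real.log 2 - R := by simp [gap]
  refine le_antisymm ?_ ?_
  · have hlim := le_liminf_log (X := fun k => ENNReal.ofReal (avgE1 R T 0 (2 * k))) (A := 16)
      (by norm_num) 4 (v := fun _ => -(Real.log 2 - R)) tendsto_const_nhds (by
        filter_upwards [eventually_two_le_exp hR] with k hkR
        refine ENNReal.ofReal_le_ofReal ?_
        rw [avgE1_eq]
        have hw := chanWeight_nonneg (θ := 0) ⟨le_rfl, zero_le_one⟩ (2 * k)
        have key := exp_le_expect_codeSum (ψ := erased)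
          (fun s c _ hc => erased_nonneg hc)
          (fun s s' c hc h => erased_mono hc h) T hw (Nat.zero_le k) (Nat.zero_le k) hkR
        refine le_trans (le_of_eq ?_) key
        have h1 : (1 : ℝ) ≤ max 1 (Real.exp (-(((2 * k : ℕ) : ℝ) * (Real.log 2 - R))) /
            (4 * ((k : ℝ) + 1) ^ 2)) * Real.exp (((2 * k : ℕ) : ℝ) * T) :=
          one_le_mul_of_one_le_of_one_le (le_max_left _ _) (Real.one_le_exp (by positivity))
        simp only [Nat.cast_zero, zero_div, hg0, Real.binEntropy_zero, mul_zero, chanWeight_zero,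
          if_true, mul_one, erased, if_pos h1,
          max_eq_right (by linarith : 0 ≤ Real.log 2 - R), zero_sub])
    have := EReal.neg_le_neg_iff.2 hlim
    rwa [EReal.coe_neg, neg_neg] at this
  · -- a distance other than `0` has likelihood `0`; any large enough exponent will do for it
    set K : ℝ := R + T + 2 * Real.log 2 with hK
    have hl2 : 0 < Real.log 2 := Real.log_pos (by norm_num)
    refine le_expE1_of_pairExp hR.le le_rfl zero_le_one (V := fun q => if q ≤ 0 then 0 else -K)
      (fun n d hn hd => ?_) fun q hq q' hq' => ?_
    · rw [chanWeight_zero]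
      by_cases h : d = 0
      · simp [h]
      · rw [if_neg h]; exact (Real.exp_pos _).le
    · unfold pairExp
      have hh := Real.binEntropy_le_log_two (p := q)
      have hh' := Real.binEntropy_le_log_two (p := q')
      rcases hq.1.eq_or_lt with rfl | h
      · rcases hq'.1.eq_or_lt with rfl | h'
        · simp only [le_refl, if_true, Real.binEntropy_zero, hg0]
          have := min_le_right (T + 0 - (Real.log 2 - R)) (0 - max 0 (Real.log 2 - R))
          have := le_max_right 0 (Real.log 2 - R)
          linarith
        · rw [if_neg h'.not_ge]
          have := min_le_left (T + -K - gap R q')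
            ((if (0 : ℝ) ≤ 0 then 0 else -K) - max 0 (gap R q'))
          rw [Real.binEntropy_zero]
          unfold gap at this ⊢
          linarith
      · rw [if_neg h.not_ge]
        have := min_le_right (T + (if q' ≤ 0 then 0 else -K) - gap R q') (-K - max 0 (gap R q'))
        have := le_max_left 0 (gap R q')
        linarith

lemma pairExp_lik_eq {R T θ : ℝ} (h0 : 0 < θ) (h1 : θ < 1) (q q' : ℝ) :
    pairExp R T (lik θ q) (lik θ q') q q' =
      -(div2 θ q + max (gap R q' - T + beta θ * (q' - q)) (max 0 (gap R q'))) := by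
  have e : gap R q' - T + beta θ * (q' - q) = lik θ q - (T + lik θ q' - gap R q') := by
    rw [lik_eq h0 h1, lik_eq h0 h1]; ring
  have e' : max 0 (gap R q') = lik θ q - (lik θ q - max 0 (gap R q')) := by ring
  rw [pairExp, e, div2]
  conv_rhs => rw [e']
  rw [max_sub_sub_left]
  ring

lemma expE1_eq_of_lt_half {R T θ : ℝ} (hR : 0 < R) (hR2 : R ≤ Real.log 2) (hT : 0 ≤ T)
    (h0 : 0 < θ) (h1 : θ < 1 / 2) : expE1 R T θ = E1BSC R T θ := by
  have hθ1 : θ < 1 := by linarith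
  have hb := beta_pos h0 h1
  obtain ⟨d0, d1, d2⟩ := deltaGV_spec hR hR2
  have hTb : 0 ≤ T / beta θ := by positivity
  have hTc : T / beta θ * beta θ = T := div_mul_cancel₀ _ hb.ne'
  -- the strict inequality in `expE1_le_of_lt` is reached by increasing `q` slightly
  have lim : ∀ q c : ℝ, q < 1 / 2 →
      (∀ ε, 0 < ε → ε < 1 / 2 → expE1 R T θ ≤ ((div2 θ (q + ε) + c : ℝ) : EReal)) →
      expE1 R T θ ≤ ((div2 θ q + c : ℝ) : EReal) := by
    intro q c hq h
    have ht : Tendsto (fun ε : ℝ => ((div2 θ (q + ε) + c : ℝ) : EReal)) (𝓝[>] 0)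
        (𝓝 ((div2 θ q + c : ℝ) : EReal)) := by
      have hc : Continuous fun ε : ℝ => ((div2 θ (q + ε) + c : ℝ) : EReal) :=
        continuous_coe_real_ereal.comp
          (((continuous_div2 θ).comp (continuous_const.add continuous_id)).add continuous_const)
      have := hc.tendsto 0
      rw [add_zero] at this
      exact this.mono_left nhdsWithin_le_nhds
    refine ge_of_tendsto ht ?_
    filter_upwards [Ioo_mem_nhdsGT (by norm_num : (0 : ℝ) < 1 / 2)] with ε hε
    exact h ε hε.1 hε.2
  refine le_antisymm ?_ ?_
  · rw [E1BSC_eq_min h0 h1]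
    refine le_min (le_iInf₂ fun q hq => ?_) (le_iInf₂ fun q hq => ?_)
    · obtain ⟨⟨hq1, hq2⟩, hq3, hq4⟩ := hq
      have hle : q + T / beta θ ≤ deltaGV R := by linarith
      have hg : 0 ≤ gap R (q + T / beta θ) := by
        rw [← gap_deltaGV hR hR2]
        exact gap_anti hq4 hle d1.le
      rw [divB_eq h0 hθ1, ← EReal.coe_add]
      have e : -Real.binEntropy (q + T / beta θ) + Real.log 2 - R = gap R (q + T / beta θ) := by
        rw [gap]; ring
      rw [e]
      refine lim q _ (by linarith) fun ε hε hε' => ?_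
      have := expE1_le_of_lt (R := R) (T := T) (θ := θ) (q := q + ε) (p := q + T / beta θ) hR h0 hθ1
        ⟨by linarith, by linarith⟩ ⟨hq4, by linarith⟩ (by
          rw [lik_eq h0 hθ1, lik_eq h0 hθ1, max_eq_left (by linarith)]
          nlinarith)
      rwa [max_eq_right hg] at this
    · rw [divB_eq h0 hθ1]
      rcases le_or_gt (1 / 2) q with hq2 | hq2
      · have hg : gap R (1 / 2) = -R := by rw [gap, binEntropy_half]; ring
        have := expE1_le_of_lt (R := R) (T := T) (θ := θ) (q := q) (p := 1 / 2) hR h0 hθ1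
          hq.1 ⟨by norm_num, by norm_num⟩ (by
            rw [lik_eq h0 hθ1, lik_eq h0 hθ1, hg, neg_neg, max_eq_right hR.le]
            nlinarith)
        rwa [hg, max_eq_left (by linarith), add_zero] at this
      · have := lim q 0 hq2 fun ε hε hε' => ?_
        · rwa [add_zero] at this
        obtain ⟨p, hp, hg, hlt⟩ := exists_of_mem_Lhat hq (mul_pos hε hb)
        have := expE1_le_of_lt (R := R) (T := T) (θ := θ) (q := q + ε) (p := p) hR h0 hθ1
          ⟨by linarith [hq.1.1], by linarith⟩ hp (by
            rw [lik_eq h0 hθ1, lik_eq h0 hθ1, max_eq_right (by linarith)]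
            nlinarith)
        rwa [max_eq_left hg] at this
  · have hθm : θ ∈ Icc (0 : ℝ) 1 := ⟨h0.le, hθ1.le⟩
    rw [E1BSC_eq_coe hR hR2 hT hθm]
    refine le_expE1_of_pairExp hR.le h0.le hθ1.le (V := lik θ)
      (fun n d hn hd => (chanWeight_eq_exp h0 hθ1 hn hd).le) fun q hq q' hq' => ?_
    rw [pairExp_lik_eq h0 hθ1]
    have := E1BSC_le_pair hR hR2 hT h0 h1 hq hq'
    rw [E1BSC_eq_coe hR hR2 hT hθm] at this
    exact neg_le_neg (by exact_mod_cast this)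

/-- The single-letter formula for the exponent of the erasure probability. -/
theorem expE1_eq {R T θ : ℝ} (hR : 0 < R) (hR2 : R ≤ Real.log 2) (hT : 0 ≤ T)
    (hθ : θ ∈ Icc (0 : ℝ) 1) : expE1 R T θ = E1BSC R T θ := by
  have key : ∀ θ ∈ Icc (0 : ℝ) (1 / 2), expE1 R T θ = E1BSC R T θ := by
    intro θ hθ
    rcases hθ.1.eq_or_lt with rfl | h0
    · rw [E1BSC_zero hT, expE1_zero hR hR2 hT]
    rcases hθ.2.eq_or_lt with rfl | h1
    · rw [E1BSC_half hR hT]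
      refine le_antisymm ?_ ?_
      · have hg : gap R (1 / 2) = -R := by rw [gap, binEntropy_half]; ring
        have := expE1_le_of_lt (R := R) (T := T) (θ := 1 / 2) (q := 1 / 2) (p := 1 / 2) hR
          (by norm_num) (by norm_num) ⟨by norm_num, by norm_num⟩ ⟨by norm_num, by norm_num⟩ (by
            rw [hg, neg_neg, max_eq_right hR.le]; linarith)
        rwa [hg, max_eq_left (by linarith), div2_self, add_zero] at this
      · refine le_expE1_of_pairExp (e := 0) hR.le h0.le (by norm_num) (V := lik (1 / 2))
          (fun n d hn hd => (chanWeight_eq_exp h0 (by norm_num) hn hd).le) fun q hq q' hq' => ?_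
        rw [pairExp_lik_eq h0 (by norm_num)]
        have h2 := div2_nonneg h0 (by norm_num) hq
        have h3 := le_max_right (gap R q' - T + beta (1 / 2) * (q' - q)) (max 0 (gap R q'))
        have h4 := le_max_left 0 (gap R q')
        linarith
    exact expE1_eq_of_lt_half hR hR2 hT h0 h1
  rcases le_total θ (1 / 2) with h | h
  · exact key θ ⟨hθ.1, h⟩
  · rw [← expE1_one_sub, ← E1BSC_one_sub]
    exact key _ ⟨by linarith [hθ.2], by linarith⟩

/-! ### The optimal metric in the erasure mode -/

/-- The real-valued exponent `E₁(R, T, θ)`, for `T ≥ 0`. -/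
def eR (R T θ : ℝ) : ℝ := (E1BSC R T θ).toReal

section ExponentFacts

variable {R T : ℝ}

lemma coe_eR (hR : 0 < R) (hR2 : R ≤ Real.log 2) (hT : 0 ≤ T) {θ : ℝ} (hθ : θ ∈ Icc (0 : ℝ) 1) :
    E1BSC R T θ = (eR R T θ : EReal) := E1BSC_eq_coe hR hR2 hT hθ

lemma eR_mem (hR : 0 < R) (hR2 : R ≤ Real.log 2) (hT : 0 ≤ T) {θ : ℝ} (hθ : θ ∈ Icc (0 : ℝ) 1) :
    0 ≤ eR R T θ ∧ eR R T θ ≤ Real.log 2 - R := by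
  have := E1BSC_mem hR hR2 hT hθ
  rw [coe_eR hR hR2 hT hθ] at this
  exact_mod_cast this

lemma eR_one_sub (R T θ : ℝ) : eR R T (1 - θ) = eR R T θ := by
  unfold eR; rw [E1BSC_one_sub]

lemma eR_eq_zero (hR : 0 < R) (hR2 : R ≤ Real.log 2) (hT : 0 ≤ T) {θ : ℝ} (h0 : 0 < θ)
    (hd : deltaGV R ≤ θ) (h1 : θ ≤ 1 / 2) : eR R T θ = 0 := by
  rcases h1.eq_or_lt with rfl | h1
  · unfold eR; rw [E1BSC_half hR hT, EReal.toReal_zero]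
  have hθ : θ ∈ Icc (0 : ℝ) 1 := ⟨h0.le, by linarith⟩
  refine le_antisymm ?_ (eR_mem hR hR2 hT hθ).1
  have hb := beta_pos h0 h1
  have hTb : 0 ≤ T / beta θ := by positivity
  have := E1BSC_le_of_mem_Lhat h0 h1
    (self_mem_Lhat (T := T) hR hR2 h0 h1 (by linarith))
  rw [coe_eR hR hR2 hT hθ, div2_self] at this
  exact_mod_cast this

lemma beta_logistic (b : ℝ) : beta (1 / (1 + Real.exp b)) = b := by
  have h : 0 < Real.exp b := Real.exp_pos b
  unfold beta
  have : (1 - 1 / (1 + Real.exp b)) / (1 / (1 + Real.exp b)) = Real.exp b := by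
    field_simp; ring
  rw [this, Real.log_exp]

lemma beta_anti {θ θ' : ℝ} (h0 : 0 < θ) (h : θ ≤ θ') (h1 : θ' < 1) : beta θ' ≤ beta θ := by
  rw [beta_eq h0 (by linarith), beta_eq (by linarith) h1]
  have h2 := Real.log_le_log h0 h
  have h3 := Real.log_le_log (by linarith : 0 < 1 - θ') (by linarith : 1 - θ' ≤ 1 - θ)
  linarith

lemma tendsto_beta_zero : Tendsto beta (𝓝[>] 0) atTop := by
  refine tendsto_atTop.2 fun b => ?_
  have hpos : 0 < 1 / (1 + Real.exp b) := by positivity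
  have hlt : 1 / (1 + Real.exp b) < 1 := by
    rw [div_lt_one (by positivity)]; linarith [Real.exp_pos b]
  filter_upwards [Ioc_mem_nhdsGT hpos] with θ hθ
  rw [← beta_logistic b]
  exact beta_anti hθ.1 hθ.2 hlt

/-- The exponent is continuous at the noiseless channel. -/
lemma eventually_le_eR (hR : 0 < R) (hR2 : R ≤ Real.log 2) (hT : 0 ≤ T) {ε : ℝ} (hε : 0 < ε) :
    ∀ᶠ θ in 𝓝[>] (0 : ℝ), Real.log 2 - R - ε ≤ eR R T θ := by
  obtain ⟨d0, d1, d2⟩ := deltaGV_spec hR hR2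
  have hl2 : 0 < Real.log 2 := Real.log_pos (by norm_num)
  -- a positive distance is too unlikely over an almost noiseless channel
  have big : ∀ η > 0, ∀ᶠ θ in 𝓝[>] (0 : ℝ), ∀ q, η ≤ q → q ≤ 1 →
      Real.log 2 ≤ div2 θ q := by
    intro η hη
    filter_upwards [tendsto_beta_zero.eventually_ge_atTop (2 * Real.log 2 / η),
      Ioo_mem_nhdsGT (by norm_num : (0 : ℝ) < 1 / 2)] with θ hβ hθ q hq hq1
    rw [div2, lik_eq hθ.1 (by linarith [hθ.2])]
    have h1 : Real.log (1 - θ) ≤ 0 := Real.log_nonpos (by linarith [hθ.2]) (by linarith [hθ.1])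
    have h2 := Real.binEntropy_le_log_two (p := q)
    rw [div_le_iff₀ hη] at hβ
    have h3 := mul_le_mul_of_nonneg_right hq (beta_pos hθ.1 hθ.2).le
    linarith
  -- below `2 η` the entropy is at most `ε`
  obtain ⟨η, hη, hη4, hηε⟩ : ∃ η > 0, η ≤ 1 / 4 ∧ Real.binEntropy (2 * η) ≤ ε := by
    have h1 := (Real.binEntropy_continuous.comp (continuous_const_mul (2 : ℝ))).tendsto 0
    simp only [Function.comp_apply, mul_zero, Real.binEntropy_zero] at h1
    have h2 := (h1.mono_left (nhdsWithin_le_nhds (s := Ioi 0))).eventually_lt_const hε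
    obtain ⟨η, h3, h4⟩ := (h2.and (Ioc_mem_nhdsGT (by norm_num : (0 : ℝ) < 1 / 4))).exists
    exact ⟨η, h4.1, h4.2, h3.le⟩
  rcases d0.eq_or_lt with hd | hd
  · have hRl : Real.log 2 - R = 0 := by rw [← d2, ← hd, Real.binEntropy_zero]
    filter_upwards [Ioo_mem_nhdsGT (by norm_num : (0 : ℝ) < 1)] with θ hθ
    have := (eR_mem hR hR2 hT ⟨hθ.1.le, hθ.2.le⟩).1
    linarith
  filter_upwards [big η hη, big (deltaGV R / 2) (by linarith),
    tendsto_beta_zero.eventually_ge_atTop (T / η),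
    tendsto_beta_zero.eventually_ge_atTop ((R + T + 1) / (deltaGV R / 2)),
    Ioo_mem_nhdsGT (by norm_num : (0 : ℝ) < 1 / 2)] with θ b1 b2 b3 b4 hθ
  have hb := beta_pos hθ.1 hθ.2
  have hθm : θ ∈ Icc (0 : ℝ) 1 := ⟨hθ.1.le, by linarith [hθ.2]⟩
  have hTb : 0 ≤ T / beta θ := by positivity
  have hTη : T / beta θ ≤ η := by
    rw [div_le_iff₀ hη] at b3
    rw [div_le_iff₀ hb]; linarith
  have hfin : ((Real.log 2 - R - ε : ℝ) : EReal) ≤ E1BSC R T θ := by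
    refine le_E1BSC hθ.1 hθ.2 (fun q hq hqd hq1 hq0 => ?_) fun q hq => ?_
    · unfold gap
      rcases le_total q η with h | h
      · have h2 := div2_nonneg hθ.1 (by linarith [hθ.2]) ⟨hθ.1.le.trans hq, hq1⟩
        have h3 := binEntropy_mono hq0 (by linarith : q + T / beta θ ≤ 2 * η) (by linarith)
        linarith
      · have h2 := b1 q h hq1
        have h3 := Real.binEntropy_le_log_two (p := q + T / beta θ)
        linarith
    · obtain ⟨p, hp, hg, hlt⟩ := exists_of_mem_Lhat hq one_pos
      have hpd := (le_of_gap_nonpos hR hR2 hp hg).1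
      have h2 := Real.binEntropy_le_log_two (p := p)
      have h3 : deltaGV R / 2 ≤ q := by
        rw [div_le_iff₀ (by linarith)] at b4
        unfold gap at hlt
        by_contra! hcon
        have h4 := mul_le_mul_of_nonneg_right hpd hb.le
        have h5 := mul_le_mul_of_nonneg_right hcon.le hb.le
        linarith
      have := b2 q h3 hq.1.2
      linarith
  rw [coe_eR hR hR2 hT hθm] at hfin
  exact_mod_cast hfin

end ExponentFacts

lemma lik_nonpos {θ q : ℝ} (h0 : 0 < θ) (h1 : θ < 1) (hq : q ∈ Icc (0 : ℝ) 1) : lik θ q ≤ 0 := by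
  have a := Real.log_nonpos h0.le h1.le
  have b := Real.log_nonpos (by linarith : 0 ≤ 1 - θ) (by linarith)
  unfold lik
  nlinarith [hq.1, hq.2]

lemma lik_le_neg_binEntropy {θ q : ℝ} (h0 : 0 < θ) (h1 : θ < 1) (hq : q ∈ Icc (0 : ℝ) 1) :
    lik θ q ≤ -Real.binEntropy q := by
  have := div2_nonneg h0 h1 hq
  unfold div2 at this
  linarith

/-- The weighted log-likelihood `ξ E₁(θ) + log (1 - θ) - q β(θ)`. -/
def met (R T ξ θ q : ℝ) : ℝ := ξ * eR R T θ + lik θ q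

/-- The metric of the minimax decoder at normalized distance `q`: the supremum of the weighted
log-likelihoods over the noisy channels. The endpoints `θ = 0, 1` contribute nothing beyond a
limit, see `maxMetric_eq`. -/
def metric (R T ξ q : ℝ) : ℝ := ⨆ θ : Ioo (0 : ℝ) 1, met R T ξ θ q

section Metric

variable {R T ξ : ℝ}

lemma bddAbove_met (hR : 0 < R) (hR2 : R ≤ Real.log 2) (hT : 0 ≤ T) (hξ : 0 ≤ ξ) {q : ℝ}
    (hq : q ∈ Icc (0 : ℝ) 1) :
    BddAbove (range fun θ : Ioo (0 : ℝ) 1 => met R T ξ θ q) := by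
  refine ⟨ξ * (Real.log 2 - R), ?_⟩
  rintro _ ⟨θ, rfl⟩
  have h1 := (eR_mem hR hR2 hT (θ := θ) ⟨θ.2.1.le, θ.2.2.le⟩).2
  have h2 := lik_nonpos θ.2.1 θ.2.2 hq
  have h3 := mul_le_mul_of_nonneg_left h1 hξ
  simp only [met]
  linarith

lemma met_le_metric (hR : 0 < R) (hR2 : R ≤ Real.log 2) (hT : 0 ≤ T) (hξ : 0 ≤ ξ) {q : ℝ}
    (hq : q ∈ Icc (0 : ℝ) 1) {θ : ℝ} (h0 : 0 < θ) (h1 : θ < 1) :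
    met R T ξ θ q ≤ metric R T ξ q :=
  le_ciSup (bddAbove_met hR hR2 hT hξ hq) (⟨θ, h0, h1⟩ : Ioo (0 : ℝ) 1)

instance instNonemptyIoo : Nonempty (Ioo (0 : ℝ) 1) := ⟨⟨1 / 2, by norm_num, by norm_num⟩⟩

lemma metric_le {q c : ℝ} (h : ∀ θ, 0 < θ → θ < 1 → met R T ξ θ q ≤ c) : metric R T ξ q ≤ c :=
  ciSup_le fun θ => h θ θ.2.1 θ.2.2

lemma exists_lt_met {q c : ℝ} (h : c < metric R T ξ q) :
    ∃ θ, 0 < θ ∧ θ < 1 ∧ c < met R T ξ θ q := by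
  obtain ⟨θ, hθ⟩ := exists_lt_of_lt_ciSup h
  exact ⟨θ, θ.2.1, θ.2.2, hθ⟩

lemma met_one_sub (θ q : ℝ) : met R T ξ (1 - θ) q = met R T ξ θ (1 - q) := by
  unfold met; rw [eR_one_sub, lik_one_sub]

lemma metric_one_sub (hR : 0 < R) (hR2 : R ≤ Real.log 2) (hT : 0 ≤ T) (hξ : 0 ≤ ξ) {q : ℝ}
    (hq : q ∈ Icc (0 : ℝ) 1) : metric R T ξ (1 - q) = metric R T ξ q := by
  have hq' : 1 - q ∈ Icc (0 : ℝ) 1 := ⟨by linarith [hq.2], by linarith [hq.1]⟩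
  refine le_antisymm (metric_le fun θ h0 h1 => ?_) (metric_le fun θ h0 h1 => ?_)
  · rw [← met_one_sub]
    exact met_le_metric hR hR2 hT hξ hq (by linarith) (by linarith)
  · have := met_one_sub (R := R) (T := T) (ξ := ξ) θ (1 - q)
    rw [sub_sub_cancel] at this
    rw [← this]
    exact met_le_metric hR hR2 hT hξ hq' (by linarith) (by linarith)

/-- Below `1/2` only the crossover probabilities up to `1/2` matter. -/
lemma exists_lt_met_le_half {q c : ℝ} (hq : q ≤ 1 / 2) (h : c < metric R T ξ q) :
    ∃ θ, 0 < θ ∧ θ ≤ 1 / 2 ∧ c < met R T ξ θ q := by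
  obtain ⟨θ, h0, h1, hlt⟩ := exists_lt_met h
  rcases le_total θ (1 / 2) with h2 | h2
  · exact ⟨θ, h0, h2, hlt⟩
  refine ⟨1 - θ, by linarith, by linarith, hlt.trans_le ?_⟩
  rw [met_one_sub, met, met, lik, lik]
  have := Real.log_le_log (by linarith : 0 < 1 - θ) (by linarith : 1 - θ ≤ θ)
  nlinarith

lemma metric_convex (hR : 0 < R) (hR2 : R ≤ Real.log 2) (hT : 0 ≤ T) (hξ : 0 ≤ ξ) {p q t : ℝ}
    (hp : p ∈ Icc (0 : ℝ) 1) (hq : q ∈ Icc (0 : ℝ) 1) (ht : t ∈ Icc (0 : ℝ) 1) :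
    metric R T ξ ((1 - t) * p + t * q) ≤ (1 - t) * metric R T ξ p + t * metric R T ξ q := by
  refine metric_le fun θ h0 h1 => ?_
  have e : met R T ξ θ ((1 - t) * p + t * q) =
      (1 - t) * met R T ξ θ p + t * met R T ξ θ q := by
    unfold met lik; ring
  rw [e]
  exact add_le_add
    (mul_le_mul_of_nonneg_left (met_le_metric hR hR2 hT hξ hp h0 h1) (by linarith [ht.2]))
    (mul_le_mul_of_nonneg_left (met_le_metric hR hR2 hT hξ hq h0 h1) ht.1)

lemma neg_binEntropy_le_metric (hR : 0 < R) (hR2 : R ≤ Real.log 2) (hT : 0 ≤ T) (hξ : 0 ≤ ξ)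
    {q : ℝ} (hq : 0 ≤ q) (hq1 : q ≤ 1 / 2) : -Real.binEntropy q ≤ metric R T ξ q := by
  have hqm : q ∈ Icc (0 : ℝ) 1 := ⟨hq, by linarith⟩
  have hmet : ∀ θ, 0 < θ → θ < 1 → lik θ q ≤ metric R T ξ q := fun θ h0 h1 => by
    refine le_trans ?_ (met_le_metric hR hR2 hT hξ hqm h0 h1)
    have := mul_nonneg hξ (eR_mem hR hR2 hT (θ := θ) ⟨h0.le, h1.le⟩).1
    unfold met; linarith
  rcases hq.eq_or_lt with rfl | h
  · rw [Real.binEntropy_zero, neg_zero]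
    refine le_of_forall_lt fun c hc => ?_
    have h2 : Real.exp (c / 2) < 1 := by rw [Real.exp_lt_one_iff]; linarith
    have := hmet (1 - Real.exp (c / 2)) (by linarith) (by linarith [Real.exp_pos (c / 2)])
    rw [lik, sub_sub_cancel, Real.log_exp] at this
    linarith
  · rw [← lik_self]
    exact hmet q h (by linarith)

lemma metric_strictAnti (hR : 0 < R) (hR2 : R ≤ Real.log 2) (hT : 0 ≤ T) (hξ : 0 ≤ ξ) {p q : ℝ}
    (hp : 0 ≤ p) (hpq : p < q) (hq : q ≤ 1 / 2) : metric R T ξ q < metric R T ξ p := by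
  obtain ⟨d0, d1, d2⟩ := deltaGV_spec hR hR2
  set θ₀ := max (deltaGV R) (1 / 4) with hθ₀
  have h00 : 0 < θ₀ := lt_max_of_lt_right (by norm_num)
  have h01 : θ₀ < 1 / 2 := max_lt d1 (by norm_num)
  have hb0 := beta_pos h00 h01
  have hpm : p ∈ Icc (0 : ℝ) 1 := ⟨hp, by linarith⟩
  have hqm : q ∈ Icc (0 : ℝ) 1 := ⟨by linarith, by linarith⟩
  set m := min (beta θ₀ * (q - p)) (Real.binEntropy q - Real.binEntropy p) with hm
  have hm0 : 0 < m :=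
    lt_min (mul_pos hb0 (by linarith)) (by linarith [binEntropy_strictMono hp hpq hq])
  obtain ⟨θ, h0, h1, hlt⟩ := exists_lt_met_le_half hq
    (show metric R T ξ q - m / 2 < metric R T ξ q by linarith)
  have : metric R T ξ q - m / 2 + m ≤ metric R T ξ p := by
    rcases le_total θ θ₀ with h | h
    · have h2 := met_le_metric hR hR2 hT hξ hpm h0 (by linarith : θ < 1)
      have h3 := mul_le_mul_of_nonneg_right (beta_anti h0 h (by linarith))
        (by linarith : 0 ≤ q - p)
      have h4 : m ≤ beta θ₀ * (q - p) := min_le_left _ _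
      have h5 : met R T ξ θ p = met R T ξ θ q + beta θ * (q - p) := by
        rw [met, met, lik_eq h0 (by linarith), lik_eq h0 (by linarith)]; ring
      linarith
    · have h2 : met R T ξ θ q = lik θ q := by
        rw [met, eR_eq_zero hR hR2 hT h0 ((le_max_left _ _).trans h) h1]; ring
      have h3 := lik_le_neg_binEntropy h0 (by linarith) hqm
      have h4 : m ≤ Real.binEntropy q - Real.binEntropy p := min_le_right _ _
      have h5 := neg_binEntropy_le_metric hR hR2 hT hξ hp (by linarith : p ≤ 1 / 2)
      linarith
  linarith

lemma metric_anti (hR : 0 < R) (hR2 : R ≤ Real.log 2) (hT : 0 ≤ T) (hξ : 0 ≤ ξ) {p q : ℝ}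
    (hp : 0 ≤ p) (hpq : p ≤ q) (hq : q ≤ 1 / 2) : metric R T ξ q ≤ metric R T ξ p := by
  rcases hpq.eq_or_lt with rfl | h
  · exact le_rfl
  · exact (metric_strictAnti hR hR2 hT hξ hp h hq).le

/-- The metric takes every value between its values at `q` and at `1/2`. -/
lemma exists_metric_eq (hR : 0 < R) (hR2 : R ≤ Real.log 2) (hT : 0 ≤ T) (hξ : 0 ≤ ξ) {q c : ℝ}
    (hq : 0 ≤ q) (hq2 : q ≤ 1 / 2) (hc : metric R T ξ (1 / 2) ≤ c) (hc' : c < metric R T ξ q) :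
    ∃ r, q ≤ r ∧ r ≤ 1 / 2 ∧ metric R T ξ r = c := by
  set s : Set ℝ := Icc q (1 / 2) ∩ ⋂ θ : Ioo (0 : ℝ) 1, {x | met R T ξ θ x ≤ c} with hs
  have hmem : ∀ x, x ∈ s ↔ x ∈ Icc q (1 / 2) ∧ metric R T ξ x ≤ c := by
    intro x
    simp only [hs, mem_inter_iff, mem_iInter, mem_ofPred_eq]
    refine and_congr_right fun hx => ⟨fun h => ciSup_le h, fun h θ => ?_⟩
    exact (met_le_metric hR hR2 hT hξ ⟨hq.trans hx.1, by linarith [hx.2]⟩ θ.2.1 θ.2.2).trans h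
  have hcomp : IsCompact s := by
    refine isCompact_Icc.inter_right (isClosed_iInter fun θ => ?_)
    refine isClosed_le ?_ continuous_const
    exact continuous_const.add (continuous_lik _)
  have hr : sInf s ∈ s := hcomp.sInf_mem ⟨1 / 2, (hmem _).2 ⟨⟨hq2, le_rfl⟩, hc⟩⟩
  set r := sInf s with hrdef
  obtain ⟨hrI, hrc⟩ := (hmem r).1 hr
  refine ⟨r, hrI.1, hrI.2, le_antisymm hrc ?_⟩
  by_contra! hlt
  have hqr : q < r := by
    refine lt_of_le_of_ne hrI.1 fun h => ?_
    rw [← h] at hrc; linarith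
  set t := (metric R T ξ q - c) / (metric R T ξ q - metric R T ξ r) with ht
  have hden : 0 < metric R T ξ q - metric R T ξ r := by linarith
  have ht0 : 0 < t := div_pos (by linarith) hden
  have ht1 : t < 1 := by rw [ht, div_lt_one hden]; linarith
  have hconv := metric_convex hR hR2 hT hξ (p := q) (q := r) (t := t) ⟨hq, by linarith⟩
    ⟨hq.trans hrI.1, by linarith [hrI.2]⟩ ⟨ht0.le, ht1.le⟩
  have e : (1 - t) * metric R T ξ q + t * metric R T ξ r = c := by
    have : t * (metric R T ξ q - metric R T ξ r) = metric R T ξ q - c :=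
      div_mul_cancel₀ _ hden.ne'
    linarith
  rw [e] at hconv
  have hx : (1 - t) * q + t * r ∈ s :=
    (hmem _).2 ⟨⟨by nlinarith, by nlinarith [hrI.2]⟩, hconv⟩
  have := csInf_le hcomp.bddBelow hx
  rw [← hrdef] at this
  nlinarith

lemma logLik_cases {q θ : ℝ} (hq : q ∈ Icc (0 : ℝ) 1) (hθ : θ ∈ Icc (0 : ℝ) 1) :
    logLik q θ = ⊥ ∨ ∃ r : ℝ, logLik q θ = (r : EReal) := by
  have zero : ∀ q ∈ Icc (0 : ℝ) 1, logLik q 0 = ⊥ ∨ ∃ r : ℝ, logLik q 0 = (r : EReal) := by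
    intro q hq
    rcases hq.1.eq_or_lt with rfl | h
    · right; exact ⟨0, logLik_zero_zero⟩
    · left; exact logLik_zero_right h
  rcases hθ.1.eq_or_lt with rfl | h0
  · exact zero q hq
  rcases hθ.2.eq_or_lt with rfl | h1
  · have := zero (1 - q) ⟨by linarith [hq.2], by linarith [hq.1]⟩
    rwa [← logLik_one_sub, sub_zero] at this
  · right; exact ⟨_, logLik_eq h0 h1 q⟩

/-- At `q = 0` the noiseless channel contributes `ξ E₁(R, T, 0)`, which is a limit of values of
noisy channels by `eventually_le_eR`; for all other `q` its likelihood vanishes. The case `θ = 1` is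
symmetric. -/
lemma maxMetric_eq (hR : 0 < R) (hR2 : R ≤ Real.log 2) (hT : 0 ≤ T) (hξ : 0 ≤ ξ) {q : ℝ}
    (hq : q ∈ Icc (0 : ℝ) 1) : maxMetric R T ξ q = (metric R T ξ q : EReal) := by
  have hcoe : ∀ θ, 0 < θ → θ < 1 →
      (ξ : EReal) * E1BSC R T θ + logLik q θ = (met R T ξ θ q : EReal) := by
    intro θ h0 h1
    rw [coe_eR hR hR2 hT ⟨h0.le, h1.le⟩, logLik_eq h0 h1, met]
    push_cast
    rfl
  have hzero : ∀ q ∈ Icc (0 : ℝ) 1,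
      (ξ : EReal) * E1BSC R T 0 + logLik q 0 ≤ (metric R T ξ q : EReal) := by
    intro q hq
    rcases hq.1.eq_or_lt with rfl | h
    · rw [logLik_zero_zero, E1BSC_zero hT, add_zero, ← EReal.coe_mul]
      refine EReal.coe_le_coe_iff.2 (le_of_forall_pos_le_add fun ε hε => ?_)
      have hε' : 0 < ε / (2 * (ξ + 1)) := by positivity
      have hlog : ∀ᶠ θ in 𝓝[>] (0 : ℝ), -(ε / 2) < Real.log (1 - θ) := by
        have h1 : ContinuousAt (fun θ : ℝ => Real.log (1 - θ)) 0 :=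
          (continuousAt_const.sub continuousAt_id).log (by simp)
        have h2 := (h1.tendsto.mono_left nhdsWithin_le_nhds :
          Tendsto _ (𝓝[>] (0 : ℝ)) _)
        rw [sub_zero, Real.log_one] at h2
        exact h2.eventually_const_lt (by linarith)
      obtain ⟨θ, h1, h2, h3⟩ := ((eventually_le_eR hR hR2 hT hε').and
        (hlog.and (Ioo_mem_nhdsGT (one_pos : (0 : ℝ) < 1)))).exists
      have h4 := met_le_metric hR hR2 hT hξ (q := 0) ⟨le_rfl, zero_le_one⟩ h3.1 h3.2
      have h5 := mul_le_mul_of_nonneg_left h1 hξ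
      have h6 : ξ * (ε / (2 * (ξ + 1))) ≤ ε / 2 := by
        rw [mul_div_assoc', div_le_div_iff₀ (by positivity) (by positivity)]
        nlinarith
      rw [met, lik] at h4
      nlinarith
    · rw [logLik_zero_right h, EReal.add_bot]
      exact bot_le
  refine le_antisymm (iSup₂_le fun θ hθ => ?_) ?_
  · rcases hθ.1.eq_or_lt with rfl | h0
    · exact hzero q hq
    rcases hθ.2.eq_or_lt with rfl | h1
    · have := hzero (1 - q) ⟨by linarith [hq.2], by linarith [hq.1]⟩
      rwa [← logLik_one_sub, metric_one_sub hR hR2 hT hξ hq, ← E1BSC_one_sub, sub_zero] at this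
    · rw [hcoe θ h0 h1]
      exact EReal.coe_le_coe_iff.2 (met_le_metric hR hR2 hT hξ hq h0 h1)
  · by_contra! hlt
    obtain ⟨x, hx1, hx2⟩ := EReal.lt_iff_exists_real_btwn.1 hlt
    obtain ⟨θ, h0, h1, h⟩ := exists_lt_met (EReal.coe_lt_coe_iff.1 hx2)
    have := le_iSup₂ (f := fun θ (_ : θ ∈ Icc (0 : ℝ) 1) =>
      (ξ : EReal) * E1BSC R T θ + logLik q θ) θ ⟨h0.le, h1.le⟩
    rw [hcoe θ h0 h1] at this
    exact absurd (hx1.trans (EReal.coe_lt_coe_iff.2 h)) (not_lt.2 this)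

end Metric

/-! ### The two conditions in terms of the metric -/

lemma iSup_sub_iInf_nonpos_iff {s t : Set ℝ} (a : ℝ → ℝ) (F : ℝ → ℝ → EReal) :
    (⨆ θ ∈ s, ((a θ : EReal) - ⨅ q ∈ t, F q θ)) ≤ 0 ↔
      ∀ θ ∈ s, ∀ q ∈ t, (a θ : EReal) ≤ F q θ := by
  have hle : ∀ (x : ℝ) (I : EReal), (x : EReal) - I ≤ 0 ↔ (x : EReal) ≤ I := by
    intro x I
    induction I with
    | bot => simp
    | top => simp
    | coe y => norm_cast; exact sub_nonpos
  simp only [iSup_le_iff, hle, le_iInf_iff]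

section Conditions

variable {R T ξ : ℝ}

/-- By definition of the divergence, quantifying over `θ` in a bound on `ξ E₁(θ) - D(q ‖ θ)` leaves
a bound on the metric at `q`. -/
lemma le_divB_add_iff (hR : 0 < R) (hR2 : R ≤ Real.log 2) (hT : 0 ≤ T) (hξ : 0 ≤ ξ) {q : ℝ}
    (hq : q ∈ Icc (0 : ℝ) 1) (c : ℝ) :
    (∀ θ ∈ Icc (0 : ℝ) 1, ((ξ * eR R T θ : ℝ) : EReal) ≤ divB q θ + (c : EReal)) ↔
      metric R T ξ q + Real.binEntropy q ≤ c := by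
  constructor
  · intro h
    have : metric R T ξ q ≤ c - Real.binEntropy q := by
      refine metric_le fun θ h0 h1 => ?_
      have h2 := h θ ⟨h0.le, h1.le⟩
      rw [divB_eq h0 h1, ← EReal.coe_add, EReal.coe_le_coe_iff, div2] at h2
      rw [met]; linarith
    linarith
  · intro h θ hθ
    have hm := le_iSup₂ (f := fun θ (_ : θ ∈ Icc (0 : ℝ) 1) =>
      (ξ : EReal) * E1BSC R T θ + logLik q θ) θ hθ
    change _ ≤ maxMetric R T ξ q at hm
    rw [maxMetric_eq hR hR2 hT hξ hq, coe_eR hR hR2 hT hθ, ← EReal.coe_mul] at hm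
    unfold divB
    rcases logLik_cases hq hθ with h2 | ⟨r, h2⟩
    · rw [h2]; simp
    · rw [h2] at hm ⊢
      have h3 : ξ * eR R T θ + r ≤ metric R T ξ q := by exact_mod_cast hm
      exact_mod_cast (by linarith : ξ * eR R T θ ≤ -Real.binEntropy q - r + c)

lemma cond1_iff (hR : 0 < R) (hR2 : R ≤ Real.log 2) (hT : 0 ≤ T) (hξ : 0 ≤ ξ) :
    Cond1 R T ξ ↔ ∀ q ∈ Icc (0 : ℝ) 1, metric R T ξ q + Real.binEntropy q ≤
      max 0 (-gFun (q1 R T ξ q) (q2 R T ξ q) + Real.log 2 - R) := by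
  have e : Cond1 R T ξ ↔ (⨆ θ ∈ Icc (0 : ℝ) 1, (((ξ * eR R T θ : ℝ) : EReal) -
    ⨅ q ∈ Icc (0 : ℝ) 1, (divB q θ +
      ((max 0 (-gFun (q1 R T ξ q) (q2 R T ξ q) + Real.log 2 - R) : ℝ) : EReal)))) ≤ 0 := by
    unfold Cond1
    refine iff_of_eq (congrArg (· ≤ (0 : EReal)) (biSup_congr fun θ hθ => ?_))
    rw [coe_eR hR hR2 hT hθ, ← EReal.coe_mul]
  rw [e, iSup_sub_iInf_nonpos_iff (fun θ => ξ * eR R T θ)]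
  refine ⟨fun h q hq => (le_divB_add_iff hR hR2 hT hξ hq _).1 fun θ hθ => h θ hθ q hq,
    fun h θ hθ q hq => (le_divB_add_iff hR hR2 hT hξ hq _).2 (h q hq) θ hθ⟩

lemma cond2_iff (hR : 0 < R) (hR2 : R ≤ Real.log 2) (hT : 0 ≤ T) (hξ : 0 ≤ ξ) :
    Cond2 R T ξ ↔ ∀ q ∈ LBSC R T ξ, metric R T ξ q + Real.binEntropy q ≤ 0 := by
  have e : Cond2 R T ξ ↔ (⨆ θ ∈ Icc (0 : ℝ) 1, (((ξ * eR R T θ : ℝ) : EReal) -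
      ⨅ q ∈ LBSC R T ξ, divB q θ)) ≤ 0 := by
    unfold Cond2
    refine iff_of_eq (congrArg (· ≤ (0 : EReal)) (biSup_congr fun θ hθ => ?_))
    rw [coe_eR hR hR2 hT hθ, ← EReal.coe_mul]
  rw [e, iSup_sub_iInf_nonpos_iff (fun θ => ξ * eR R T θ)]
  have hz : ∀ x : EReal, x = x + ((0 : ℝ) : EReal) := by simp
  constructor
  · intro h q hq
    refine (le_divB_add_iff hR hR2 hT hξ hq.1 0).1 fun θ hθ => ?_
    rw [← hz]; exact h θ hθ q hq
  · intro h θ hθ q hq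
    rw [hz (divB q θ)]
    exact (le_divB_add_iff hR hR2 hT hξ hq.1 0).2 (h q hq) θ hθ

/-- The real-valued version of `phi`. -/
def phiR (R T ξ q θ : ℝ) : ℝ :=
  (ξ * eR R T θ + Real.log (1 - θ) + T - metric R T ξ q) / beta θ

lemma phi_eq (hR : 0 < R) (hR2 : R ≤ Real.log 2) (hT : 0 ≤ T) (hξ : 0 ≤ ξ) {q θ : ℝ}
    (hq : q ∈ Icc (0 : ℝ) 1) (hθ : θ ∈ Icc (0 : ℝ) 1) :
    phi R T ξ q θ = (phiR R T ξ q θ : EReal) := by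
  unfold phi phiR
  rw [maxMetric_eq hR hR2 hT hξ hq, coe_eR hR hR2 hT hθ, EReal.coe_div, ← EReal.coe_mul,
    ← EReal.coe_add, ← EReal.coe_sub]
  congr 2; ring

lemma phiR_one_sub {q θ : ℝ} (h0 : 0 < θ) (h1 : θ < 1) (hb : beta θ ≠ 0) :
    phiR R T ξ q (1 - θ) = 1 - phiR R T ξ q θ := by
  unfold phiR
  rw [eR_one_sub, beta_one_sub h0 h1, sub_sub_cancel, eq_sub_iff_add_eq, div_neg,
    neg_add_eq_sub, ← sub_div, div_eq_one_iff_eq hb, beta_eq h0 h1]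
  ring

lemma lt_of_lt_phiR (hR : 0 < R) (hR2 : R ≤ Real.log 2) (hT : 0 ≤ T) (hξ : 0 ≤ ξ) {q x θ : ℝ}
    (hx : x ∈ Icc (0 : ℝ) 1) (h0 : 0 < θ) (h1 : θ < 1 / 2) (h : x < phiR R T ξ q θ) :
    metric R T ξ q < T + metric R T ξ x := by
  have hm := met_le_metric hR hR2 hT hξ hx h0 (by linarith : θ < 1)
  unfold phiR at h
  rw [lt_div_iff₀ (beta_pos h0 h1)] at h
  rw [met, lik_eq h0 (by linarith)] at hm
  linarith

lemma lt_of_lt_q1 (hR : 0 < R) (hR2 : R ≤ Real.log 2) (hT : 0 ≤ T) (hξ : 0 ≤ ξ) {q x : ℝ}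
    (hq : q ∈ Icc (0 : ℝ) 1) (hx : x ∈ Icc (0 : ℝ) 1) (h : (x : EReal) < q1 R T ξ q) :
    metric R T ξ q < T + metric R T ξ x := by
  unfold q1 at h
  obtain ⟨θ, h⟩ := lt_iSup_iff.1 h
  obtain ⟨hθ, h⟩ := lt_iSup_iff.1 h
  rw [phi_eq hR hR2 hT hξ hq ⟨hθ.1.le, by linarith [hθ.2]⟩, EReal.coe_lt_coe_iff] at h
  exact lt_of_lt_phiR hR hR2 hT hξ hx hθ.1 hθ.2 h

lemma lt_of_q2_lt (hR : 0 < R) (hR2 : R ≤ Real.log 2) (hT : 0 ≤ T) (hξ : 0 ≤ ξ) {q x : ℝ}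
    (hq : q ∈ Icc (0 : ℝ) 1) (hx : x ∈ Icc (0 : ℝ) 1) (h : q2 R T ξ q < (x : EReal)) :
    metric R T ξ q < T + metric R T ξ x := by
  unfold q2 at h
  obtain ⟨θ, h⟩ := iInf_lt_iff.1 h
  obtain ⟨hθ, h⟩ := iInf_lt_iff.1 h
  have h0 : 0 < 1 - θ := by linarith [hθ.2]
  have h1 : 1 - θ < 1 / 2 := by linarith [hθ.1]
  rw [phi_eq hR hR2 hT hξ hq ⟨by linarith [hθ.1], hθ.2.le⟩, EReal.coe_lt_coe_iff,
    ← sub_sub_cancel 1 θ, phiR_one_sub h0 (by linarith) (beta_pos h0 h1).ne'] at h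
  rw [← metric_one_sub hR hR2 hT hξ hx]
  exact lt_of_lt_phiR hR hR2 hT hξ ⟨by linarith [hx.2], by linarith [hx.1]⟩ h0 h1 (by linarith)

/-- As `θ → 0`, `β(θ) → ∞` while the numerator of `φ` stays bounded. -/
lemma exists_lt_phiR (hR : 0 < R) (hR2 : R ≤ Real.log 2) (hT : 0 ≤ T) (hξ : 0 ≤ ξ) (q : ℝ)
    {x : ℝ} (hx : x < 0) : ∃ θ, 0 < θ ∧ θ < 1 / 2 ∧ x < phiR R T ξ q θ := by
  set B := |Real.log 2 + metric R T ξ q| + 1 with hB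
  have hB0 : 0 < B := by positivity
  obtain ⟨θ, hβ, hθ⟩ := ((tendsto_beta_zero.eventually_gt_atTop (B / -x)).and
    (Ioo_mem_nhdsGT (by norm_num : (0 : ℝ) < 1 / 2))).exists
  refine ⟨θ, hθ.1, hθ.2, ?_⟩
  have he := mul_nonneg hξ (eR_mem hR hR2 hT (θ := θ) ⟨hθ.1.le, by linarith [hθ.2]⟩).1
  have hlog : -Real.log 2 ≤ Real.log (1 - θ) := by
    rw [← Real.log_inv]
    exact Real.log_le_log (by norm_num) (by linarith [hθ.2])
  unfold phiR
  rw [lt_div_iff₀ (beta_pos hθ.1 hθ.2)]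
  rw [div_lt_iff₀ (by linarith)] at hβ
  have := le_abs_self (Real.log 2 + metric R T ξ q)
  linarith

lemma q1_nonneg (hR : 0 < R) (hR2 : R ≤ Real.log 2) (hT : 0 ≤ T) (hξ : 0 ≤ ξ) {q : ℝ}
    (hq : q ∈ Icc (0 : ℝ) 1) : 0 ≤ q1 R T ξ q := by
  by_contra! h
  obtain ⟨x, hx1, hx2⟩ := EReal.lt_iff_exists_real_btwn.1 h
  obtain ⟨θ, h0, h1, hlt⟩ := exists_lt_phiR hR hR2 hT hξ q (by exact_mod_cast hx2)
  have := le_iSup₂ (f := fun θ (_ : θ ∈ Ioo (0 : ℝ) (1 / 2)) => phi R T ξ q θ) θ ⟨h0, h1⟩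
  rw [phi_eq hR hR2 hT hξ hq ⟨h0.le, by linarith⟩] at this
  exact absurd (hx1.trans (EReal.coe_lt_coe_iff.2 hlt)) (not_lt.2 this)

lemma q2_le_one (hR : 0 < R) (hR2 : R ≤ Real.log 2) (hT : 0 ≤ T) (hξ : 0 ≤ ξ) {q : ℝ}
    (hq : q ∈ Icc (0 : ℝ) 1) : q2 R T ξ q ≤ 1 := by
  by_contra! h
  obtain ⟨x, hx1, hx2⟩ := EReal.lt_iff_exists_real_btwn.1 h
  have hx1' : 1 < x := by exact_mod_cast hx1
  obtain ⟨θ, h0, h1, hlt⟩ := exists_lt_phiR hR hR2 hT hξ q (by linarith : 1 - x < 0)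
  have := iInf₂_le (f := fun θ (_ : θ ∈ Ioo (1 / 2 : ℝ) 1) => phi R T ξ q θ) (1 - θ)
    ⟨by linarith, by linarith⟩
  rw [phi_eq hR hR2 hT hξ hq ⟨by linarith, by linarith⟩,
    phiR_one_sub h0 (by linarith) (beta_pos h0 h1).ne'] at this
  have h3 := hx2.trans_le this
  have h4 : x < 1 - phiR R T ξ q θ := by exact_mod_cast h3
  linarith

/-- Either `g = log 2`, or `q₁*` and `q₂*` are probabilities on their sides of `1/2`. -/
lemma gFun_cases (hR : 0 < R) (hR2 : R ≤ Real.log 2) (hT : 0 ≤ T) (hξ : 0 ≤ ξ) {q : ℝ}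
    (hq : q ∈ Icc (0 : ℝ) 1) :
    ((((1 / 2 : ℝ) : EReal) < q1 R T ξ q ∨ q2 R T ξ q < ((1 / 2 : ℝ) : EReal)) ∧
      gFun (q1 R T ξ q) (q2 R T ξ q) = Real.log 2) ∨
    ∃ a b : ℝ, q1 R T ξ q = a ∧ q2 R T ξ q = b ∧ 0 ≤ a ∧ a ≤ 1 / 2 ∧ 1 / 2 ≤ b ∧ b ≤ 1 ∧
      gFun (q1 R T ξ q) (q2 R T ξ q) = max (Real.binEntropy a) (Real.binEntropy b) := by
  classical
  by_cases h : ((1 / 2 : ℝ) : EReal) < q1 R T ξ q ∨ q2 R T ξ q < ((1 / 2 : ℝ) : EReal)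
  · left
    refine ⟨h, ?_⟩
    unfold gFun
    rw [if_pos h]
  · right
    obtain ⟨h1, h2⟩ := not_or.1 h
    have h1 := not_lt.1 h1
    have h2 := not_lt.1 h2
    have h3 := q1_nonneg hR hR2 hT hξ hq
    have h4 := q2_le_one hR hR2 hT hξ hq
    have e1 : q1 R T ξ q = ((q1 R T ξ q).toReal : EReal) :=
      (EReal.coe_toReal (ne_top_of_le_ne_top (EReal.coe_ne_top _) h1)
        (ne_bot_of_le_ne_bot EReal.zero_ne_bot h3)).symm
    have e2 : q2 R T ξ q = ((q2 R T ξ q).toReal : EReal) :=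
      (EReal.coe_toReal (ne_top_of_le_ne_top (EReal.coe_ne_top 1) h4)
        (ne_bot_of_le_ne_bot (EReal.coe_ne_bot _) h2)).symm
    refine ⟨_, _, e1, e2, ?_, ?_, ?_, ?_, ?_⟩
    · rw [e1] at h3; exact_mod_cast h3
    · rw [e1] at h1; exact EReal.coe_le_coe_iff.1 h1
    · rw [e2] at h2; exact EReal.coe_le_coe_iff.1 h2
    · rw [e2] at h4; exact_mod_cast h4
    · unfold gFun
      rw [if_neg h]

/-- `g` bounds the entropy of every distance whose metric, scaled by the threshold, reaches that
at `q`. -/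
lemma binEntropy_le_gFun (hR : 0 < R) (hR2 : R ≤ Real.log 2) (hT : 0 ≤ T) (hξ : 0 ≤ ξ) {q q' : ℝ}
    (hq : q ∈ Icc (0 : ℝ) 1) (h0 : 0 ≤ q') (h1 : q' ≤ 1 / 2)
    (h : metric R T ξ q ≤ T + metric R T ξ q') :
    Real.binEntropy q' ≤ gFun (q1 R T ξ q) (q2 R T ξ q) := by
  rcases gFun_cases hR hR2 hT hξ hq with ⟨_, hg⟩ | ⟨a, b, ha, hb, ha0, ha1, hb0, hb1, hg⟩
  · rw [hg]; exact Real.binEntropy_le_log_two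
  rw [hg]
  refine le_max_of_le_left (binEntropy_mono h0 ?_ ha1)
  by_contra! hlt
  set x := (a + q') / 2 with hx
  have hxm : x ∈ Icc (0 : ℝ) 1 := ⟨by linarith, by linarith⟩
  have hall : ∀ θ, 0 < θ → θ < 1 / 2 → met R T ξ θ x ≤ metric R T ξ q - T := by
    intro θ h0 h1
    have hphi := le_iSup₂ (f := fun θ (_ : θ ∈ Ioo (0 : ℝ) (1 / 2)) => phi R T ξ q θ) θ ⟨h0, h1⟩
    change _ ≤ q1 R T ξ q at hphi
    rw [phi_eq hR hR2 hT hξ hq ⟨h0.le, by linarith⟩, ha, EReal.coe_le_coe_iff, phiR,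
      div_le_iff₀ (beta_pos h0 h1)] at hphi
    rw [met, lik_eq h0 (by linarith)]
    have := mul_le_mul_of_nonneg_right (by linarith : a ≤ x) (beta_pos h0 h1).le
    linarith
  -- the useless channel is a limit of noisy channels with vanishing exponent
  have hhalf : met R T ξ (1 / 2) x ≤ metric R T ξ q - T := by
    have hcont : ContinuousAt (fun θ => lik θ x) (1 / 2) := by
      unfold lik
      refine (continuousAt_const.mul (continuousAt_id.log (by norm_num))).add
        (continuousAt_const.mul ((continuousAt_const.sub continuousAt_id).log (by norm_num)))
    have e : met R T ξ (1 / 2) x = lik (1 / 2) x := by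
      rw [met, eR_eq_zero hR hR2 hT (by norm_num) (deltaGV_spec hR hR2).2.1.le le_rfl]; ring
    rw [e]
    refine le_of_tendsto (hcont.tendsto.mono_left (nhdsWithin_le_nhds (s := Iio (1 / 2)))) ?_
    filter_upwards [Ioo_mem_nhdsLT (by norm_num : (0 : ℝ) < 1 / 2)] with θ hθ
    refine le_trans ?_ (hall θ hθ.1 hθ.2)
    have := mul_nonneg hξ (eR_mem hR hR2 hT (θ := θ) ⟨hθ.1.le, by linarith [hθ.2]⟩).1
    unfold met; linarith
  have hle : metric R T ξ x ≤ metric R T ξ q - T := by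
    by_contra! hcon
    obtain ⟨θ, h2, h3, h4⟩ := exists_lt_met_le_half (by linarith : x ≤ 1 / 2) hcon
    rcases h3.eq_or_lt with rfl | h3
    · linarith
    · linarith [hall θ h2 h3]
  have := metric_strictAnti hR hR2 hT hξ (by linarith : 0 ≤ x) (by linarith : x < q') h1
  linarith

/-- `g` is approached by the entropies of distances whose scaled metric reaches that at `q`. -/
lemma le_max_gFun (hR : 0 < R) (hR2 : R ≤ Real.log 2) (hT : 0 ≤ T) (hξ : 0 ≤ ξ) {q w : ℝ}
    (hq : q ∈ Icc (0 : ℝ) 1)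
    (h : ∀ x ∈ Icc (0 : ℝ) 1, metric R T ξ q ≤ T + metric R T ξ x → w ≤ max 0 (gap R x)) :
    w ≤ max 0 (-gFun (q1 R T ξ q) (q2 R T ξ q) + Real.log 2 - R) := by
  rcases gFun_cases hR hR2 hT hξ hq with ⟨hc, hg⟩ | ⟨a, b, ha, hb, ha0, ha1, hb0, hb1, hg⟩
  · have hm : metric R T ξ q < T + metric R T ξ (1 / 2) := by
      rcases hc with hc | hc
      · exact lt_of_lt_q1 hR hR2 hT hξ hq ⟨by norm_num, by norm_num⟩ hc
      · exact lt_of_q2_lt hR hR2 hT hξ hq ⟨by norm_num, by norm_num⟩ hc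
    have := h (1 / 2) ⟨by norm_num, by norm_num⟩ hm.le
    rw [gap, binEntropy_half] at this
    rw [hg]
    refine this.trans (le_of_eq ?_)
    congr 1; ring
  · have hzero : w ≤ max 0 (gap R 0) := by
      refine (h q hq (by linarith)).trans (max_le_max le_rfl ?_)
      have := Real.binEntropy_nonneg hq.1 hq.2
      unfold gap; rw [Real.binEntropy_zero]; linarith
    have left : ∀ r, 0 ≤ r → (∀ x, 0 ≤ x → x < r → w ≤ max 0 (gap R x)) →
        w ≤ max 0 (gap R r) := by
      intro r hr hx
      rcases hr.eq_or_lt with rfl | hr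
      · exact hzero
      have hc : Continuous fun x => max 0 (gap R x) := continuous_const.max (continuous_gap R)
      refine ge_of_tendsto ((hc.tendsto r).mono_left (nhdsWithin_le_nhds (s := Iio r))) ?_
      filter_upwards [Ioo_mem_nhdsLT hr] with x hxr
      exact hx x hxr.1.le hxr.2
    have hwa : w ≤ max 0 (gap R a) := left a ha0 fun x hx0 hxa => by
      have hxm : x ∈ Icc (0 : ℝ) 1 := ⟨hx0, by linarith⟩
      exact h x hxm (lt_of_lt_q1 hR hR2 hT hξ hq hxm
        (by rw [ha]; exact EReal.coe_lt_coe_iff.2 hxa)).le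
    have hwb : w ≤ max 0 (gap R b) := by
      rw [← gap_one_sub]
      refine left (1 - b) (by linarith) fun x hx0 hxb => ?_
      have hxm : 1 - x ∈ Icc (0 : ℝ) 1 := ⟨by linarith, by linarith⟩
      rw [← gap_one_sub]
      exact h (1 - x) hxm (lt_of_q2_lt hR hR2 hT hξ hq hxm
        (by rw [hb]; exact EReal.coe_lt_coe_iff.2 (by linarith))).le
    rw [hg]
    unfold gap at hwa hwb
    rcases max_cases (Real.binEntropy a) (Real.binEntropy b) with h' | h'
    · rw [h'.1]; refine hwa.trans (le_of_eq ?_); congr 1; ring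
    · rw [h'.1]; refine hwb.trans (le_of_eq ?_); congr 1; ring

lemma clampGV_mem (hR : 0 < R) (hR2 : R ≤ Real.log 2) (θ : ℝ) :
    deltaGV R ≤ clampGV R θ ∧ clampGV R θ ≤ 1 - deltaGV R := by
  obtain ⟨d0, d1, d2⟩ := deltaGV_spec hR hR2
  exact ⟨le_min (le_max_right _ _) (by linarith), min_le_right _ _⟩

/-- Inside `[δ, 1 - δ]` the divergence from `θ` is least at the point nearest to `θ`. -/
lemma div2_clampGV_le (hR : 0 < R) (hR2 : R ≤ Real.log 2) {θ q : ℝ} (h0 : 0 < θ) (h1 : θ < 1)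
    (hq1 : deltaGV R ≤ q) (hq2 : q ≤ 1 - deltaGV R) : div2 θ (clampGV R θ) ≤ div2 θ q := by
  obtain ⟨d0, d1, d2⟩ := deltaGV_spec hR hR2
  refine div2_le_of_mem_uIcc h0 h1 ⟨by linarith, by linarith⟩ ?_
  unfold clampGV
  rw [mem_uIcc]
  rcases le_total θ (deltaGV R) with h | h
  · left
    rw [max_eq_right h, min_eq_left (by linarith)]
    exact ⟨h, hq1⟩
  · rw [max_eq_left h]
    rcases le_total θ (1 - deltaGV R) with h' | h'
    · rw [min_eq_left h']
      rcases le_total θ q with h2 | h2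
      · left; exact ⟨le_rfl, h2⟩
      · right; exact ⟨h2, le_rfl⟩
    · rw [min_eq_right h']
      right; exact ⟨hq2, h'⟩

/-- If a plentiful distance `q'` makes the competitors reach the metric at `q`, then `q` lies in
`𝓛`: for each `θ` the point of `[δ, 1 - δ]` nearest to `θ` does at least as well as `q'`. -/
lemma mem_LBSC_of_le (hR : 0 < R) (hR2 : R ≤ Real.log 2) (hT : 0 ≤ T) (hξ : 0 ≤ ξ) {q q' : ℝ}
    (hq : q ∈ Icc (0 : ℝ) 1) (hq' : q' ∈ Icc (0 : ℝ) 1) (hg : gap R q' ≤ 0)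
    (h : metric R T ξ q ≤ T + metric R T ξ q' - gap R q') : q ∈ LBSC R T ξ := by
  refine ⟨hq, ?_⟩
  set V := ⨆ θ ∈ Icc (0 : ℝ) 1, ((ξ : EReal) * E1BSC R T θ + logLik (clampGV R θ) θ +
      ((Real.binEntropy (clampGV R θ) - Real.log 2 : ℝ) : EReal)) with hV
  have hle : ((metric R T ξ q' - gap R q' - R : ℝ) : EReal) ≤ V := by
    by_contra! hlt
    obtain ⟨x, hx1, hx2⟩ := EReal.lt_iff_exists_real_btwn.1 hlt
    have hx2' := EReal.coe_lt_coe_iff.1 hx2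
    obtain ⟨θ, h0, h1, hlt⟩ := exists_lt_met (R := R) (T := T) (ξ := ξ) (q := q')
      (show x + gap R q' + R < _ by linarith)
    obtain ⟨g1, g2⟩ := le_of_gap_nonpos hR hR2 hq' hg
    have hd := div2_clampGV_le hR hR2 h0 h1 g1 g2
    have hterm := le_iSup₂ (f := fun θ (_ : θ ∈ Icc (0 : ℝ) 1) =>
      (ξ : EReal) * E1BSC R T θ + logLik (clampGV R θ) θ +
      ((Real.binEntropy (clampGV R θ) - Real.log 2 : ℝ) : EReal)) θ ⟨h0.le, h1.le⟩
    rw [← hV, coe_eR hR hR2 hT ⟨h0.le, h1.le⟩, logLik_eq h0 h1, ← EReal.coe_mul, ← EReal.coe_add,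
      ← EReal.coe_add] at hterm
    refine absurd (hx1.trans_le ?_) (not_lt.2 hterm)
    refine EReal.coe_le_coe_iff.2 ?_
    unfold div2 at hd
    unfold met at hlt
    unfold gap at hlt
    linarith
  rw [maxMetric_eq hR hR2 hT hξ hq]
  refine le_trans ?_ (add_le_add_right hle _)
  exact_mod_cast (by linarith :
    metric R T ξ q ≤ (R + T) + (metric R T ξ q' - gap R q' - R))

/-- Conversely, on `𝓛` the metric is bounded by what the plentiful distances achieve. -/
lemma le_of_mem_LBSC (hR : 0 < R) (hR2 : R ≤ Real.log 2) (hT : 0 ≤ T) (hξ : 0 ≤ ξ) {q y : ℝ}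
    (hq : q ∈ LBSC R T ξ)
    (h : ∀ q' ∈ Icc (0 : ℝ) 1, gap R q' ≤ 0 → T + metric R T ξ q' - gap R q' ≤ y) :
    metric R T ξ q ≤ y := by
  obtain ⟨d0, d1, d2⟩ := deltaGV_spec hR hR2
  have hV : (⨆ θ ∈ Icc (0 : ℝ) 1, ((ξ : EReal) * E1BSC R T θ + logLik (clampGV R θ) θ +
      ((Real.binEntropy (clampGV R θ) - Real.log 2 : ℝ) : EReal))) ≤
      ((y - R - T : ℝ) : EReal) := by
    refine iSup₂_le fun θ hθ => ?_
    obtain ⟨c1, c2⟩ := clampGV_mem hR hR2 θ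
    have hc : clampGV R θ ∈ Icc (0 : ℝ) 1 := ⟨by linarith, by linarith⟩
    have h1 := h _ hc (gap_nonpos hR hR2 c1 c2)
    have hm := le_iSup₂ (f := fun θ' (_ : θ' ∈ Icc (0 : ℝ) 1) =>
      (ξ : EReal) * E1BSC R T θ' + logLik (clampGV R θ) θ') θ hθ
    change _ ≤ maxMetric R T ξ (clampGV R θ) at hm
    rw [maxMetric_eq hR hR2 hT hξ hc] at hm
    refine (add_le_add_left hm _).trans ?_
    unfold gap at h1
    exact_mod_cast (by linarith : metric R T ξ (clampGV R θ) +
      (Real.binEntropy (clampGV R θ) - Real.log 2) ≤ y - R - T)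
  have h2 := hq.2.trans (add_le_add_right hV _)
  rw [maxMetric_eq hR hR2 hT hξ hq.1, ← EReal.coe_add, EReal.coe_le_coe_iff] at h2
  linarith

/-- The two conditions say that no pair of joint types contributes an exponentially growing term:
the first one accounts for competitors that are exponentially rare, the second one for those that
are plentiful. -/
theorem cond_iff_pairExp (hR : 0 < R) (hR2 : R ≤ Real.log 2) (hT : 0 ≤ T) (hξ : 0 ≤ ξ) :
    (Cond1 R T ξ ∧ Cond2 R T ξ) ↔ ∀ q ∈ Icc (0 : ℝ) 1, ∀ q' ∈ Icc (0 : ℝ) 1,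
      pairExp R T (metric R T ξ q) (metric R T ξ q') q q' ≤ 0 := by
  rw [cond1_iff hR hR2 hT hξ, cond2_iff hR hR2 hT hξ]
  constructor
  · rintro ⟨hc1, hc2⟩
    have key : ∀ q q', 0 ≤ q → q ≤ 1 / 2 → 0 ≤ q' → q' ≤ 1 / 2 →
        pairExp R T (metric R T ξ q) (metric R T ξ q') q q' ≤ 0 := by
      intro q q' hq0 hq1 hq0' hq1'
      have hhalf := metric_anti hR hR2 hT hξ hq0' hq1' le_rfl
      -- increase `q` until the two terms of the minimum are balanced
      have move : ∀ c, metric R T ξ (1 / 2) ≤ c → ∃ r, 0 ≤ r ∧ r ≤ 1 / 2 ∧ metric R T ξ r ≤ c ∧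
          Real.binEntropy q + min c (metric R T ξ q) ≤ Real.binEntropy r + metric R T ξ r := by
        intro c hc
        rcases le_or_gt (metric R T ξ q) c with h | h
        · exact ⟨q, hq0, hq1, h, by rw [min_eq_right h]⟩
        · obtain ⟨r, h1, h2, h3⟩ := exists_metric_eq hR hR2 hT hξ hq0 hq1 hc h
          refine ⟨r, hq0.trans h1, h2, h3.le, ?_⟩
          rw [min_eq_left h.le, h3]
          linarith [binEntropy_mono hq0 h1 h2]
      rcases le_or_gt (gap R q') 0 with hg | hg
      · obtain ⟨r, hr0, hr1, hrc, hr⟩ := move (T + metric R T ξ q' - gap R q') (by linarith)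
        have hrm : r ∈ Icc (0 : ℝ) 1 := ⟨hr0, by linarith⟩
        have := hc2 r (mem_LBSC_of_le hR hR2 hT hξ hrm ⟨hq0', by linarith⟩ hg hrc)
        rw [pairExp, max_eq_left hg, sub_zero]
        linarith
      · obtain ⟨r, hr0, hr1, hrc, hr⟩ := move (T + metric R T ξ q') (by linarith)
        have hrm : r ∈ Icc (0 : ℝ) 1 := ⟨hr0, by linarith⟩
        have h1 := hc1 r hrm
        have h2 := binEntropy_le_gFun hR hR2 hT hξ hrm hq0' hq1' hrc
        have h3 : max 0 (-gFun (q1 R T ξ r) (q2 R T ξ r) + Real.log 2 - R) ≤ gap R q' :=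
          max_le hg.le (by unfold gap; linarith)
        rw [pairExp, max_eq_right hg.le, min_sub_sub_right]
        linarith
    have fold : ∀ q ∈ Icc (0 : ℝ) 1, ∃ r, 0 ≤ r ∧ r ≤ 1 / 2 ∧ metric R T ξ q = metric R T ξ r ∧
        Real.binEntropy q = Real.binEntropy r := by
      intro q hq
      rcases le_total q (1 / 2) with h | h
      · exact ⟨q, hq.1, h, rfl, rfl⟩
      · exact ⟨1 - q, by linarith [hq.2], by linarith, (metric_one_sub hR hR2 hT hξ hq).symm,
          (Real.binEntropy_one_sub q).symm⟩
    intro q hq q' hq'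
    obtain ⟨r, r0, r1, rm, re⟩ := fold q hq
    obtain ⟨r', r0', r1', rm', re'⟩ := fold q' hq'
    have := key r r' r0 r1 r0' r1'
    unfold pairExp gap at this ⊢
    rwa [rm, rm', re, re']
  · intro h
    constructor
    · intro q hq
      refine le_max_gFun hR hR2 hT hξ hq fun x hx hle => ?_
      have h1 := h q hq x hx
      have h2 : metric R T ξ q - max 0 (gap R x) ≤
          min (T + metric R T ξ x - gap R x) (metric R T ξ q - max 0 (gap R x)) :=
        le_min (by linarith [le_max_right 0 (gap R x)]) le_rfl
      rw [pairExp] at h1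
      linarith
    · intro q hq
      by_contra! hpos
      have := le_of_mem_LBSC hR hR2 hT hξ (y := -Real.binEntropy q) hq fun q' hq' hg => by
        have h1 := h q hq.1 q' hq'
        rw [pairExp, max_eq_left hg, sub_zero] at h1
        rcases min_cases (T + metric R T ξ q' - gap R q') (metric R T ξ q) with h2 | h2 <;>
          linarith
      linarith

end Conditions

/-! ### The minimax criterion in the erasure mode -/

/-- The normalized Lagrangian as a sum over the output words, each of which contributes the scaled
likelihood of the competitors if it is decided and that of the sent codeword if it is not. -/
lemma Gam_mul_exp (T θ s : ℝ) {M n : ℕ} (C : Codebook M n) (D : Regions M n) :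
    Gam T θ C D * Real.exp (n * (s + T)) = 1 / (M : ℝ) * ∑ m, ∑ y : Word n,
      if y ∈ D m then Real.exp (n * T) * ∑ m' ∈ Finset.univ.erase m,
        (Real.exp (n * s) * chan θ (C m').1 y) else Real.exp (n * s) * chan θ (C m).1 y := by
  have e1 : Real.exp (n * (s + T)) = Real.exp (n * T) * Real.exp (n * s) := by
    rw [← Real.exp_add]; congr 1; ring
  have e2 : Real.exp (-(n * T)) * Real.exp (n * T) = 1 := by
    rw [← Real.exp_add]; simp
  have hsplit : ∀ m : Fin M, (∑ y : Word n,
      if y ∈ D m then Real.exp (n * T) * ∑ m' ∈ Finset.univ.erase m,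
        (Real.exp (n * s) * chan θ (C m').1 y) else Real.exp (n * s) * chan θ (C m).1 y) =
      Real.exp (n * T) * Real.exp (n * s) *
        (∑ y ∈ D m, ∑ m' ∈ Finset.univ.erase m, chan θ (C m').1 y) +
      Real.exp (n * s) * ∑ y ∈ (D m)ᶜ, chan θ (C m).1 y := by
    intro m
    rw [← Finset.sum_add_sum_compl (D m)]
    congr 1
    · rw [Finset.mul_sum]
      refine Finset.sum_congr rfl fun y hy => ?_
      rw [if_pos hy, ← Finset.mul_sum, mul_assoc]
    · rw [Finset.mul_sum]
      exact Finset.sum_congr rfl fun y hy => if_neg (Finset.mem_compl.1 hy)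
  simp_rw [hsplit]
  rw [Finset.sum_add_distrib, ← Finset.mul_sum, ← Finset.mul_sum, Gam, prE1, prE2, e1]
  linear_combination (Real.exp (n * s) * (1 / (M : ℝ) *
    ∑ m, ∑ y ∈ (D m)ᶜ, chan θ (C m).1 y)) * e2

lemma chan_nonneg {θ : ℝ} (hθ : θ ∈ Icc (0 : ℝ) 1) {n : ℕ} (x y : Word n) : 0 ≤ chan θ x y := by
  rw [chan_eq]; exact chanWeight_nonneg hθ n _

lemma ofReal_div_exp {a : ℝ} (n : ℕ) (s T : ℝ) :
    ENNReal.ofReal a / EReal.exp (-((n : EReal) * ((s : EReal) + (T : EReal)))) =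
      ENNReal.ofReal (a * Real.exp (n * (s + T))) := by
  have : -((n : EReal) * ((s : EReal) + (T : EReal))) = ((-(n * (s + T)) : ℝ) : EReal) := by
    rw [EReal.coe_neg, EReal.coe_mul, EReal.coe_add]; rfl
  rw [this, EReal.exp_coe, ← ENNReal.ofReal_div_of_pos (Real.exp_pos _), Real.exp_neg,
    div_inv_eq_mul]

lemma codeSum_min_nonneg (T : ℝ) {u : ℕ → ℝ} (hu : ∀ d, 0 ≤ u d) {M n : ℕ} (C : Codebook M n) :
    0 ≤ codeSum min T u C :=
  mul_nonneg (by positivity) (Finset.sum_nonneg fun m _ => Finset.sum_nonneg fun y _ =>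
    le_min (mul_nonneg (Real.exp_pos _).le (Finset.sum_nonneg fun _ _ => hu _)) (hu _))

lemma sum_ofReal_div_card {Ω : Type} [Fintype Ω] [Nonempty Ω] {f : Ω → ℝ} (hf : ∀ x, 0 ≤ f x) :
    (∑ x, ENNReal.ofReal (f x)) / (Fintype.card Ω : ℝ≥0∞) = ENNReal.ofReal (𝔼 x, f x) := by
  rw [← ENNReal.ofReal_sum_of_nonneg fun x _ => hf x, ← ENNReal.ofReal_natCast,
    ← ENNReal.ofReal_div_of_pos (by exact_mod_cast Fintype.card_pos),
    Fintype.expect_eq_sum_div_card]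

section Erasure

variable {R T ξ : ℝ}

/-- The weight `e^{n U(d/n)}` of the optimal metric at Hamming distance `d`. -/
def metricWeight (R T ξ : ℝ) (n d : ℕ) : ℝ := Real.exp (n * metric R T ξ ((d : ℝ) / n))

lemma metricWeight_nonneg (n d : ℕ) : 0 ≤ metricWeight R T ξ n d := (Real.exp_pos _).le

/-- The metric dominates the normalized likelihood of every channel, the noiseless ones included. -/
lemma exp_mul_chan_le (hR : 0 < R) (hR2 : R ≤ Real.log 2) (hT : 0 ≤ T) (hξ : 0 ≤ ξ) {n : ℕ}
    (hn : 0 < n) {θ : ℝ} (hθ : θ ∈ Icc (0 : ℝ) 1) (x y : Word n) :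
    Real.exp (n * (ξ * eR R T θ)) * chan θ x y ≤ metricWeight R T ξ n (hammingDist x y) := by
  have hn' : (n : ℝ) ≠ 0 := by positivity
  have hfrac : ∀ d ≤ n, (d : ℝ) / n ∈ Icc (0 : ℝ) 1 := fun d hd =>
    ⟨by positivity, div_le_one_of_le₀ (by exact_mod_cast hd) (Nat.cast_nonneg _)⟩
  have hz : ∀ d ≤ n, Real.exp (n * (ξ * eR R T 0)) * chanWeight 0 n d ≤
      metricWeight R T ξ n d := by
    intro d hd
    rw [chanWeight_zero]
    split_ifs with h
    · have hm := le_iSup₂ (f := fun θ (_ : θ ∈ Icc (0 : ℝ) 1) =>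
        (ξ : EReal) * E1BSC R T θ + logLik 0 θ) 0 ⟨le_rfl, zero_le_one⟩
      change _ ≤ maxMetric R T ξ 0 at hm
      rw [maxMetric_eq hR hR2 hT hξ ⟨le_rfl, zero_le_one⟩, logLik_zero_zero, add_zero,
        coe_eR hR hR2 hT ⟨le_rfl, zero_le_one⟩, ← EReal.coe_mul, EReal.coe_le_coe_iff] at hm
      subst h
      rw [metricWeight, mul_one, Nat.cast_zero, zero_div]
      gcongr
    · rw [mul_zero]; exact metricWeight_nonneg _ _
  have hd := hammingDist_le x y
  rw [chan_eq]
  change _ * chanWeight θ n (hammingDist x y) ≤ _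
  rcases hθ.1.eq_or_lt with rfl | h0
  · exact hz _ hd
  rcases hθ.2.eq_or_lt with rfl | h1
  · have h2 := hz (n - hammingDist x y) (Nat.sub_le _ _)
    have e1 : chanWeight 1 n (hammingDist x y) = chanWeight 0 n (n - hammingDist x y) := by
      unfold chanWeight
      rw [Nat.sub_sub_self hd]
      simp
    have e2 : metricWeight R T ξ n (n - hammingDist x y) =
        metricWeight R T ξ n (hammingDist x y) := by
      unfold metricWeight
      rw [Nat.cast_sub hd, sub_div, div_self hn', metric_one_sub hR hR2 hT hξ (hfrac _ hd)]
    rw [e1, ← e2, ← eR_one_sub, sub_self]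
    exact h2
  · rw [chanWeight_eq_exp h0 h1 hn hd, ← Real.exp_add, ← mul_add, metricWeight]
    have := met_le_metric hR hR2 hT hξ (hfrac _ hd) h0 h1
    unfold met at this
    gcongr

lemma KnD_eq (hR : 0 < R) (hR2 : R ≤ Real.log 2) (hT : 0 ≤ T) {M n : ℕ}
    (C : Codebook M n) (D : Regions M n) :
    KnD R T ξ C D = ⨆ θ ∈ Icc (0 : ℝ) 1,
      ENNReal.ofReal (Gam T θ C D * Real.exp (n * (ξ * eR R T θ + T))) := by
  unfold KnD
  refine biSup_congr fun θ hθ => ?_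
  rw [expE1_eq hR hR2 hT hθ, coe_eR hR hR2 hT hθ, ← EReal.coe_mul, ofReal_div_exp]

/-- The decoder that compares the optimal metrics is optimal up to a polynomial factor. -/
lemma Kn_le (hR : 0 < R) (hR2 : R ≤ Real.log 2) (hT : 0 ≤ T) (hξ : 0 ≤ ξ) {M n : ℕ} (hn : 0 < n)
    (C : Codebook M n) :
    Kn R T ξ C ≤ ENNReal.ofReal (codeSum min T (metricWeight R T ξ n) C) := by
  classical
  set u := metricWeight R T ξ n with hu
  have hu0 : ∀ d, 0 ≤ u d := metricWeight_nonneg n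
  set D : Regions M n := fun m => Finset.univ.filter fun y =>
    Real.exp (n * T) * ∑ m' ∈ Finset.univ.erase m, u (hammingDist (C m').1 y) <
      u (hammingDist (C m).1 y) with hD
  have hexp : 1 ≤ Real.exp (n * T) := Real.one_le_exp (by positivity)
  have hdec : IsDecoder T D := by
    intro _ m m' hmm
    rw [Finset.disjoint_left]
    intro y hy hy'
    simp only [hD, Finset.mem_filter, Finset.mem_univ, true_and] at hy hy'
    have h1 : u (hammingDist (C m').1 y) ≤
        ∑ m' ∈ Finset.univ.erase m, u (hammingDist (C m').1 y) :=
      Finset.single_le_sum (f := fun i => u (hammingDist (C i).1 y)) (fun i _ => hu0 _)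
        (Finset.mem_erase.2 ⟨hmm.symm, Finset.mem_univ _⟩)
    have h2 : u (hammingDist (C m).1 y) ≤
        ∑ m ∈ Finset.univ.erase m', u (hammingDist (C m).1 y) :=
      Finset.single_le_sum (f := fun i => u (hammingDist (C i).1 y)) (fun i _ => hu0 _)
        (Finset.mem_erase.2 ⟨hmm, Finset.mem_univ _⟩)
    have h3 := le_mul_of_one_le_left (Finset.sum_nonneg fun i (_ : i ∈ Finset.univ.erase m) =>
      hu0 (hammingDist (C i).1 y)) hexp
    have h4 := le_mul_of_one_le_left (Finset.sum_nonneg fun i (_ : i ∈ Finset.univ.erase m') =>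
      hu0 (hammingDist (C i).1 y)) hexp
    linarith
  refine (iInf₂_le D hdec).trans ?_
  rw [KnD_eq hR hR2 hT]
  refine iSup₂_le fun θ hθ => ENNReal.ofReal_le_ofReal ?_
  rw [Gam_mul_exp, codeSum]
  refine mul_le_mul_of_nonneg_left (Finset.sum_le_sum fun m _ => Finset.sum_le_sum fun y _ => ?_)
    (by positivity)
  have hle : ∀ m, Real.exp (n * (ξ * eR R T θ)) * chan θ (C m).1 y ≤ u (hammingDist (C m).1 y) :=
    fun m => exp_mul_chan_le hR hR2 hT hξ hn hθ _ _
  split_ifs with h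
  · have hlt := (Finset.mem_filter.1 h).2
    rw [min_eq_left hlt.le]
    exact mul_le_mul_of_nonneg_left (Finset.sum_le_sum fun m' _ => hle m') (Real.exp_pos _).le
  · have hge : u (hammingDist (C m).1 y) ≤ Real.exp (n * T) *
        ∑ m' ∈ Finset.univ.erase m, u (hammingDist (C m').1 y) := by
      by_contra! hcon
      exact h (Finset.mem_filter.2 ⟨Finset.mem_univ _, hcon⟩)
    rw [min_eq_right hge]
    exact hle m

/-- Only `n + 1` crossover probabilities matter, one for each Hamming distance, so the maximum
over `θ` may be replaced by a sum and exchanged with the sum over the output words. -/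
lemma le_Kn (hR : 0 < R) (hR2 : R ≤ Real.log 2) (hT : 0 ≤ T) {M n : ℕ} (hn : 0 < n)
    (C : Codebook M n) :
    ENNReal.ofReal (codeSum min T (metricWeight R T ξ n) C / (2 * ((n : ℝ) + 1))) ≤
      Kn R T ξ C := by
  classical
  have hn' : (0 : ℝ) < n := by exact_mod_cast hn
  set u := metricWeight R T ξ n with hu
  have hex : ∀ d : ℕ, ∃ θ, 0 < θ ∧ θ < 1 ∧
      metric R T ξ ((d : ℝ) / n) - Real.log 2 / n < met R T ξ θ ((d : ℝ) / n) := fun d =>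
    exists_lt_met (by
      have : 0 < Real.log 2 / n := div_pos (Real.log_pos (by norm_num)) hn'
      linarith)
  -- a channel for each Hamming distance whose likelihood attains half the metric weight there
  choose t ht0 ht1 ht using hex
  have htm : ∀ d, t d ∈ Icc (0 : ℝ) 1 := fun d => ⟨(ht0 d).le, (ht1 d).le⟩
  set w : ℕ → Word n → Word n → ℝ := fun j x y =>
    Real.exp (n * (ξ * eR R T (t j))) * chan (t j) x y with hw
  have hw0 : ∀ j x y, 0 ≤ w j x y := fun j x y =>
    mul_nonneg (Real.exp_pos _).le (chan_nonneg (htm j) x y)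
  have hub : ∀ x y : Word n, u (hammingDist x y) ≤ ∑ j ∈ Finset.range (n + 1), 2 * w j x y := by
    intro x y
    set d := hammingDist x y with hd
    have hdn : d ≤ n := hammingDist_le x y
    refine le_trans ?_ (Finset.single_le_sum (f := fun j => 2 * w j x y)
      (fun j _ => mul_nonneg zero_le_two (hw0 j x y)) (Finset.mem_range.2 (Nat.lt_succ_of_le hdn)))
    have e : w d x y = Real.exp (n * met R T ξ (t d) ((d : ℝ) / n)) := by
      simp only [hw]
      rw [chan_eq, ← hd]
      change _ * chanWeight (t d) n d = _
      rw [chanWeight_eq_exp (ht0 d) (ht1 d) hn hdn, ← Real.exp_add, ← mul_add, met]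
    have e2 : (2 : ℝ) = Real.exp (Real.log 2) := (Real.exp_log (by norm_num)).symm
    change u d ≤ 2 * w d x y
    rw [e, e2, ← Real.exp_add, hu, metricWeight]
    refine Real.exp_le_exp.2 ?_
    have h3 := mul_le_mul_of_nonneg_left (ht d).le hn'.le
    rw [mul_sub, mul_div_cancel₀ _ hn'.ne'] at h3
    linarith
  refine le_iInf₂ fun D _ => ?_
  have hsum : codeSum min T u C ≤ ∑ j ∈ Finset.range (n + 1),
      2 * (Gam T (t j) C D * Real.exp (n * (ξ * eR R T (t j) + T))) := by
    simp_rw [Gam_mul_exp]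
    have hterm : ∀ (m : Fin M) (y : Word n),
        min (Real.exp (n * T) * ∑ m' ∈ Finset.univ.erase m, u (hammingDist (C m').1 y))
          (u (hammingDist (C m).1 y)) ≤ ∑ j ∈ Finset.range (n + 1), 2 *
          (if y ∈ D m then Real.exp (n * T) * ∑ m' ∈ Finset.univ.erase m, w j (C m').1 y
            else w j (C m).1 y) := by
      intro m y
      split_ifs with h
      · refine (min_le_left _ _).trans ?_
        calc _ ≤ Real.exp (n * T) * ∑ m' ∈ Finset.univ.erase m,
              ∑ j ∈ Finset.range (n + 1), 2 * w j (C m').1 y :=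
              mul_le_mul_of_nonneg_left (Finset.sum_le_sum fun m' _ => hub _ _)
                (Real.exp_pos _).le
          _ = _ := by
              rw [Finset.sum_comm, Finset.mul_sum]
              refine Finset.sum_congr rfl fun j _ => ?_
              rw [← Finset.mul_sum]; ring
      · exact (min_le_right _ _).trans (hub _ _)
    have hswap : ∀ F : ℕ → Fin M → Word n → ℝ,
        1 / (M : ℝ) * ∑ m, ∑ y, ∑ j ∈ Finset.range (n + 1), 2 * F j m y =
          ∑ j ∈ Finset.range (n + 1), 2 * (1 / (M : ℝ) * ∑ m, ∑ y, F j m y) := by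
      intro F
      simp only [Finset.mul_sum]
      rw [Finset.sum_comm (s := Finset.range (n + 1))]
      refine Finset.sum_congr rfl fun m _ => ?_
      rw [Finset.sum_comm]
      exact Finset.sum_congr rfl fun j _ => Finset.sum_congr rfl fun y _ => by ring
    unfold codeSum
    calc _ ≤ 1 / (M : ℝ) * ∑ m : Fin M, ∑ y : Word n, ∑ j ∈ Finset.range (n + 1), 2 *
          (if y ∈ D m then Real.exp (n * T) * ∑ m' ∈ Finset.univ.erase m, w j (C m').1 y
            else w j (C m).1 y) :=
          mul_le_mul_of_nonneg_left (Finset.sum_le_sum fun m _ => Finset.sum_le_sum fun y _ =>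
            hterm m y) (by positivity)
      _ = _ := hswap _
  have hK : ∀ j, ENNReal.ofReal (Gam T (t j) C D * Real.exp (n * (ξ * eR R T (t j) + T))) ≤
      KnD R T ξ C D := by
    intro j
    rw [KnD_eq hR hR2 hT]
    exact le_iSup₂ (f := fun θ (_ : θ ∈ Icc (0 : ℝ) 1) =>
      ENNReal.ofReal (Gam T θ C D * Real.exp (n * (ξ * eR R T θ + T)))) (t j) (htm j)
  rw [ENNReal.ofReal_div_of_pos (by positivity)]
  refine ENNReal.div_le_of_le_mul ?_
  have hG0 : ∀ j, 0 ≤ Gam T (t j) C D * Real.exp (n * (ξ * eR R T (t j) + T)) := by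
    intro j
    rw [Gam_mul_exp]
    refine mul_nonneg (by positivity) (Finset.sum_nonneg fun m _ => Finset.sum_nonneg fun y _ => ?_)
    split_ifs
    · exact mul_nonneg (Real.exp_pos _).le (Finset.sum_nonneg fun m' _ => hw0 j _ _)
    · exact hw0 j _ _
  calc _ ≤ ENNReal.ofReal (∑ j ∈ Finset.range (n + 1),
        2 * (Gam T (t j) C D * Real.exp (n * (ξ * eR R T (t j) + T)))) :=
        ENNReal.ofReal_le_ofReal hsum
    _ = ∑ j ∈ Finset.range (n + 1), ENNReal.ofReal 2 *
        ENNReal.ofReal (Gam T (t j) C D * Real.exp (n * (ξ * eR R T (t j) + T))) := by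
        rw [ENNReal.ofReal_sum_of_nonneg fun j _ => mul_nonneg zero_le_two (hG0 j)]
        exact Finset.sum_congr rfl fun j _ => ENNReal.ofReal_mul zero_le_two
    _ ≤ ∑ j ∈ Finset.range (n + 1), ENNReal.ofReal 2 * KnD R T ξ C D := by
        gcongr with j _
        exact hK j
    _ = _ := by
        rw [Finset.sum_const, Finset.card_range, nsmul_eq_mul, mul_comm (KnD R T ξ C D),
          ENNReal.ofReal_mul zero_le_two, ← mul_assoc, mul_comm (ENNReal.ofReal 2)]
        congr 2
        rw [← ENNReal.ofReal_natCast]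
        push_cast
        rfl

lemma pairExp_sub (R T v v' q q' η : ℝ) :
    pairExp R T (v - η) (v' - η) q q' = pairExp R T v v' q q' - η := by
  unfold pairExp
  rw [add_sub_assoc (Real.binEntropy q), ← min_sub_sub_right]
  congr 2 <;> ring

lemma pairExp_mono {R T v w v' w' : ℝ} (q q' : ℝ) (h : v ≤ w) (h' : v' ≤ w') :
    pairExp R T v v' q q' ≤ pairExp R T w w' q q' := by
  unfold pairExp
  gcongr

/-- A fraction is achievable if and only if no pair of joint types contributes an exponentially
growing term under the optimal metric. -/
theorem achievable_iff_pairExp (hR : 0 < R) (hR2 : R ≤ Real.log 2) (hT : 0 ≤ T) (hξ : 0 ≤ ξ) :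
    Achievable R T ξ ↔ ∀ q ∈ Icc (0 : ℝ) 1, ∀ q' ∈ Icc (0 : ℝ) 1,
      pairExp R T (metric R T ξ q) (metric R T ξ q') q q' ≤ 0 := by
  have havg : ∀ k : ℕ, (∑ C : Codebook (codeSize R (2 * k)) (2 * k),
      ENNReal.ofReal (codeSum min T (metricWeight R T ξ (2 * k)) C)) /
      (Fintype.card (Codebook (codeSize R (2 * k)) (2 * k)) : ℝ≥0∞) =
      ENNReal.ofReal (𝔼 C : Codebook (codeSize R (2 * k)) (2 * k),
        codeSum min T (metricWeight R T ξ (2 * k)) C) := fun k =>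
    sum_ofReal_div_card fun C => codeSum_min_nonneg T (metricWeight_nonneg _) C
  constructor
  · intro hach q hq q' hq'
    by_contra! hpos
    set c := pairExp R T (metric R T ξ q) (metric R T ξ q') q q' with hc
    obtain ⟨θ, h0, h1, hθ⟩ := exists_lt_met (R := R) (T := T) (ξ := ξ) (q := q)
      (show metric R T ξ q - c / 2 < _ by linarith)
    obtain ⟨θ', h0', h1', hθ'⟩ := exists_lt_met (R := R) (T := T) (ξ := ξ) (q := q')
      (show metric R T ξ q' - c / 2 < _ by linarith)
    set a : ℕ → ℝ := fun k => (⌊q * k⌋₊ : ℝ) / k with ha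
    set b : ℕ → ℝ := fun k => (⌊q' * k⌋₊ : ℝ) / k with hb
    have ta : Tendsto a atTop (𝓝 q) := tendsto_floor_mul_div hq.1
    have tb : Tendsto b atTop (𝓝 q') := tendsto_floor_mul_div hq'.1
    have hmet : ∀ θ, Continuous (met R T ξ θ) := fun θ =>
      continuous_const.add (continuous_lik θ)
    set v : ℕ → ℝ := fun k =>
      pairExp R T (met R T ξ θ (a k)) (met R T ξ θ' (b k)) (a k) (b k) with hv
    have tv : Tendsto v atTop (𝓝 (pairExp R T (met R T ξ θ q) (met R T ξ θ' q') q q')) := by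
      have t1 := ((hmet θ).tendsto q).comp ta
      have t2 := ((hmet θ').tendsto q').comp tb
      have t3 := ((continuous_gap R).tendsto q').comp tb
      exact ((Real.binEntropy_continuous.tendsto q).comp ta).add
        (((t2.const_add T).sub t3).min (t1.sub (tendsto_const_nhds.max t3)))
    -- even Hamming distances `2 ⌊q k⌋` and `2 ⌊q' k⌋` occur between balanced words
    have hlim := le_liminf_log (X := fun k => avgKn R T ξ (2 * k)) (A := 256) (by norm_num) 7 tv
      (by
        filter_upwards [eventually_gt_atTop 0, eventually_two_le_exp hR] with k hk0 hkR
        have hj := floor_mul_le hq.2 k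
        have hj' := floor_mul_le hq'.2 k
        have hk' : (0 : ℝ) < k := by exact_mod_cast hk0
        have hweight : ∀ (θ : ℝ), 0 < θ → θ < 1 → ∀ j ≤ k,
            Real.exp ((2 * k : ℕ) * met R T ξ θ ((j : ℝ) / k)) ≤
              metricWeight R T ξ (2 * k) (2 * j) := by
          intro θ h0 h1 j hj
          have e : ((2 * j : ℕ) : ℝ) / ((2 * k : ℕ) : ℝ) = (j : ℝ) / k := by
            push_cast
            rw [mul_div_mul_left _ _ two_ne_zero]
          rw [metricWeight, e]
          have := met_le_metric hR hR2 hT hξ (q := (j : ℝ) / k) ⟨by positivity,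
            div_le_one_of_le₀ (by exact_mod_cast hj) hk'.le⟩ h0 h1
          gcongr
        have key := exp_pairExp_le_expect_codeSum_min T (metricWeight_nonneg (R := R) (T := T)
          (ξ := ξ) (2 * k)) hj hj' hkR (hweight θ h0 h1 _ hj) (hweight θ' h0' h1' _ hj')
        have hstep : ENNReal.ofReal (𝔼 C : Codebook (codeSize R (2 * k)) (2 * k),
            codeSum min T (metricWeight R T ξ (2 * k)) C / (2 * (((2 * k : ℕ) : ℝ) + 1))) ≤
            avgKn R T ξ (2 * k) := by
          rw [← sum_ofReal_div_card fun C =>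
            div_nonneg (codeSum_min_nonneg T (metricWeight_nonneg _) C) (by positivity)]
          refine ENNReal.div_le_div_right (Finset.sum_le_sum fun C _ => ?_) _
          exact le_Kn hR hR2 hT (by omega) C
        refine le_trans (ENNReal.ofReal_le_ofReal ?_) hstep
        rw [← Finset.expect_div, le_div_iff₀ (by positivity)]
        refine le_trans ?_ key
        rw [div_mul_eq_mul_div, div_le_div_iff₀ (by positivity) (by positivity), mul_assoc]
        refine mul_le_mul_of_nonneg_left ?_ (Real.exp_pos _).le
        push_cast
        have : 2 * (2 * (k : ℝ) + 1) ≤ 4 * ((k : ℝ) + 1) := by linarith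
        calc _ ≤ 4 * ((k : ℝ) + 1) * (64 * ((k : ℝ) + 1) ^ 6) := by gcongr
          _ = _ := by ring)
    have h2 := (hlim.trans (liminf_le_limsup (f := atTop))).trans hach
    have h3 : pairExp R T (met R T ξ θ q) (met R T ξ θ' q') q q' ≤ 0 := by exact_mod_cast h2
    have h4 := pairExp_mono (R := R) (T := T) q q' hθ.le hθ'.le
    rw [pairExp_sub, ← hc] at h4
    linarith
  · intro h
    refine limsup_log_le (A := 16) (by norm_num) 3 (c := 0) ?_
    filter_upwards [eventually_gt_atTop 0] with k hk
    have hbound := expect_codeSum_min_le_exp (R := R) (T := T) (c := 0) hR.le (k := k)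
      (u := metricWeight R T ξ (2 * k)) (metricWeight_nonneg _) (V := metric R T ξ)
      (fun d _ => le_rfl) h
    refine le_trans ?_ (ENNReal.ofReal_le_ofReal hbound)
    rw [← havg k]
    exact ENNReal.div_le_div_right (Finset.sum_le_sum fun C _ =>
      Kn_le hR hR2 hT hξ (by omega) C) _

/-- The exponents lie in `[0, log 2]`, so the metric is Lipschitz in `ξ`. -/
lemma continuousOn_metric (hR : 0 < R) (hR2 : R ≤ Real.log 2) (hT : 0 ≤ T) {q : ℝ}
    (hq : q ∈ Icc (0 : ℝ) 1) : ContinuousOn (fun ξ => metric R T ξ q) (Icc 0 1) := by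
  have hL : 0 ≤ Real.log 2 := Real.log_nonneg (by norm_num)
  refine (LipschitzOnWith.of_le_add_mul (Real.log 2).toNNReal fun x hx y hy => ?_).continuousOn
  rw [Real.coe_toNNReal _ hL]
  refine metric_le fun θ h0 h1 => ?_
  have h2 := met_le_metric hR hR2 hT hy.1 hq h0 h1
  obtain ⟨h3, h4⟩ := eR_mem hR hR2 hT (θ := θ) ⟨h0.le, h1.le⟩
  have h5 : (x - y) * eR R T θ ≤ Real.log 2 * dist x y := by
    rw [Real.dist_eq, mul_comm (Real.log 2)]
    exact mul_le_mul (le_abs_self _) (by linarith) h3 (abs_nonneg _)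
  unfold met at h2 ⊢
  linarith

lemma isClosed_setOf_pairExp (hR : 0 < R) (hR2 : R ≤ Real.log 2) (hT : 0 ≤ T) :
    IsClosed {ξ : ℝ | ξ ∈ Icc (0 : ℝ) 1 ∧ ∀ q ∈ Icc (0 : ℝ) 1, ∀ q' ∈ Icc (0 : ℝ) 1,
      pairExp R T (metric R T ξ q) (metric R T ξ q') q q' ≤ 0} := by
  have e : {ξ : ℝ | ξ ∈ Icc (0 : ℝ) 1 ∧ ∀ q ∈ Icc (0 : ℝ) 1, ∀ q' ∈ Icc (0 : ℝ) 1,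
      pairExp R T (metric R T ξ q) (metric R T ξ q') q q' ≤ 0} =
      Icc (0 : ℝ) 1 ∩ ⋂ p : Icc (0 : ℝ) 1 × Icc (0 : ℝ) 1, (Icc (0 : ℝ) 1 ∩
        (fun ξ => pairExp R T (metric R T ξ p.1) (metric R T ξ p.2) p.1 p.2) ⁻¹' Iic 0) := by
    ext ξ
    simp only [mem_ofPred_eq, mem_inter_iff, mem_iInter, mem_preimage, mem_Iic, Prod.forall,
      Subtype.forall]
    refine and_congr_right fun hξ => ⟨fun h q hq q' hq' => ⟨hξ, h q hq q' hq'⟩,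
      fun h q hq q' hq' => (h q hq q' hq').2⟩
  rw [e]
  refine isClosed_Icc.inter (isClosed_iInter fun p => ?_)
  refine ContinuousOn.preimage_isClosed_of_isClosed ?_ isClosed_Icc isClosed_Iic
  have c1 := continuousOn_metric hR hR2 hT p.1.2
  have c2 := continuousOn_metric hR hR2 hT p.2.2
  unfold pairExp
  exact continuousOn_const.add (((continuousOn_const.add c2).sub continuousOn_const).inf
    (c1.sub continuousOn_const))

end Erasure

/-! ### The fraction zero -/

/-- The decoder that always erases attains the normalization `e^{-nT}`. -/
lemma achievable_zero (R T : ℝ) : Achievable R T 0 := by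
  have hKn : ∀ n (C : Codebook (codeSize R n) n), Kn R T 0 C ≤ 1 := by
    intro n C
    have hM : ((codeSize R n : ℕ) : ℝ) ≠ 0 := by
      exact_mod_cast (codeSize_pos R n).ne'
    refine (iInf₂_le (fun _ => ∅) fun _ _ _ _ => Finset.disjoint_empty_left _).trans ?_
    refine iSup₂_le fun θ _ => ?_
    have hG : Gam T θ C (fun _ => ∅) = Real.exp (-(n * T)) := by
      simp [Gam, prE1, prE2, sum_chan, hM]
    rw [hG, EReal.coe_zero, zero_mul, zero_add,
      show -((n : EReal) * (T : EReal)) = ((-(n * T) : ℝ) : EReal) by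
        rw [EReal.coe_neg, EReal.coe_mul]; rfl, EReal.exp_coe]
    exact ENNReal.div_self_le_one
  refine limsup_log_le (A := 1) one_pos 0 (c := 0) (Eventually.of_forall fun k => ?_)
  simp only [pow_zero, mul_one, mul_zero, Real.exp_zero, ENNReal.ofReal_one]
  refine ENNReal.div_le_of_le_mul ?_
  rw [one_mul]
  refine (Finset.sum_le_sum fun C _ => hKn _ C).trans ?_
  simp

lemma zero_mul_sub_nonpos {x y : EReal} (hy : 0 ≤ y) : ((0 : ℝ) : EReal) * x - y ≤ 0 := by
  rw [EReal.coe_zero, zero_mul, zero_sub]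
  exact EReal.neg_le.1 (by simpa using hy)

lemma cond1_zero (R T : ℝ) : Cond1 R T 0 :=
  iSup₂_le fun _ hθ => zero_mul_sub_nonpos <| le_iInf₂ fun _ hq =>
    add_nonneg (divB_nonneg hθ hq) (by exact_mod_cast le_max_left _ _)

lemma cond2_zero (R T : ℝ) : Cond2 R T 0 :=
  iSup₂_le fun _ hθ => zero_mul_sub_nonpos <| le_iInf₂ fun _ hq => divB_nonneg hθ hq.1

/-! ### The list mode -/

/-- The letters are independent. -/
lemma expect_prod_pi {ι Ω : Type} [Fintype ι] [DecidableEq ι] [Fintype Ω] (f : Ω → ℝ) :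
    𝔼 C : ι → Ω, ∏ i, f (C i) = (𝔼 x, f x) ^ Fintype.card ι := by
  rw [Fintype.expect_eq_sum_div_card, Fintype.expect_eq_sum_div_card, div_pow,
    Fintype.card_fun, Nat.cast_pow]
  congr 1
  have := Finset.prod_univ_sum (fun _ : ι => (Finset.univ : Finset Ω)) (fun _ x => f x)
  rw [Finset.prod_const, Finset.card_univ, Fintype.piFinset_univ] at this
  exact this.symm

/-- Over the noiseless channel a list decoder loses the transmitted codeword only if it is repeated
at least `e^{-nT}` times, and this has superexponentially small probability, by the Chernoff
bound. -/
lemma avgE1_zero_le {R T : ℝ} (hR : 0 < R) (hR2 : R ≤ Real.log 2) (k : ℕ) :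
    avgE1 R T 0 (2 * k) ≤
      Real.exp (4 * ((2 * k : ℕ) + 1) - Real.exp (-((2 * k : ℕ) * T))) := by
  set n := 2 * k with hn
  set M := codeSize R n with hM
  set B := Real.exp (4 * ((n : ℕ) + 1) - Real.exp (-((n : ℕ) * T))) with hB
  have hM0 : 0 < M := codeSize_pos R n
  have hM0' : (0 : ℝ) < M := by exact_mod_cast hM0
  have hc0 : (0 : ℝ) < n.choose k := by exact_mod_cast Nat.choose_pos (by omega)
  have hMp : (M : ℝ) * (1 / n.choose k) ≤ 2 * ((n : ℝ) + 1) := by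
    rw [mul_one_div, div_le_iff₀ hc0]
    calc (M : ℝ) ≤ 2 * Real.exp (n * Real.log 2) := by
          calc (M : ℝ) ≤ 2 * Real.exp (n * R) := codeSize_le hR.le n
            _ ≤ _ := by gcongr
      _ ≤ 2 * (((n : ℝ) + 1) * n.choose k) := by gcongr; exact exp_le_centralBinom k
      _ = _ := by ring
  have herased : ∀ s : ℝ, erased (Real.exp (n * T) * s) 1 ≤
      Real.exp (s - Real.exp (-(n * T))) := by
    intro s
    unfold erased
    split_ifs with h
    · refine Real.one_le_exp (sub_nonneg.2 ?_)
      rw [Real.exp_neg, inv_le_iff_one_le_mul₀' (Real.exp_pos _)]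
      exact h
    · exact (Real.exp_pos _).le
  have hinner : ∀ (m : Fin M) (y : Word n), 𝔼 C' : {j // j ≠ m} → BalancedWord n,
      erased (∑ j, Real.exp (n * T) * chanWeight 0 n (hammingDist (C' j).1 y)) 1 ≤ B := by
    intro m y
    -- `e ≤ 3`
    have hf : ∀ x : BalancedWord n, Real.exp (chanWeight 0 n (hammingDist x.1 y)) ≤
        1 + 2 * (if x.1 = y then 1 else 0) := by
      intro x
      simp only [chanWeight_zero, hammingDist_eq_zero]
      split_ifs
      · have := Real.exp_one_lt_d9
        linarith
      · simp
    have hp : 𝔼 x : BalancedWord n, (if x.1 = y then (1 : ℝ) else 0) ≤ 1 / n.choose k := by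
      rw [Fintype.expect_eq_sum_div_card, card_balancedWord]
      refine div_le_div_of_nonneg_right ?_ hc0.le
      rw [Finset.sum_boole]
      have : (Finset.univ.filter fun x : BalancedWord n => x.1 = y).card ≤ 1 :=
        Finset.card_le_one.2 fun a ha b hb => Subtype.ext
          ((Finset.mem_filter.1 ha).2.trans (Finset.mem_filter.1 hb).2.symm)
      exact_mod_cast this
    have hE : 𝔼 x : BalancedWord n, Real.exp (chanWeight 0 n (hammingDist x.1 y)) ≤
        Real.exp (2 * (1 / n.choose k)) := by
      calc _ ≤ 𝔼 x : BalancedWord n, (1 + 2 * (if x.1 = y then (1 : ℝ) else 0)) :=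
            Finset.expect_le_expect fun x _ => hf x
        _ = 1 + 2 * 𝔼 x : BalancedWord n, (if x.1 = y then (1 : ℝ) else 0) := by
            rw [Finset.expect_add_distrib, Fintype.expect_const, Finset.mul_expect]
        _ ≤ 2 * (1 / n.choose k) + 1 := by linarith
        _ ≤ _ := Real.add_one_le_exp _
    calc _ ≤ 𝔼 C' : {j // j ≠ m} → BalancedWord n, Real.exp (-Real.exp (-(n * T))) *
          ∏ j, Real.exp (chanWeight 0 n (hammingDist (C' j).1 y)) := by
          refine Finset.expect_le_expect fun C' _ => ?_
          rw [← Finset.mul_sum, ← Real.exp_sum, ← Real.exp_add, neg_add_eq_sub]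
          exact herased _
      _ = Real.exp (-Real.exp (-(n * T))) *
          (𝔼 x : BalancedWord n, Real.exp (chanWeight 0 n (hammingDist x.1 y))) ^ (M - 1) := by
          rw [← Finset.mul_expect, expect_prod_pi
            (fun x : BalancedWord n => Real.exp (chanWeight 0 n (hammingDist x.1 y))),
            card_ne_fin]
      _ ≤ Real.exp (-Real.exp (-(n * T))) * Real.exp (2 * (1 / n.choose k)) ^ (M - 1) := by
          have : 0 ≤ 𝔼 x : BalancedWord n, Real.exp (chanWeight 0 n (hammingDist x.1 y)) :=
            Finset.expect_nonneg fun _ _ => (Real.exp_pos _).le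
          gcongr
      _ ≤ Real.exp (-Real.exp (-(n * T))) * Real.exp (2 * (1 / n.choose k)) ^ M := by
          gcongr
          · exact Real.one_le_exp (by positivity)
          · exact Nat.sub_le _ _
      _ ≤ B := by
          rw [← Real.exp_nat_mul, ← Real.exp_add, hB]
          refine Real.exp_le_exp.2 ?_
          linarith
  rw [avgE1_eq, expect_codeSum]
  have hx : ∀ (m : Fin M) (x : BalancedWord n), (∑ y : Word n,
      𝔼 C' : {j // j ≠ m} → BalancedWord n,
        erased (∑ j, Real.exp (n * T) * chanWeight 0 n (hammingDist (C' j).1 y))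
          (chanWeight 0 n (hammingDist x.1 y))) ≤ B := by
    intro m x
    rw [Finset.sum_eq_single x.1]
    · rw [hammingDist_self, chanWeight_zero, if_pos rfl]
      exact hinner m x.1
    · intro y _ hy
      rw [chanWeight_zero, if_neg (hammingDist_ne_zero.2 hy.symm)]
      simp [erased]
    · simp
  calc _ ≤ 1 / (M : ℝ) * ∑ m : Fin M, B := by
        refine mul_le_mul_of_nonneg_left (Finset.sum_le_sum fun m _ => ?_) (by positivity)
        refine (Finset.expect_le_expect fun x _ => hx m x).trans_eq ?_
        exact Fintype.expect_const _
    _ = B := by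
        rw [Finset.sum_const, Finset.card_univ, Fintype.card_fin, nsmul_eq_mul]
        field_simp

lemma expE1_zero_eq_top {R T : ℝ} (hR : 0 < R) (hR2 : R ≤ Real.log 2) (hT : T < 0) :
    expE1 R T 0 = ⊤ := by
  refine EReal.eq_top_iff_forall_lt _ |>.2 fun e => ?_
  refine lt_of_lt_of_le (EReal.coe_lt_coe_iff.2 (lt_add_one e)) ?_
  refine neg_le_expE1_of_limsup (limsup_log_le (A := 1) one_pos 0 ?_)
  filter_upwards [eventually_ge_atTop 1,
    tendsto_natCast_atTop_atTop.eventually_ge_atTop ((|e| + 7) / T ^ 2)] with k hk1 hk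
  refine ENNReal.ofReal_le_ofReal ((avgE1_zero_le hR hR2 k).trans ?_)
  rw [pow_zero, one_mul, one_mul, Real.exp_le_exp]
  have hk1' : (1 : ℝ) ≤ k := by exact_mod_cast hk1
  have hT2 : 0 < T ^ 2 := by have := hT.ne; positivity
  have hkT := (div_le_iff₀ hT2).1 hk
  have hq := Real.quadratic_le_exp_of_nonneg (x := -(((2 * k : ℕ) : ℝ) * T)) (by
    have : 0 ≤ ((2 * k : ℕ) : ℝ) * (-T) := mul_nonneg (Nat.cast_nonneg _) (by linarith)
    linarith)
  push_cast at hq ⊢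
  have h1 : (k : ℝ) * (|e| + 7) ≤ k * (k * T ^ 2) := by gcongr
  have h2 : (k : ℝ) * e ≤ k * |e| := by gcongr; exact le_abs_self e
  have h3 : 0 ≤ -(2 * (k : ℝ) * T) := by
    have : 0 ≤ (k : ℝ) * (-T) := mul_nonneg (by linarith) (by linarith)
    linarith
  nlinarith

/-- In the list mode the noiseless channel has an infinite exponent, so that a positive fraction of
it cannot be attained: a codebook that repeats one word has errors with every decoder. -/
lemma not_achievable_of_neg {R T ξ : ℝ} (hR : 0 < R) (hR2 : R ≤ Real.log 2) (hT : T < 0)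
    (hξ : 0 < ξ) : ¬ Achievable R T ξ := by
  classical
  have hchan : ∀ n (x y : Word n), 0 ≤ chan 0 x y := fun n x y =>
    chan_nonneg ⟨le_rfl, zero_le_one⟩ x y
  have hself : ∀ n (x : Word n), chan 0 x x = 1 := fun n x => by simp [chan]
  have hGam : ∀ k, 0 < k → ∀ (x : BalancedWord (2 * k))
      (D : Regions (codeSize R (2 * k)) (2 * k)), 0 < Gam T 0 (fun _ => x) D := by
    intro k hk x D
    have hM : 1 < codeSize R (2 * k) := by
      refine Nat.lt_ceil.2 ?_
      rw [Nat.cast_one]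
      have : (0 : ℝ) < ((2 * k : ℕ) : ℝ) := by exact_mod_cast (by omega)
      exact Real.one_lt_exp_iff.2 (by positivity)
    have hM' : (0 : ℝ) < 1 / (codeSize R (2 * k) : ℝ) :=
      one_div_pos.2 (by exact_mod_cast zero_lt_one.trans hM)
    have h1 : 0 ≤ prE1 0 (fun _ => x) D := mul_nonneg hM'.le
      (Finset.sum_nonneg fun m _ => Finset.sum_nonneg fun y _ => hchan _ _ _)
    have h2 : 0 ≤ prE2 0 (fun _ => x) D := mul_nonneg hM'.le
      (Finset.sum_nonneg fun m _ => Finset.sum_nonneg fun y _ =>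
        Finset.sum_nonneg fun m' _ => hchan _ _ _)
    have he := Real.exp_pos (-(((2 * k : ℕ) : ℝ) * T))
    by_cases hx : ∃ m, x.1 ∈ D m
    · obtain ⟨m, hm⟩ := hx
      have : Nontrivial (Fin (codeSize R (2 * k))) := Fin.nontrivial_iff_two_le.2 hM
      obtain ⟨m', hm'⟩ := exists_ne m
      have : 0 < prE2 0 (fun _ => x) D := by
        refine mul_pos hM' (Finset.sum_pos' (fun m _ => Finset.sum_nonneg fun y _ =>
          Finset.sum_nonneg fun m' _ => hchan _ _ _) ⟨m, Finset.mem_univ _, ?_⟩)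
        refine Finset.sum_pos' (fun y _ => Finset.sum_nonneg fun m' _ => hchan _ _ _)
          ⟨x.1, hm, ?_⟩
        refine Finset.sum_pos' (fun m' _ => hchan _ _ _)
          ⟨m', Finset.mem_erase.2 ⟨hm', Finset.mem_univ _⟩, ?_⟩
        rw [hself]; exact one_pos
      exact add_pos_of_pos_of_nonneg this (mul_nonneg he.le h1)
    · push Not at hx
      have : 0 < prE1 0 (fun _ => x) D := by
        refine mul_pos hM' (Finset.sum_pos' (fun m _ => Finset.sum_nonneg fun y _ =>
          hchan _ _ _) ⟨⟨0, by omega⟩, Finset.mem_univ _, ?_⟩)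
        refine Finset.sum_pos' (fun y _ => hchan _ _ _) ⟨x.1, Finset.mem_compl.2 (hx _), ?_⟩
        rw [hself]; exact one_pos
      exact add_pos_of_nonneg_of_pos h2 (mul_pos he this)
  have htop : ∀ k, 0 < k → avgKn R T ξ (2 * k) = ⊤ := by
    intro k hk
    obtain ⟨x⟩ : Nonempty (BalancedWord (2 * k)) := inferInstance
    have hn : (0 : EReal) < ((2 * k : ℕ) : EReal) := by exact_mod_cast (by omega)
    have hKn : Kn R T ξ (fun _ : Fin (codeSize R (2 * k)) => x) = ⊤ := by
      refine top_le_iff.1 (le_iInf₂ fun D _ => ?_)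
      refine le_trans ?_ (le_iSup₂ (0 : ℝ) (⟨le_rfl, zero_le_one⟩ : (0 : ℝ) ∈ Icc (0 : ℝ) 1))
      rw [expE1_zero_eq_top hR hR2 hT, EReal.coe_mul_top_of_pos hξ, EReal.top_add_coe,
        EReal.mul_top_of_pos hn, EReal.neg_top, EReal.exp_bot, ENNReal.div_zero]
      exact (ENNReal.ofReal_pos.2 (hGam k hk x D)).ne'
    have hsum : ∑ C : Codebook (codeSize R (2 * k)) (2 * k), Kn R T ξ C = ⊤ :=
      ENNReal.sum_eq_top.2 ⟨_, Finset.mem_univ _, hKn⟩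
    rw [avgKn, hsum, ENNReal.top_div_of_ne_top (ENNReal.natCast_ne_top _)]
  intro h
  have hlim : limsup (fun k : ℕ => ENNReal.log (avgKn R T ξ (2 * k)) / ((2 * k : ℕ) : EReal))
      atTop = ⊤ := by
    rw [limsup_congr (v := fun _ => ⊤), limsup_const]
    filter_upwards [eventually_gt_atTop 0] with k hk
    rw [htop k hk, ENNReal.log_top]
    exact EReal.top_div_of_pos_ne_top (by exact_mod_cast (by omega)) (EReal.natCast_ne_top _)
  rw [Achievable, hlim] at h
  exact absurd h (by simp)

lemma not_cond1_of_neg {R T ξ : ℝ} (hT : T < 0) (hξ : 0 < ξ) : ¬ Cond1 R T ξ := by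
  intro h
  have h0 := (le_iSup₂ (f := fun θ (_ : θ ∈ Icc (0 : ℝ) 1) => ((ξ : EReal) * E1BSC R T θ -
    ⨅ q ∈ Icc (0 : ℝ) 1, (divB q θ +
      ((max 0 (-gFun (q1 R T ξ q) (q2 R T ξ q) + Real.log 2 - R) : ℝ) : EReal))))
      0 ⟨le_rfl, zero_le_one⟩).trans h
  have hE : E1BSC R T 0 = ⊤ := by simp [E1BSC, hT.not_ge]
  have hdiv : divB 0 0 = 0 := by simp [divB, logLik_zero_zero]
  have hI := iInf₂_le (f := fun q (_ : q ∈ Icc (0 : ℝ) 1) => divB q 0 +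
    ((max 0 (-gFun (q1 R T ξ q) (q2 R T ξ q) + Real.log 2 - R) : ℝ) : EReal))
    0 ⟨le_rfl, zero_le_one⟩
  rw [hdiv, zero_add] at hI
  have hI' := (hI.trans_lt (EReal.coe_lt_top _)).ne
  rw [hE, EReal.coe_mul_top_of_pos hξ, EReal.top_sub hI'] at h0
  exact absurd h0 (by simp)

lemma setOf_eq_singleton_zero {P : ℝ → Prop} (h0 : P 0) (h : ∀ ξ, 0 < ξ → ¬ P ξ) :
    {ξ : ℝ | ξ ∈ Icc (0 : ℝ) 1 ∧ P ξ} = {0} := by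
  ext ξ
  refine ⟨fun hξ => ?_, ?_⟩
  · rcases hξ.1.1.eq_or_lt with h1 | h1
    · exact h1.symm
    · exact absurd hξ.2 (h ξ h1)
  · rintro rfl
    exact ⟨⟨le_rfl, zero_le_one⟩, h0⟩

/-- Both sets are `{0}` in the list mode, and both are given by the pair exponents otherwise. -/
theorem setOf_cond_eq_setOf_achievable {R T : ℝ} (hR : 0 < R) (hR2 : R ≤ Real.log 2) :
    {ξ : ℝ | ξ ∈ Icc (0 : ℝ) 1 ∧ Cond1 R T ξ ∧ Cond2 R T ξ} =
      {ξ : ℝ | ξ ∈ Icc (0 : ℝ) 1 ∧ Achievable R T ξ} := by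
  rcases lt_or_ge T 0 with hT | hT
  · rw [setOf_eq_singleton_zero (achievable_zero R T) fun ξ hξ =>
        not_achievable_of_neg hR hR2 hT hξ,
      setOf_eq_singleton_zero (P := fun ξ => Cond1 R T ξ ∧ Cond2 R T ξ)
        ⟨cond1_zero R T, cond2_zero R T⟩ fun ξ hξ h => not_cond1_of_neg hT hξ h.1]
  · exact Set.ext fun ξ => and_congr_right fun hξ =>
      (cond_iff_pairExp hR hR2 hT hξ.1).trans (achievable_iff_pairExp hR hR2 hT hξ.1).symm

theorem isGreatest_xiStar {R T : ℝ} (hR : 0 < R) (hR2 : R ≤ Real.log 2) :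
    IsGreatest {ξ : ℝ | ξ ∈ Icc (0 : ℝ) 1 ∧ Achievable R T ξ} (xiStar R T) := by
  unfold xiStar
  rcases lt_or_ge T 0 with hT | hT
  · rw [setOf_eq_singleton_zero (achievable_zero R T) fun ξ hξ =>
      not_achievable_of_neg hR hR2 hT hξ, csSup_singleton]
    exact isGreatest_singleton
  · refine IsCompact.isGreatest_sSup ?_ ⟨0, ⟨le_rfl, zero_le_one⟩, achievable_zero R T⟩
    refine isCompact_Icc.of_isClosed_subset ?_ fun ξ hξ => hξ.1
    rw [show {ξ : ℝ | ξ ∈ Icc (0 : ℝ) 1 ∧ Achievable R T ξ} =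
        {ξ : ℝ | ξ ∈ Icc (0 : ℝ) 1 ∧ ∀ q ∈ Icc (0 : ℝ) 1, ∀ q' ∈ Icc (0 : ℝ) 1,
          pairExp R T (metric R T ξ q) (metric R T ξ q') q q' ≤ 0} from
      Set.ext fun ξ => and_congr_right fun hξ => achievable_iff_pairExp hR hR2 hT hξ.1]
    exact isClosed_setOf_pairExp hR hR2 hT

end ErasureBSC

end

theorem corollary2 (R T : ℝ) (hR : 0 < R) (hR2 : R ≤ Real.log 2) :
    IsGreatest {ξ : ℝ | ξ ∈ Set.Icc (0 : ℝ) 1 ∧ ErasureBSC.Achievable R T ξ}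
        (ErasureBSC.xiStar R T) ∧
      IsGreatest {ξ : ℝ | ξ ∈ Set.Icc (0 : ℝ) 1 ∧ ErasureBSC.Cond1 R T ξ ∧ ErasureBSC.Cond2 R T ξ}
        (ErasureBSC.xiStar R T) :=
  ⟨ErasureBSC.isGreatest_xiStar hR hR2,
    (ErasureBSC.setOf_cond_eq_setOf_achievable hR hR2).symm ▸
      ErasureBSC.isGreatest_xiStar hR hR2⟩
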